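/- **Theorem (high-dimensional landscape, orthogonal dictionary).** For $\mu>0$ let $h_\mu(z)=\mu\log\cosh(z/\mu)$. For integers $n,p\ge 1$ and a matrix $\mathbf X_0\in\mathbb R^{n\times p}$ with columns $(\mathbf x_0)_1,\dots,(\mathbf x_0)_p$, put $\mathbf q(\mathbf w)=\big(\mathbf w,\sqrt{1-\|\mathbf w\|^2}\big)\in\mathbb R^n$ for $\mathbf w\in\mathbb R^{n-1}$, $\|\mathbf w\|\le 1$, and $$g(\mathbf w;\mathbf X_0)=\frac1p\sum_{k=1}^p h_\mu\big(\mathbf q(\mathbf w)^*(\mathbf x_0)_k\big),\qquad \Gamma=\Big\{\mathbf w\in\mathbb R^{n-1}:\ \|\mathbf w\|<\sqrt{\tfrac{4n-1}{4n}}\Big\},$$ where $\|\cdot\|$ is the Euclidean norm. (This is the objective for the dictionary $\mathbf A_0=\mathbf I$, with data $\mathbf Y=\mathbf A_0\mathbf X_0=\mathbf X_0$.) Let $\mathrm{BG}(\theta)$ be the law of $B\cdot G$ with $B\sim\mathrm{Ber}(\theta)$ and $G\sim\mathcal N(0,1)$ independent. There exist positive numerical constants $c_\star, C, c_a, c_b,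 c_c, c_d, c_e$ such that the following holds for all integers $n\ge1$, $p \ge 1$, every $\theta\in(0,1/2)$ and every $\mu$ with $0<\mu<\min\{c_a\theta n^{-1},\,c_b n^{-5/4}\}$: if $$p\ \ge\ \frac{C}{\mu^2\theta^2}\,n^3\log\frac{n}{\mu\theta}$$ and the entries of $\mathbf X_0$ are i.i.d. $\mathrm{BG}(\theta)$, then, with failure probability at most $$4np^{-10}+\theta(np)^{-7}+\exp(-0.3\,\theta np)+c_d\exp\!\big(-c_e\,p\mu^2\theta^2/n^2\big),$$ all of the following hold simultaneously: 1. $\nabla^2 g(\mathbf w;\mathbf X_0)\succeq \frac{c_\star\theta}{\mu}\mathbf I$ for all $\mathbf w$ with $\|\mathbf w\|\le\frac{\mu}{4\sqrt2}$; 2. $\dfrac{\mathbf w^*\nabla g(\mathbf w;\mathbf X_0)}{\|\mathbf w\|}\ge c_\star\theta$ for all $\mathbf w$ with $\frac{\mu}{4\sqrt2}\le\|\mathbf w\|\le\frac1{20\sqrt5}$; 3. $\dfrac{\mathbf w^*\nabla^2 g(\mathbf w;\mathbf X_0)\mathbf w}{\|\mathbf w\|^2}\le -c_\star\theta$ for all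 $\mathbf w$ with $\frac1{20\sqrt5}\le\|\mathbf w\|\le\sqrt{\frac{4n-1}{4n}}$; 4. $g(\cdot;\mathbf X_0)$ has exactly one local minimizer $\mathbf w_\star$ over the open set $\Gamma$, and $$\|\mathbf w_\star\|\le\min\Big\{\frac{c_c\mu}{\theta}\sqrt{\frac{n\log p}{p}},\ \frac{\mu}{16}\Big\}.$$ -/

import Mathlib

open MeasureTheory ProbabilityTheory

noncomputable section

/-- The Bernoulli-Gaussian law `BG(θ)`: the law of `B * G` with `B ~ Ber(θ)` and
`G ~ N(0, 1)` independent. -/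
def bernoulliGaussian (θ : unitInterval) : Measure ℝ :=
  ((bernoulliMeasure (1 : ℝ) 0 θ).prod (gaussianReal 0 1)).map (fun z => z.1 * z.2)

/-- The log-cosh surrogate `h_μ(z) = μ log cosh (z / μ)` of the absolute value. -/
def logCosh (μ z : ℝ) : ℝ :=
  μ * Real.log (Real.cosh (z / μ))

/-- The objective `f(q; Y) = (1 / p) ∑ₖ h_μ(q* yₖ)`, where `yₖ` is the `k`-th column of `Y`. -/
def sphereObjective {n p : ℕ} (μ : ℝ) (Y : Matrix (Fin n) (Fin p) ℝ)
    (q : EuclideanSpace ℝ (Fin n)) : ℝ :=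
  (1 / (p : ℝ)) * ∑ k, logCosh μ (∑ i, q i * Y i k)

/-- The reparametrization `q(w) = (w, √(1 - ‖w‖²))` of the upper hemisphere of the unit sphere of
`ℝ^(d+1)` by the unit ball of `ℝ^d`. -/
def liftToSphere {d : ℕ} (w : EuclideanSpace ℝ (Fin d)) : EuclideanSpace ℝ (Fin (d + 1)) :=
  WithLp.toLp 2 (Fin.snoc (α := fun _ => ℝ) (fun i => w i) (Real.sqrt (1 - ‖w‖ ^ 2)))

/-- The reparametrized objective `g(w; Y) = f(q(w); Y)`. -/
def chartObjective {d p : ℕ} (μ : ℝ) (Y : Matrix (Fin (d + 1)) (Fin p) ℝ)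
    (w : EuclideanSpace ℝ (Fin d)) : ℝ :=
  sphereObjective μ Y (liftToSphere w)

/-- The Hessian of a function on `ℝ^d`, as the operator `v ↦ D(∇g)(w) v`. -/
def hessian {d : ℕ} (g : EuclideanSpace ℝ (Fin d) → ℝ) (w : EuclideanSpace ℝ (Fin d)) :
    EuclideanSpace ℝ (Fin d) →L[ℝ] EuclideanSpace ℝ (Fin d) :=
  fderiv ℝ (gradient g) w

/-- The open ball `Γ = {w : ‖w‖ < √((4n - 1) / (4n))}` of `ℝ^(n-1)`, with `n = d + 1`. -/
def chartDomain (d : ℕ) : Set (EuclideanSpace ℝ (Fin d)) :=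
  {w | ‖w‖ < Real.sqrt ((4 * ((d + 1 : ℕ) : ℝ) - 1) / (4 * ((d + 1 : ℕ) : ℝ)))}

end

/-! Everything about the landscape that matters is carried by averages over the columns of a few
explicit functions of one column `x`: the nonnegative part of the Hessian form (`curvatureTerm`),
the radial derivative (`radialGradTerm`) and the second derivative in the radial direction
(`radialHessTerm`). Their means have the right sign in the three regions, they concentrate, and a
fine net makes the concentration uniform. The rest is deterministic.

Means. Write `x` as a Bernoulli mask times a Gaussian vector, and `q` for the height of the lift.
Near the origin and on the intermediate shell the main contribution comes from the event that the
last entry vanishes, which has probability `1 - θ ≥ 1/2`. There the argument of `tanh` is the linear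
form of `w`, and a Taylor bound on `tanh` reduces the estimate to second and fourth moments
(`le_integral_curvatureTerm`, `le_integral_radialGradTerm`). On the outer shell one conditions on
the mask. If the last entry is active, splitting the last Gaussian coordinate into its projection on
the linear form and an independent remainder, followed by Stein's identity, gives an exact formula
(`integral_radial_gaussian`). It is negative in proportion to the mass of `w` on inactive
coordinates. If the last entry is inactive, the contribution is at most `μ` per active coordinate,
which is negligible since `μ n` is small (`integral_radialHessTerm_le`).

Concentration. Chernoff bounds give lower tails with exponents of order `pθ`, `pθ²` and `pθ²μ²/n²`.
On the event that all entries are at most `p`, each summand is Lipschitz in its parameters with a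
constant that is a power of `p`. A net of mesh `p⁻⁷²` has at most `p^(75d)` points, so the union
bound costs a factor `exp(O(n log p))`, which the sample size absorbs
(`exists_exceptional_set_goodColumns`, `failure_probability_le`).

Landscape. On good data the positive curvature term, of order `θ/μ`, dominates the bounded negative
part of the Hessian near the origin, so `g` is strongly convex there. The positive radial derivative
and the negative radial curvature exclude local minima elsewhere. The minimizer over the small ball
is therefore the only one, and strong monotonicity of the gradient bounds its norm by the gradient
at the origin, whose coordinates are sums of independent centered sub-Gaussian variables
(`exists_unique_isLocalMinOn_ball`, `GoodColumns.landscape`). -/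

/-! ### Elementary inequalities for the hyperbolic tangent. -/

theorem Real.one_sub_tanh_sq (x : ℝ) : 1 - Real.tanh x ^ 2 = 1 / Real.cosh x ^ 2 := by
  have h := (Real.cosh_pos x).ne'
  rw [Real.tanh_eq_sinh_div_cosh, div_pow, Real.sinh_sq]
  field_simp
  ring

theorem Real.hasDerivAt_tanh (x : ℝ) : HasDerivAt Real.tanh (1 - Real.tanh x ^ 2) x := by
  have h := (Real.cosh_pos x).ne'
  have hd := (Real.hasDerivAt_sinh x).div (Real.hasDerivAt_cosh x) h
  have he : Real.sinh / Real.cosh = Real.tanh := by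
    ext y; simp [Real.tanh_eq_sinh_div_cosh]
  rw [he] at hd
  refine hd.congr_deriv ?_
  rw [Real.tanh_eq_sinh_div_cosh]
  field_simp

theorem Real.hasDerivAt_log_cosh (x : ℝ) :
    HasDerivAt (fun y => Real.log (Real.cosh y)) (Real.tanh x) x := by
  rw [Real.tanh_eq_sinh_div_cosh]
  exact (Real.hasDerivAt_cosh x).log (Real.cosh_pos x).ne'

@[fun_prop]
theorem Real.continuous_tanh' : Continuous Real.tanh :=
  continuous_iff_continuousAt.2 fun x => (Real.hasDerivAt_tanh x).continuousAt

@[fun_prop]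
theorem Real.measurable_tanh' : Measurable Real.tanh := Real.continuous_tanh'.measurable

theorem Real.one_sub_tanh_sq_nonneg (x : ℝ) : 0 ≤ 1 - Real.tanh x ^ 2 := by
  linarith [Real.tanh_sq_lt_one x]

theorem Real.tanh_monotone' : Monotone Real.tanh := by
  refine monotone_of_deriv_nonneg (fun x => (Real.hasDerivAt_tanh x).differentiableAt) fun x => ?_
  rw [(Real.hasDerivAt_tanh x).deriv]
  exact Real.one_sub_tanh_sq_nonneg x

theorem Real.abs_tanh_sub_tanh_le (x y : ℝ) : |Real.tanh x - Real.tanh y| ≤ |x - y| := by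
  have h := convex_univ.norm_image_sub_le_of_norm_hasDerivWithin_le (f := Real.tanh) (C := 1)
    (x := y) (y := x) (fun z _ => (Real.hasDerivAt_tanh z).hasDerivWithinAt)
    (fun z _ => by
      rw [Real.norm_eq_abs, abs_of_nonneg (Real.one_sub_tanh_sq_nonneg z)]
      linarith [sq_nonneg (Real.tanh z)]) (Set.mem_univ _) (Set.mem_univ _)
  simpa using h

theorem Real.abs_tanh_le_abs (x : ℝ) : |Real.tanh x| ≤ |x| := by
  simpa using Real.abs_tanh_sub_tanh_le x 0

theorem Real.tanh_nonneg' {x : ℝ} (hx : 0 ≤ x) : 0 ≤ Real.tanh x := by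
  simpa using Real.tanh_monotone' hx

theorem Real.sub_cube_le_tanh {x : ℝ} (hx : 0 ≤ x) : x - x ^ 3 / 3 ≤ Real.tanh x := by
  have hm : MonotoneOn (fun y => Real.tanh y - (y - y ^ 3 / 3)) (Set.Ici 0) := by
    have hd : ∀ y, HasDerivAt (fun y => Real.tanh y - (y - y ^ 3 / 3))
        ((1 - Real.tanh y ^ 2) - (1 - 3 * y ^ 2 / 3)) y := fun y => by
      exact ((Real.hasDerivAt_tanh y).fun_sub
        ((hasDerivAt_id' y).fun_sub ((hasDerivAt_pow 3 y).div_const 3))).congr_deriv (by simp)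
    refine monotoneOn_of_deriv_nonneg (convex_Ici 0)
      (fun y _ => (hd y).continuousAt.continuousWithinAt)
      (fun y _ => (hd y).differentiableAt.differentiableWithinAt) fun y _ => ?_
    rw [(hd y).deriv]
    have := sq_le_sq.2 (Real.abs_tanh_le_abs y)
    linarith
  have := hm (Set.mem_Ici.2 le_rfl) (Set.mem_Ici.2 hx) hx
  simp at this
  linarith

theorem Real.mul_tanh_mul_abs (K x : ℝ) : x * Real.tanh (K * x) = |x| * Real.tanh (K * |x|) := by
  rcases abs_choice x with h | h <;> rw [h]
  rw [mul_neg, Real.tanh_neg]; ring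

/-- Monotonicity of `tanh` lets a large slope `K` be lowered to a fixed `K₀` before the cubic Taylor
bound is applied, so the quartic error does not grow with `K`. -/
theorem Real.mul_tanh_mul_ge {K K₀ : ℝ} (h0 : 0 ≤ K₀) (hK : K₀ ≤ K) (x : ℝ) :
    K₀ * x ^ 2 - K₀ ^ 3 * x ^ 4 / 3 ≤ x * Real.tanh (K * x) := by
  rw [Real.mul_tanh_mul_abs, ← sq_abs x, ← Even.pow_abs (by decide : Even 4) x]
  have hx := abs_nonneg x
  have h1 := Real.tanh_monotone' (mul_le_mul_of_nonneg_right hK hx)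
  have h2 := Real.sub_cube_le_tanh (mul_nonneg h0 hx)
  calc _ = |x| * (K₀ * |x| - (K₀ * |x|) ^ 3 / 3) := by ring
    _ ≤ _ := mul_le_mul_of_nonneg_left (h2.trans h1) hx

theorem Real.one_add_sq_div_two_le_cosh' (x : ℝ) : 1 + x ^ 2 / 2 ≤ Real.cosh x := by
  have h1 : Real.cosh x = 1 + 2 * Real.sinh (x / 2) ^ 2 := by
    have := Real.cosh_two_mul (x / 2)
    rw [mul_div_cancel₀ _ (two_ne_zero)] at this
    rw [this, Real.cosh_sq]; ring
  have h2 : (x / 2) ^ 2 ≤ Real.sinh (x / 2) ^ 2 := by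
    refine sq_le_sq.2 ?_
    rw [Real.abs_sinh]
    exact Real.self_le_sinh_iff.2 (abs_nonneg _)
  rw [h1]; linarith

theorem Real.sq_mul_one_sub_tanh_sq_le (x : ℝ) : x ^ 2 * (1 - Real.tanh x ^ 2) ≤ 1 := by
  rw [Real.one_sub_tanh_sq, mul_one_div, div_le_one (pow_pos (Real.cosh_pos x) 2)]
  have := Real.one_add_sq_div_two_le_cosh' x
  nlinarith [sq_nonneg x, sq_nonneg (x ^ 2)]

/-- The defect is `|x| (1 - tanh |x|) ≤ |x| (1 - tanh² |x|) = |x| / cosh² |x|`, and `cosh |x| ≥ 1 +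
x²/2` makes this at most 1. -/
theorem Real.abs_sub_one_le_mul_tanh (x : ℝ) : |x| - 1 ≤ x * Real.tanh x := by
  have h := Real.mul_tanh_mul_abs 1 x
  rw [one_mul, one_mul] at h
  rw [h]
  have hx := abs_nonneg x
  have h1 := Real.tanh_nonneg' hx
  have h2 := (Real.tanh_lt_one |x|).le
  have h3 : |x| * (1 - Real.tanh |x| ^ 2) ≤ 1 := by
    rw [Real.one_sub_tanh_sq, mul_one_div, div_le_one (pow_pos (Real.cosh_pos _) 2)]
    have := Real.one_add_sq_div_two_le_cosh' |x|
    nlinarith [sq_nonneg |x|, sq_nonneg (|x| - 1), sq_nonneg (|x| ^ 2)]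
  nlinarith [mul_nonneg hx (mul_nonneg h1 (sub_nonneg.2 h2))]

/-! ### One-dimensional Gaussian and Bernoulli-Gaussian computations -/

theorem integrable_pow_gaussianReal (m : ℝ) (v : NNReal) (k : ℕ) :
    Integrable (fun x : ℝ => x ^ k) (gaussianReal m v) := by
  rcases Nat.eq_zero_or_pos k with rfl | hk
  · simp
  · have h := (memLp_id_gaussianReal (μ := m) (v := v) (k : NNReal)).integrable_norm_pow
      (by simpa using hk.ne')
    refine h.mono' (by fun_prop) (Filter.Eventually.of_forall fun x => ?_)
    simp

/-- Gaussian integration by parts. -/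
theorem integral_mul_gaussianReal_eq_integral_deriv {f f' : ℝ → ℝ}
    (hf : ∀ x, HasDerivAt f (f' x) x) (h0 : Integrable f (gaussianReal 0 1))
    (h1 : Integrable f' (gaussianReal 0 1)) (hx : Integrable (fun x => x * f x) (gaussianReal 0 1)) :
    ∫ x, x * f x ∂gaussianReal 0 1 = ∫ x, f' x ∂gaussianReal 0 1 := by
  have hv : (1 : NNReal) ≠ 0 := one_ne_zero
  have key : ∀ g : ℝ → ℝ, Integrable g (gaussianReal 0 1) →
      Integrable (fun x => gaussianPDFReal 0 1 x * g x) := fun g hg => by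
    rw [gaussianReal_of_var_ne_zero 0 hv,
      integrable_withDensity_iff_integrable_smul' (measurable_gaussianPDF 0 1)
        (Filter.Eventually.of_forall fun _ => gaussianPDF_lt_top)] at hg
    simpa [toReal_gaussianPDF] using hg
  have hpdf : ∀ x, HasDerivAt (gaussianPDFReal 0 1) (-x * gaussianPDFReal 0 1 x) x := fun x => by
    rw [gaussianPDFReal_def]
    have h : HasDerivAt (fun y : ℝ => -(y - 0) ^ 2 / (2 * ((1 : NNReal) : ℝ)))
        (-(2 * x) / 2) x := by
      have := ((((hasDerivAt_id' x).sub_const 0).pow 2).neg).div_const (2 * ((1 : NNReal) : ℝ))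
      refine this.congr_deriv ?_
      simp
    refine (h.exp.const_mul _).congr_deriv ?_
    ring
  have hd : ∀ x, HasDerivAt (fun x => gaussianPDFReal 0 1 x * f x)
      (gaussianPDFReal 0 1 x * f' x - gaussianPDFReal 0 1 x * (x * f x)) x := fun x =>
    ((hpdf x).mul (hf x)).congr_deriv (by ring)
  have hz := integral_eq_zero_of_hasDerivAt_of_integrable hd ((key _ h1).sub (key _ hx)) (key _ h0)
  rw [integral_sub (key _ h1) (key _ hx)] at hz
  rw [integral_gaussianReal_eq_integral_smul hv, integral_gaussianReal_eq_integral_smul hv]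
  simp only [smul_eq_mul]
  linarith

theorem integral_sq_gaussianReal : ∫ x, x ^ 2 ∂gaussianReal 0 1 = 1 := by
  have h := integral_mul_gaussianReal_eq_integral_deriv (f := fun x => x) (f' := fun _ => 1)
    (fun x => hasDerivAt_id' x) (by simpa using integrable_pow_gaussianReal 0 1 1) (by simp)
    (by simpa [← sq] using integrable_pow_gaussianReal 0 1 2)
  simpa [← sq] using h

theorem integral_pow_four_gaussianReal : ∫ x, x ^ 4 ∂gaussianReal 0 1 = 3 := by
  have h := integral_mul_gaussianReal_eq_integral_deriv (f := fun x => x ^ 3)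
    (f' := fun x => 3 * x ^ 2)
    (fun x => by simpa using hasDerivAt_pow 3 x) (integrable_pow_gaussianReal 0 1 3)
    ((integrable_pow_gaussianReal 0 1 2).const_mul 3)
    (by simpa [← pow_succ'] using integrable_pow_gaussianReal 0 1 4)
  rw [integral_const_mul, integral_sq_gaussianReal] at h
  simpa [← pow_succ'] using h

theorem map_sqrt_mul_gaussianReal (v : NNReal) :
    (gaussianReal 0 1).map (fun x => Real.sqrt v * x) = gaussianReal 0 v := by
  rw [gaussianReal_map_const_mul, mul_zero]
  congr 1
  ext; simp

theorem integral_sq_gaussianReal_var (v : NNReal) : ∫ x, x ^ 2 ∂gaussianReal 0 v = v := by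
  rw [← map_sqrt_mul_gaussianReal, integral_map (by fun_prop) (by fun_prop)]
  simp [mul_pow, integral_const_mul, integral_sq_gaussianReal]

theorem integral_pow_four_gaussianReal_var (v : NNReal) :
    ∫ x, x ^ 4 ∂gaussianReal 0 v = 3 * v ^ 2 := by
  rw [← map_sqrt_mul_gaussianReal, integral_map (by fun_prop) (by fun_prop)]
  have : Real.sqrt v ^ 4 = (v : ℝ) ^ 2 := by
    rw [show (4 : ℕ) = 2 * 2 by norm_num, pow_mul, Real.sq_sqrt v.coe_nonneg]
  simp [mul_pow, integral_const_mul, integral_pow_four_gaussianReal, this]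
  ring

theorem integral_abs_gaussianReal_le : ∫ x, |x| ∂gaussianReal 0 1 ≤ 1 := by
  have h1 := integrable_pow_gaussianReal 0 1 1
  have h2 := integrable_pow_gaussianReal 0 1 2
  have : ∫ x, |x| ∂gaussianReal 0 1 ≤ ∫ x, (1 + x ^ 2) / 2 ∂gaussianReal 0 1 := by
    refine integral_mono (by simpa using h1.abs) (((integrable_const 1).add h2).div_const 2)
      fun x => ?_
    nlinarith [sq_abs x, sq_nonneg (|x| - 1)]
  refine this.trans ?_
  rw [integral_div, integral_add (integrable_const 1) h2, integral_sq_gaussianReal]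
  simp

/-- A quartic polynomial minorant of `|x|` suffices: its Gaussian mean is `9/10 - 27/80`, which
exceeds `1/2`. -/
theorem le_integral_abs_gaussianReal : 1 / 2 ≤ ∫ x, |x| ∂gaussianReal 0 1 := by
  have h1 := integrable_pow_gaussianReal 0 1 1
  have h2 := integrable_pow_gaussianReal 0 1 2
  have h4 := integrable_pow_gaussianReal 0 1 4
  have hi : Integrable (fun x : ℝ => (9 / 10) * x ^ 2 - 9 / 80 * x ^ 4) (gaussianReal 0 1) :=
    (h2.const_mul _).sub (h4.const_mul _)
  have : ∫ x, ((9 / 10) * x ^ 2 - 9 / 80 * x ^ 4) ∂gaussianReal 0 1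
      ≤ ∫ x, |x| ∂gaussianReal 0 1 := by
    refine integral_mono hi (by simpa using h1.abs) fun x => ?_
    have h : ∀ y : ℝ, 0 ≤ y → (9 / 10) * y ^ 2 - 9 / 80 * y ^ 4 ≤ y := fun y hy => by
      -- The cubic attains its minimum on the half-line at `y = √(8/3)`, hence the squares centered
      -- at the nearby point `8/5`.
      have : 0 ≤ 1 - (9 / 10) * y + 9 / 80 * y ^ 3 := by
        nlinarith [mul_nonneg hy (sq_nonneg (y - 8 / 5)), sq_nonneg (y - 8 / 5)]
      nlinarith [mul_nonneg hy this]
    have := h |x| (abs_nonneg x)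
    rwa [sq_abs, Even.pow_abs (by decide : Even 4)] at this
  refine le_trans ?_ this
  rw [integral_sub (h2.const_mul _) (h4.const_mul _), integral_const_mul, integral_const_mul,
    integral_sq_gaussianReal, integral_pow_four_gaussianReal]
  norm_num

theorem integrable_exp_sq_gaussianReal :
    Integrable (fun x : ℝ => Real.exp (x ^ 2 / 4)) (gaussianReal 0 1) := by
  have hv : (1 : NNReal) ≠ 0 := one_ne_zero
  rw [gaussianReal_of_var_ne_zero 0 hv,
    integrable_withDensity_iff_integrable_smul' (measurable_gaussianPDF 0 1)
      (Filter.Eventually.of_forall fun _ => gaussianPDF_lt_top)]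
  have := (integrable_exp_neg_mul_sq (b := 1 / 4) (by norm_num)).const_mul
    ((Real.sqrt (2 * Real.pi * (1 : NNReal)))⁻¹)
  refine this.congr (Filter.Eventually.of_forall fun x => ?_)
  simp only [toReal_gaussianPDF, smul_eq_mul, gaussianPDFReal_def, mul_assoc, ← Real.exp_add]
  congr 2
  simp
  ring

theorem integral_exp_sq_gaussianReal_le :
    ∫ x, Real.exp (x ^ 2 / 4) ∂gaussianReal 0 1 ≤ 2 := by
  have hv : (1 : NNReal) ≠ 0 := one_ne_zero
  rw [integral_gaussianReal_eq_integral_smul hv]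
  have : ∀ x : ℝ, gaussianPDFReal 0 1 x • Real.exp (x ^ 2 / 4) =
      (Real.sqrt (2 * Real.pi))⁻¹ * Real.exp (-(1 / 4) * x ^ 2) := fun x => by
    simp only [smul_eq_mul, gaussianPDFReal_def, mul_assoc, ← Real.exp_add]
    simp only [NNReal.coe_one, mul_one]
    congr 2
    ring
  simp_rw [this]
  rw [integral_const_mul, integral_gaussian]
  have h2 : Real.sqrt (Real.pi / (1 / 4)) = Real.sqrt 2 * Real.sqrt (2 * Real.pi) := by
    rw [← Real.sqrt_mul (by norm_num)]; congr 1; ring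
  rw [h2]
  have h3 : Real.sqrt (2 * Real.pi) ≠ 0 := (Real.sqrt_pos.2 (by positivity)).ne'
  field_simp
  rw [Real.sqrt_le_left (by norm_num)]
  norm_num

theorem bernoulliGaussian_eq (θ : unitInterval) :
    bernoulliGaussian θ = unitInterval.toNNReal θ • gaussianReal 0 1 +
      unitInterval.toNNReal (unitInterval.symm θ) • Measure.dirac 0 := by
  rw [bernoulliGaussian, bernoulliMeasure_def]
  ext s hs
  rw [Measure.map_apply (by fun_prop) hs, Measure.prod_apply (by measurability)]
  rw [lintegral_add_measure, lintegral_smul_measure, lintegral_smul_measure, lintegral_dirac,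
    lintegral_dirac]
  have h1 : (Prod.mk (1 : ℝ) ⁻¹' ((fun z : ℝ × ℝ => z.1 * z.2) ⁻¹' s)) = s := by
    ext; simp
  have h0 : gaussianReal 0 1 (Prod.mk (0 : ℝ) ⁻¹' ((fun z : ℝ × ℝ => z.1 * z.2) ⁻¹' s)) =
      Measure.dirac 0 s := by
    rw [Measure.dirac_apply' _ hs]
    by_cases h : (0 : ℝ) ∈ s
    · simp [h, Set.preimage, Set.indicator]
    · simp [h, Set.preimage, Set.indicator]
  rw [h1, h0]
  simp

instance (θ : unitInterval) : IsProbabilityMeasure (bernoulliGaussian θ) :=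
  Measure.isProbabilityMeasure_map (by fun_prop)

theorem integrable_bernoulliGaussian {θ : unitInterval} {f : ℝ → ℝ}
    (hf : Integrable f (gaussianReal 0 1)) : Integrable f (bernoulliGaussian θ) := by
  rw [bernoulliGaussian_eq]
  exact (hf.smul_measure_nnreal).add_measure ((integrable_dirac (by simp)).smul_measure_nnreal)

theorem integral_bernoulliGaussian {θ : unitInterval} {f : ℝ → ℝ}
    (hf : Integrable f (gaussianReal 0 1)) :
    ∫ x, f x ∂bernoulliGaussian θ = θ * ∫ x, f x ∂gaussianReal 0 1 + (1 - θ) * f 0 := by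
  rw [bernoulliGaussian_eq, integral_add_measure hf.smul_measure_nnreal
    ((integrable_dirac (by simp)).smul_measure_nnreal)]
  simp [NNReal.smul_def]

theorem integrable_pow_bernoulliGaussian (θ : unitInterval) (k : ℕ) :
    Integrable (fun x : ℝ => x ^ k) (bernoulliGaussian θ) :=
  integrable_bernoulliGaussian (integrable_pow_gaussianReal 0 1 k)

theorem integrable_abs_bernoulliGaussian (θ : unitInterval) :
    Integrable (fun x : ℝ => |x|) (bernoulliGaussian θ) := by
  simpa using (integrable_pow_bernoulliGaussian θ 1).abs

theorem integral_abs_bernoulliGaussian_le (θ : unitInterval) :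
    ∫ x, |x| ∂bernoulliGaussian θ ≤ θ := by
  rw [integral_bernoulliGaussian (by simpa using (integrable_pow_gaussianReal 0 1 1).abs)]
  have := integral_abs_gaussianReal_le
  have := θ.2.1
  simp
  nlinarith

theorem integrable_exp_mul_bernoulliGaussian (θ : unitInterval) (t : ℝ) :
    Integrable (fun x : ℝ => Real.exp (t * x)) (bernoulliGaussian θ) :=
  integrable_bernoulliGaussian (integrable_exp_mul_gaussianReal t)

theorem hasSubgaussianMGF_bernoulliGaussian (θ : unitInterval) :
    HasSubgaussianMGF (fun x => x) 1 (bernoulliGaussian θ) where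
  integrable_exp_mul t := integrable_exp_mul_bernoulliGaussian θ t
  mgf_le t := by
    rw [mgf, integral_bernoulliGaussian (integrable_exp_mul_gaussianReal t)]
    have h : ∫ x, Real.exp (t * x) ∂gaussianReal 0 1 = Real.exp (t ^ 2 / 2) := by
      simpa [mgf] using congrFun (mgf_fun_id_gaussianReal (μ := 0) (v := 1)) t
    rw [h]
    have h1 : 1 ≤ Real.exp (t ^ 2 / 2) := Real.one_le_exp (by positivity)
    have := θ.2.1
    have := θ.2.2
    simp
    nlinarith

theorem integrable_exp_sq_bernoulliGaussian (θ : unitInterval) :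
    Integrable (fun x : ℝ => Real.exp (x ^ 2 / 4)) (bernoulliGaussian θ) :=
  integrable_bernoulliGaussian integrable_exp_sq_gaussianReal

theorem integral_exp_sq_bernoulliGaussian_le (θ : unitInterval) :
    ∫ x, Real.exp (x ^ 2 / 4) ∂bernoulliGaussian θ ≤ 2 := by
  rw [integral_bernoulliGaussian integrable_exp_sq_gaussianReal]
  have := integral_exp_sq_gaussianReal_le
  have := θ.2.1
  have := θ.2.2
  simp
  nlinarith

/-! ### Random vectors with independent Gaussian or Bernoulli-Gaussian entries -/

section Pi

variable {ι : Type*} [Fintype ι]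

theorem integrable_eval_pi {m : Measure ℝ} [IsProbabilityMeasure m] {f : ℝ → ℝ}
    (hf : Integrable f m) (i : ι) :
    Integrable (fun x : ι → ℝ => f (x i)) (Measure.pi fun _ : ι => m) :=
  ((measurePreserving_eval (fun _ : ι => m) i).integrable_comp hf.aestronglyMeasurable).2 hf

theorem integral_eval_pi {m : Measure ℝ} [IsProbabilityMeasure m] {f : ℝ → ℝ}
    (hf : AEStronglyMeasurable f m) (i : ι) :
    ∫ x : ι → ℝ, f (x i) ∂(Measure.pi fun _ : ι => m) = ∫ x, f x ∂m := by
  have h := measurePreserving_eval (fun _ : ι => m) i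
  have h2 := integral_map (μ := Measure.pi fun _ : ι => m) h.measurable.aemeasurable (f := f)
    (by rwa [h.map_eq])
  rw [h.map_eq] at h2
  exact h2.symm

theorem ae_eval_pi {m : Measure ℝ} [IsProbabilityMeasure m] {p : ℝ → Prop}
    (hp : ∀ᵐ x ∂m, p x) : ∀ᵐ x ∂(Measure.pi fun _ : ι => m), ∀ i, p (x i) :=
  ae_all_iff.2 fun i =>
    (measurePreserving_eval (fun _ : ι => m) i).quasiMeasurePreserving.ae hp

theorem integral_last_mul_head {d : ℕ} {m : Measure ℝ} [IsProbabilityMeasure m] (f : ℝ → ℝ)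
    (h : (Fin d → ℝ) → ℝ) :
    ∫ x : Fin (d + 1) → ℝ, f (x (Fin.last d)) * h (fun i => x i.castSucc)
        ∂(Measure.pi fun _ => m) =
      (∫ t, f t ∂m) * ∫ y, h y ∂(Measure.pi fun _ : Fin d => m) := by
  have hm := measurePreserving_piFinSuccAbove (fun _ : Fin (d + 1) => m) (Fin.last d)
  have := hm.integral_comp' (fun z : ℝ × (Fin d → ℝ) => f z.1 * h z.2)
  rw [integral_prod_mul] at this
  rw [← this]
  refine integral_congr_ae (Filter.Eventually.of_forall fun x => ?_)
  have h1 : (fun i => x (Fin.castSucc i)) =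
      (MeasurableEquiv.piFinSuccAbove (fun _ => ℝ) (Fin.last d) x).2 := by
    ext i
    simp [MeasurableEquiv.piFinSuccAbove, Fin.insertNthEquiv, Fin.init]
  have h2 : x (Fin.last d) = (MeasurableEquiv.piFinSuccAbove (fun _ => ℝ) (Fin.last d) x).1 := by
    simp [MeasurableEquiv.piFinSuccAbove, Fin.insertNthEquiv]
  simp only [← h1, ← h2]

/-- The linear functional with coefficient vector `c`. -/
noncomputable def linForm (c x : ι → ℝ) : ℝ := ∑ i, c i * x i

@[fun_prop]
theorem measurable_linForm (c : ι → ℝ) : Measurable (linForm c) := by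
  unfold linForm; fun_prop

@[fun_prop]
theorem continuous_linForm (c : ι → ℝ) : Continuous (linForm c) := by
  unfold linForm; fun_prop

variable (ι) in
theorem hasGaussianLaw_pi :
    HasGaussianLaw (fun g : ι → ℝ => g) (Measure.pi fun _ : ι => gaussianReal 0 1) := by
  have hi : iIndepFun (fun (i : ι) (g : ι → ℝ) => g i)
      (Measure.pi fun _ : ι => gaussianReal 0 1) :=
    iIndepFun_pi (X := fun _ x => x) fun _ => aemeasurable_id
  refine hi.hasGaussianLaw fun i => ?_
  have hl : HasLaw (fun g : ι → ℝ => g i) (gaussianReal 0 1)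
      (Measure.pi fun _ : ι => gaussianReal 0 1) :=
    (measurePreserving_eval (fun _ : ι => gaussianReal 0 1) i).hasLaw
  exact hl.hasGaussianLaw

theorem memLp_eval_gaussian (i : ι) :
    MemLp (fun g : ι → ℝ => g i) 2 (Measure.pi fun _ : ι => gaussianReal 0 1) :=
  ((hasGaussianLaw_pi ι).eval i).memLp_two

theorem covariance_eval_gaussian [DecidableEq ι] (i j : ι) :
    cov[fun g : ι → ℝ => g i, fun g => g j; Measure.pi fun _ : ι => gaussianReal 0 1] =
      if i = j then 1 else 0 := by
  have hi : iIndepFun (fun (i : ι) (g : ι → ℝ) => g i)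
      (Measure.pi fun _ : ι => gaussianReal 0 1) :=
    iIndepFun_pi (X := fun _ x => x) fun _ => aemeasurable_id
  split_ifs with h
  · subst h
    rw [covariance_self (measurable_pi_apply i).aemeasurable]
    have hl : HasLaw (fun g : ι → ℝ => g i) (gaussianReal 0 1)
        (Measure.pi fun _ : ι => gaussianReal 0 1) :=
      (measurePreserving_eval (fun _ : ι => gaussianReal 0 1) i).hasLaw
    rw [hl.variance_eq, variance_id_gaussianReal]
    simp
  · exact (hi.indepFun h).covariance_eq_zero (memLp_eval_gaussian i) (memLp_eval_gaussian j)

theorem integral_linForm_gaussian (c : ι → ℝ) :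
    ∫ g, linForm c g ∂(Measure.pi fun _ : ι => gaussianReal 0 1) = 0 := by
  unfold linForm
  rw [integral_finsetSum _ fun i _ =>
    ((memLp_eval_gaussian i).integrable (by norm_num)).const_mul (c i)]
  refine Finset.sum_eq_zero fun i _ => ?_
  rw [integral_const_mul, integral_eval_pi (f := fun x => x) (by fun_prop)]
  simp

theorem covariance_linForm_gaussian (c c' : ι → ℝ) :
    cov[linForm c, linForm c'; Measure.pi fun _ : ι => gaussianReal 0 1] = ∑ i, c i * c' i := by
  classical
  unfold linForm
  rw [covariance_fun_sum_fun_sum (fun i => (memLp_eval_gaussian i).const_mul (c i))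
    (fun i => (memLp_eval_gaussian i).const_mul (c' i))]
  simp [covariance_const_mul_left, covariance_const_mul_right, covariance_eval_gaussian, mul_comm]

theorem map_linForm_gaussian (c : ι → ℝ) :
    (Measure.pi fun _ : ι => gaussianReal 0 1).map (linForm c) =
      gaussianReal 0 (∑ i, c i ^ 2).toNNReal := by
  let L : (ι → ℝ) →L[ℝ] ℝ := ∑ i, c i • ContinuousLinearMap.proj i
  have h := (hasGaussianLaw_pi ι).map_fun L
  have hL : (fun g => L g) = linForm c := by
    ext g; simp [L, linForm]
  rw [hL] at h
  rw [h.map_eq_gaussianReal, integral_linForm_gaussian, ← covariance_self (by fun_prop),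
    covariance_linForm_gaussian]
  simp_rw [sq]

theorem indepFun_linForm_gaussian {c c' : ι → ℝ} (h : ∑ i, c i * c' i = 0) :
    IndepFun (linForm c) (linForm c') (Measure.pi fun _ : ι => gaussianReal 0 1) := by
  let L : (ι → ℝ) → (ι → ℝ) →L[ℝ] ℝ := fun c => ∑ i, c i • ContinuousLinearMap.proj i
  have h1 := (hasGaussianLaw_pi ι).map_fun ((L c).prod (L c'))
  have hL : (fun g => ((L c).prod (L c')) g) = fun g => (linForm c g, linForm c' g) := by
    ext g <;> simp [L, linForm]
  rw [hL] at h1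
  exact h1.indepFun_of_covariance_eq_zero (by rw [covariance_linForm_gaussian, h])

theorem integral_comp_linForm_gaussian (c : ι → ℝ) {f : ℝ → ℝ} (hf : Measurable f) :
    ∫ g, f (linForm c g) ∂(Measure.pi fun _ : ι => gaussianReal 0 1) =
      ∫ x, f x ∂gaussianReal 0 (∑ i, c i ^ 2).toNNReal := by
  rw [← map_linForm_gaussian, integral_map (by fun_prop) hf.aestronglyMeasurable]

theorem integrable_linForm_pow_gaussian (c : ι → ℝ) (k : ℕ) :
    Integrable (fun g => linForm c g ^ k) (Measure.pi fun _ : ι => gaussianReal 0 1) := by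
  have h := integrable_pow_gaussianReal 0 (∑ i, c i ^ 2).toNNReal k
  rw [← map_linForm_gaussian, integrable_map_measure (by fun_prop) (by fun_prop)] at h
  exact h

end Pi

section BernoulliGaussianVector

variable {ι : Type*} [Fintype ι]

variable (ι) in
theorem map_mul_pi_bernoulli_gaussian (θ : unitInterval) :
    ((Measure.pi fun _ : ι => bernoulliMeasure (1 : ℝ) 0 θ).prod
      (Measure.pi fun _ : ι => gaussianReal 0 1)).map (fun z => fun i => z.1 i * z.2 i) =
      Measure.pi fun _ : ι => bernoulliGaussian θ := by
  have hm := measurePreserving_arrowProdEquivProdArrow ℝ ℝ ι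
    (fun _ => bernoulliMeasure (1 : ℝ) 0 θ) (fun _ => gaussianReal 0 1)
  rw [← hm.map_eq, Measure.map_map (by fun_prop) hm.measurable]
  unfold bernoulliGaussian
  rw [← Measure.pi_map_pi (fun _ => by fun_prop)]
  rfl

/-- Conditioning on the mask `b`: once it is frozen, a linear form with coefficients `c i` is
Gaussian with coefficients `c i * b i`. -/
theorem integral_pi_bernoulliGaussian {θ : unitInterval} {F : (ι → ℝ) → ℝ}
    (hF : Integrable F (Measure.pi fun _ : ι => bernoulliGaussian θ)) :
    ∫ x, F x ∂(Measure.pi fun _ : ι => bernoulliGaussian θ) =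
      ∫ b : ι → ℝ, ∫ g : ι → ℝ, F (fun i => b i * g i) ∂(Measure.pi fun _ : ι => gaussianReal 0 1)
        ∂(Measure.pi fun _ : ι => bernoulliMeasure (1 : ℝ) 0 θ) := by
  rw [← map_mul_pi_bernoulli_gaussian] at hF ⊢
  rw [integral_map (by fun_prop) hF.1]
  rw [integrable_map_measure hF.1 (by fun_prop)] at hF
  exact integral_prod _ hF

theorem ae_bernoulli_eq_zero_or_one (θ : unitInterval) :
    ∀ᵐ b ∂(Measure.pi fun _ : ι => bernoulliMeasure (1 : ℝ) 0 θ), ∀ i, b i = 0 ∨ b i = 1 := by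
  refine ae_eval_pi (p := fun x => x = 0 ∨ x = 1) ?_
  rw [bernoulliMeasure_def, ae_add_measure_iff]
  refine ⟨Measure.ae_smul_measure ?_ _, Measure.ae_smul_measure ?_ _⟩ <;> simp [ae_dirac_eq]

theorem integral_eval_bernoulli (θ : unitInterval) (f : ℝ → ℝ) (hf : Measurable f) (i : ι) :
    ∫ b : ι → ℝ, f (b i) ∂(Measure.pi fun _ : ι => bernoulliMeasure (1 : ℝ) 0 θ) =
      θ * f 1 + (1 - θ) * f 0 := by
  rw [integral_eval_pi hf.aestronglyMeasurable, integral_bernoulliMeasure]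
  simp

theorem integrable_eval_bernoulli (θ : unitInterval) (f : ℝ → ℝ) (i : ι) :
    Integrable (fun b : ι → ℝ => f (b i))
      (Measure.pi fun _ : ι => bernoulliMeasure (1 : ℝ) 0 θ) :=
  integrable_eval_pi (integrable_bernoulliMeasure 1 0 θ f) i

theorem hasSubgaussianMGF_linForm (θ : unitInterval) (c : ι → ℝ) :
    HasSubgaussianMGF (linForm c) (∑ i, c i ^ 2).toNNReal
      (Measure.pi fun _ : ι => bernoulliGaussian θ) := by
  have hi : iIndepFun (fun (i : ι) (x : ι → ℝ) => c i * x i)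
      (Measure.pi fun _ : ι => bernoulliGaussian θ) :=
    iIndepFun_pi (X := fun i x => c i * x) fun _ => by fun_prop
  have h := HasSubgaussianMGF.sum_of_iIndepFun hi (s := Finset.univ)
    (c := fun i => NNReal.mk (c i ^ 2) (sq_nonneg _) * 1) (fun i _ => by
      have h1 : HasSubgaussianMGF (fun x : ι → ℝ => x i) 1
          (Measure.pi fun _ : ι => bernoulliGaussian θ) := by
        have he := measurePreserving_eval (fun _ : ι => bernoulliGaussian θ) i
        have h2 := hasSubgaussianMGF_bernoulliGaussian θ
        rw [← he.map_eq] at h2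
        exact HasSubgaussianMGF.of_map he.measurable.aemeasurable h2
      exact h1.const_mul (c i))
  have hs : (∑ i, NNReal.mk (c i ^ 2) (sq_nonneg _) * 1) = (∑ i, c i ^ 2).toNNReal := by
    ext
    rw [Real.coe_toNNReal _ (Finset.sum_nonneg fun i _ => sq_nonneg _)]
    push_cast
    simp
  rw [hs] at h
  exact h

theorem integrable_linForm_pow (θ : unitInterval) (c : ι → ℝ) (k : ℕ) :
    Integrable (fun x => linForm c x ^ k) (Measure.pi fun _ : ι => bernoulliGaussian θ) := by
  rcases Nat.eq_zero_or_pos k with rfl | hk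
  · simp
  · have h := ((hasSubgaussianMGF_linForm θ c).memLp (k : NNReal)).integrable_norm_pow
      (by simpa using hk.ne')
    exact h.mono' (by fun_prop) (Filter.Eventually.of_forall fun x => by simp)

theorem integral_linForm_sq (θ : unitInterval) (c : ι → ℝ) :
    ∫ x, linForm c x ^ 2 ∂(Measure.pi fun _ : ι => bernoulliGaussian θ) = θ * ∑ i, c i ^ 2 := by
  rw [integral_pi_bernoulliGaussian (integrable_linForm_pow θ c 2)]
  have h : ∀ b : ι → ℝ, ∫ g : ι → ℝ, linForm c (fun i => b i * g i) ^ 2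
      ∂(Measure.pi fun _ : ι => gaussianReal 0 1) = ∑ i, c i ^ 2 * b i ^ 2 := fun b => by
    have := integral_comp_linForm_gaussian (fun i => c i * b i) (f := fun x => x ^ 2) (by fun_prop)
    rw [integral_sq_gaussianReal_var,
      Real.coe_toNNReal _ (Finset.sum_nonneg fun i _ => sq_nonneg _)] at this
    simp only [mul_pow] at this
    rw [← this]
    simp only [linForm, mul_assoc]
  simp_rw [h]
  rw [integral_finsetSum _ fun i _ =>
    (integrable_eval_bernoulli θ (fun x => x ^ 2) i).const_mul _, Finset.mul_sum]
  refine Finset.sum_congr rfl fun i _ => ?_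
  rw [integral_const_mul, integral_eval_bernoulli θ (fun x => x ^ 2) (by fun_prop)]
  ring

/-- Given the mask, the fourth moment is three times the squared variance. One variance factor is
bounded by its unmasked value and the other is averaged, so the bound stays linear in `θ`. -/
theorem integral_linForm_pow_four_le (θ : unitInterval) (c : ι → ℝ) :
    ∫ x, linForm c x ^ 4 ∂(Measure.pi fun _ : ι => bernoulliGaussian θ) ≤
      3 * θ * (∑ i, c i ^ 2) ^ 2 := by
  rw [integral_pi_bernoulliGaussian (integrable_linForm_pow θ c 4)]
  have h : ∀ b : ι → ℝ, ∫ g : ι → ℝ, linForm c (fun i => b i * g i) ^ 4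
      ∂(Measure.pi fun _ : ι => gaussianReal 0 1) = 3 * (∑ i, c i ^ 2 * b i ^ 2) ^ 2 := fun b => by
    have := integral_comp_linForm_gaussian (fun i => c i * b i) (f := fun x => x ^ 4) (by fun_prop)
    rw [integral_pow_four_gaussianReal_var,
      Real.coe_toNNReal _ (Finset.sum_nonneg fun i _ => sq_nonneg _)] at this
    simp only [mul_pow] at this
    rw [← this]
    simp only [linForm, mul_assoc]
  simp_rw [h]
  have hint : Integrable (fun b : ι → ℝ => ∑ i, c i ^ 2 * b i ^ 2)
      (Measure.pi fun _ : ι => bernoulliMeasure (1 : ℝ) 0 θ) :=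
    integrable_finsetSum _ fun i _ =>
      (integrable_eval_bernoulli θ (fun x => x ^ 2) i).const_mul _
  have hle : ∀ᵐ b ∂(Measure.pi fun _ : ι => bernoulliMeasure (1 : ℝ) 0 θ),
      3 * (∑ i, c i ^ 2 * b i ^ 2) ^ 2 ≤
        3 * (∑ i, c i ^ 2) * ∑ i, c i ^ 2 * b i ^ 2 := by
    filter_upwards [ae_bernoulli_eq_zero_or_one θ] with b hb
    have h0 : 0 ≤ ∑ i, c i ^ 2 * b i ^ 2 := Finset.sum_nonneg fun i _ => by positivity
    have h1 : ∑ i, c i ^ 2 * b i ^ 2 ≤ ∑ i, c i ^ 2 := Finset.sum_le_sum fun i _ => by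
      rcases hb i with h | h <;> simp [h, sq_nonneg]
    nlinarith
  refine (integral_mono_of_nonneg (Filter.Eventually.of_forall fun b => by positivity)
    (hint.const_mul _) hle).trans (le_of_eq ?_)
  rw [integral_const_mul, integral_finsetSum _ fun i _ =>
    (integrable_eval_bernoulli θ (fun x => x ^ 2) i).const_mul _]
  have : ∀ i, ∫ b : ι → ℝ, c i ^ 2 * b i ^ 2
      ∂(Measure.pi fun _ : ι => bernoulliMeasure (1 : ℝ) 0 θ) = θ * c i ^ 2 := fun i => by
    rw [integral_const_mul, integral_eval_bernoulli θ (fun x => x ^ 2) (by fun_prop)]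
    ring
  simp_rw [this, ← Finset.mul_sum]
  ring

theorem integral_linForm (θ : unitInterval) (c : ι → ℝ) :
    ∫ x, linForm c x ∂(Measure.pi fun _ : ι => bernoulliGaussian θ) = 0 := by
  rw [integral_pi_bernoulliGaussian (by simpa using integrable_linForm_pow θ c 1)]
  have h : ∀ b : ι → ℝ, ∫ g : ι → ℝ, linForm c (fun i => b i * g i)
      ∂(Measure.pi fun _ : ι => gaussianReal 0 1) = 0 := fun b => by
    simpa only [linForm, mul_assoc] using integral_linForm_gaussian (fun i => c i * b i)
  simp_rw [h, integral_zero]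

theorem integrable_exp_abs_linForm (θ : unitInterval) (c : ι → ℝ) (t : ℝ) :
    Integrable (fun x => Real.exp (t * |linForm c x|))
      (Measure.pi fun _ : ι => bernoulliGaussian θ) := by
  have h := hasSubgaussianMGF_linForm θ c
  refine ((h.integrable_exp_mul t).add (h.integrable_exp_mul (-t))).mono' (by fun_prop)
    (Filter.Eventually.of_forall fun x => ?_)
  simp only [Pi.add_apply, Real.norm_eq_abs, Real.abs_exp]
  rcases abs_choice (linForm c x) with h | h <;> rw [h]
  · linarith [Real.exp_pos (-t * linForm c x)]
  · rw [mul_neg, ← neg_mul]; linarith [Real.exp_pos (t * linForm c x)]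

theorem integral_exp_abs_linForm_le (θ : unitInterval) (c : ι → ℝ) (t : ℝ) :
    ∫ x, Real.exp (t * |linForm c x|) ∂(Measure.pi fun _ : ι => bernoulliGaussian θ) ≤
      2 * Real.exp ((∑ i, c i ^ 2) * t ^ 2 / 2) := by
  have h := hasSubgaussianMGF_linForm θ c
  have h1 := h.mgf_le t
  have h2 := h.mgf_le (-t)
  rw [Real.coe_toNNReal _ (Finset.sum_nonneg fun i _ => sq_nonneg _)] at h1 h2
  rw [neg_sq] at h2
  rw [mgf] at h1 h2
  have hle := integral_mono (integrable_exp_abs_linForm θ c t)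
    ((h.integrable_exp_mul t).add (h.integrable_exp_mul (-t))) (fun x => by
      simp only [Pi.add_apply]
      rcases abs_choice (linForm c x) with h | h <;> rw [h]
      · linarith [Real.exp_pos (-t * linForm c x)]
      · rw [mul_neg, ← neg_mul]; linarith [Real.exp_pos (t * linForm c x)])
  rw [integral_add' (h.integrable_exp_mul t) (h.integrable_exp_mul (-t))] at hle
  linarith

end BernoulliGaussianVector

/-! ### The summands of the radial gradient and of the Hessian quadratic forms -/

section Terms

variable {d : ℕ}

/-- The inner product of `w` with the first `d` coordinates of `x`. -/
noncomputable def headDot (w : EuclideanSpace ℝ (Fin d)) (x : Fin (d + 1) → ℝ) : ℝ :=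
  ∑ i, w i * x i.castSucc

/-- The last coordinate of the lift of `w` to the sphere. -/
noncomputable def liftHeight (w : EuclideanSpace ℝ (Fin d)) : ℝ := Real.sqrt (1 - ‖w‖ ^ 2)

/-- The inner product of `x` with the lift of `w` to the sphere. -/
noncomputable def liftDot (w : EuclideanSpace ℝ (Fin d)) (x : Fin (d + 1) → ℝ) : ℝ :=
  headDot w x + liftHeight w * x (Fin.last d)

/-- The derivative of the summand `w ↦ logCosh μ (liftDot w x)` at `w` in direction `w`. -/
noncomputable def radialGradTerm (μ : ℝ) (w : EuclideanSpace ℝ (Fin d)) (x : Fin (d + 1) → ℝ) : ℝ :=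
  Real.tanh (liftDot w x / μ) * (headDot w x - ‖w‖ ^ 2 / liftHeight w * x (Fin.last d))

/-- The nonnegative part of the second derivative of `w ↦ logCosh μ (liftDot w x)` at `w` in
direction `v`. -/
noncomputable def curvatureTerm (μ : ℝ) (w v : EuclideanSpace ℝ (Fin d)) (x : Fin (d + 1) → ℝ) :
    ℝ :=
  (1 - Real.tanh (liftDot w x / μ) ^ 2) / μ *
    (headDot v x - inner ℝ w v / liftHeight w * x (Fin.last d)) ^ 2

/-- The second derivative of `w ↦ logCosh μ (liftDot w x)` at `w` in direction `w`. -/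
noncomputable def radialHessTerm (μ : ℝ) (w : EuclideanSpace ℝ (Fin d)) (x : Fin (d + 1) → ℝ) : ℝ :=
  (1 - Real.tanh (liftDot w x / μ) ^ 2) / μ * (liftDot w x - x (Fin.last d) / liftHeight w) ^ 2 -
    ‖w‖ ^ 2 / liftHeight w ^ 3 * (x (Fin.last d) * Real.tanh (liftDot w x / μ))

@[fun_prop]
theorem measurable_headDot (w : EuclideanSpace ℝ (Fin d)) : Measurable (headDot w) := by
  unfold headDot; fun_prop

@[fun_prop]
theorem measurable_liftDot (w : EuclideanSpace ℝ (Fin d)) : Measurable (liftDot w) := by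
  unfold liftDot; fun_prop

@[fun_prop]
theorem measurable_radialGradTerm (μ : ℝ) (w : EuclideanSpace ℝ (Fin d)) :
    Measurable (radialGradTerm μ w) := by
  unfold radialGradTerm; fun_prop

@[fun_prop]
theorem measurable_curvatureTerm (μ : ℝ) (w v : EuclideanSpace ℝ (Fin d)) :
    Measurable (curvatureTerm μ w v) := by
  unfold curvatureTerm; fun_prop

@[fun_prop]
theorem measurable_radialHessTerm (μ : ℝ) (w : EuclideanSpace ℝ (Fin d)) :
    Measurable (radialHessTerm μ w) := by
  unfold radialHessTerm; fun_prop

theorem headDot_add_mul_last (v : EuclideanSpace ℝ (Fin d)) (a : ℝ) (x : Fin (d + 1) → ℝ) :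
    headDot v x + a * x (Fin.last d) =
      linForm (Fin.snoc (α := fun _ => ℝ) (fun i => v i) a) x := by
  simp [headDot, linForm, Fin.sum_univ_castSucc]

theorem sum_sq_snoc (v : EuclideanSpace ℝ (Fin d)) (a : ℝ) :
    ∑ i, (Fin.snoc (α := fun _ => ℝ) (fun i => v i) a : Fin (d + 1) → ℝ) i ^ 2 =
      ‖v‖ ^ 2 + a ^ 2 := by
  simp [Fin.sum_univ_castSucc, EuclideanSpace.real_norm_sq_eq]

theorem integrable_last {m : Measure ℝ} [IsProbabilityMeasure m] {f : ℝ → ℝ} (hf : Integrable f m) :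
    Integrable (fun x : Fin (d + 1) → ℝ => f (x (Fin.last d))) (Measure.pi fun _ => m) :=
  integrable_eval_pi hf _

/-- The indicator function of `{0}`. -/
noncomputable def zeroIndicator (t : ℝ) : ℝ := if t = 0 then 1 else 0

@[fun_prop]
theorem measurable_zeroIndicator : Measurable zeroIndicator :=
  Measurable.ite (measurableSet_singleton 0) measurable_const measurable_const

theorem abs_zeroIndicator_le (t : ℝ) : |zeroIndicator t| ≤ 1 := by
  unfold zeroIndicator; split_ifs <;> simp

theorem integral_zeroIndicator_bernoulliGaussian (θ : unitInterval) :
    ∫ t, zeroIndicator t ∂bernoulliGaussian θ = 1 - θ := by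
  have h : zeroIndicator =ᵐ[gaussianReal 0 1] fun _ => 0 := by
    have : NullSingletonClass (gaussianReal 0 1) := nullSingletonClass_gaussianReal one_ne_zero
    filter_upwards [measure_eq_zero_iff_ae_notMem.1 (measure_singleton (μ := gaussianReal 0 1) 0)]
      with t ht
    exact if_neg (by simpa using ht)
  rw [integral_bernoulliGaussian ((integrable_zero _ _ _).congr h.symm), integral_congr_ae h]
  simp [zeroIndicator]

theorem integrable_headDot_pow (θ : unitInterval) (v : EuclideanSpace ℝ (Fin d)) (k : ℕ) :
    Integrable (fun x => headDot v x ^ k) (Measure.pi fun _ => bernoulliGaussian θ) := by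
  have h := integrable_linForm_pow θ (Fin.snoc (α := fun _ => ℝ) (fun i => v i) 0) k
  simpa [← headDot_add_mul_last] using h

/-- Independence of the last coordinate and the others. -/
theorem integral_last_mul_headDot (θ : unitInterval) (f h : ℝ → ℝ)
    (v : EuclideanSpace ℝ (Fin d)) :
    ∫ x : Fin (d + 1) → ℝ, f (x (Fin.last d)) * h (headDot v x)
        ∂(Measure.pi fun _ => bernoulliGaussian θ) =
      (∫ t, f t ∂bernoulliGaussian θ) *
        ∫ y, h (linForm (fun i => v i) y) ∂(Measure.pi fun _ : Fin d => bernoulliGaussian θ) :=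
  integral_last_mul_head f (fun y => h (linForm (fun i => v i) y))

theorem integrable_last_mul_headDot_pow (θ : unitInterval) {f : ℝ → ℝ} (hf : Measurable f)
    (hb : ∀ t, |f t| ≤ 1) (v : EuclideanSpace ℝ (Fin d)) (k : ℕ) :
    Integrable (fun x : Fin (d + 1) → ℝ => f (x (Fin.last d)) * headDot v x ^ k)
      (Measure.pi fun _ => bernoulliGaussian θ) :=
  (integrable_headDot_pow θ v k).bdd_mul (c := 1)
    (hf.comp (measurable_pi_apply (Fin.last d))).aestronglyMeasurable
    (Filter.Eventually.of_forall fun _ => hb _)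

/-! ### Curvature near the origin -/

theorem curvatureTerm_nonneg {μ : ℝ} (hμ : 0 < μ) (w v : EuclideanSpace ℝ (Fin d))
    (x : Fin (d + 1) → ℝ) : 0 ≤ curvatureTerm μ w v x :=
  mul_nonneg (div_nonneg (Real.one_sub_tanh_sq_nonneg _) hμ.le) (sq_nonneg _)

theorem curvatureTerm_le {μ : ℝ} (hμ : 0 < μ) (w v : EuclideanSpace ℝ (Fin d))
    (x : Fin (d + 1) → ℝ) :
    curvatureTerm μ w v x ≤ 1 / μ *
      linForm (Fin.snoc (α := fun _ => ℝ) (fun i => v i) (-(inner ℝ w v / liftHeight w))) x ^ 2 := by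
  rw [← headDot_add_mul_last, neg_mul, ← sub_eq_add_neg]
  refine mul_le_mul_of_nonneg_right ?_ (sq_nonneg _)
  gcongr
  linarith [sq_nonneg (Real.tanh (liftDot w x / μ))]

theorem integrable_curvatureTerm (θ : unitInterval) {μ : ℝ} (hμ : 0 < μ)
    (w v : EuclideanSpace ℝ (Fin d)) :
    Integrable (curvatureTerm μ w v) (Measure.pi fun _ => bernoulliGaussian θ) :=
  ((integrable_linForm_pow θ _ 2).const_mul (1 / μ)).mono' (by fun_prop)
    (Filter.Eventually.of_forall fun x => by
      rw [Real.norm_eq_abs, abs_of_nonneg (curvatureTerm_nonneg hμ w v x)]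
      exact curvatureTerm_le hμ w v x)

theorem curvatureTerm_sq_le {μ : ℝ} (hμ : 0 < μ) (w v : EuclideanSpace ℝ (Fin d))
    (x : Fin (d + 1) → ℝ) :
    curvatureTerm μ w v x ^ 2 ≤ (1 / μ) ^ 2 *
      linForm (Fin.snoc (α := fun _ => ℝ) (fun i => v i) (-(inner ℝ w v / liftHeight w))) x ^ 4 := by
  have := pow_le_pow_left₀ (curvatureTerm_nonneg hμ w v x) (curvatureTerm_le hμ w v x) 2
  refine this.trans (le_of_eq ?_)
  rw [mul_pow, ← pow_mul]

theorem integrable_curvatureTerm_sq (θ : unitInterval) {μ : ℝ} (hμ : 0 < μ)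
    (w v : EuclideanSpace ℝ (Fin d)) :
    Integrable (fun x => curvatureTerm μ w v x ^ 2) (Measure.pi fun _ => bernoulliGaussian θ) :=
  ((integrable_linForm_pow θ _ 4).const_mul ((1 / μ) ^ 2)).mono' (by fun_prop)
    (Filter.Eventually.of_forall fun x => by
      rw [Real.norm_eq_abs, abs_of_nonneg (sq_nonneg _)]
      exact curvatureTerm_sq_le hμ w v x)

theorem integral_curvatureTerm_sq_le (θ : unitInterval) {μ : ℝ} (hμ : 0 < μ)
    {w v : EuclideanSpace ℝ (Fin d)} (hv : ‖v‖ = 1) (hw : ‖w‖ ≤ 1 / 2) :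
    ∫ x, curvatureTerm μ w v x ^ 2 ∂(Measure.pi fun _ => bernoulliGaussian θ) ≤
      6 * θ / μ ^ 2 := by
  refine (integral_mono (integrable_curvatureTerm_sq θ hμ w v)
    ((integrable_linForm_pow θ _ 4).const_mul _) (curvatureTerm_sq_le hμ w v)).trans ?_
  rw [integral_const_mul]
  have h1 := integral_linForm_pow_four_le θ
    (Fin.snoc (α := fun _ => ℝ) (fun i => v i) (-(inner ℝ w v / liftHeight w)))
  rw [sum_sq_snoc, hv] at h1
  have hq : liftHeight w ^ 2 = 1 - ‖w‖ ^ 2 := Real.sq_sqrt (by nlinarith [norm_nonneg w])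
  have hwv : |inner ℝ w v| ≤ ‖w‖ := by
    simpa [hv] using abs_real_inner_le_norm w v
  have h2 : (-(inner ℝ w v / liftHeight w)) ^ 2 ≤ 1 / 3 := by
    rw [neg_sq, div_pow, hq, div_le_div_iff₀ (by nlinarith [norm_nonneg w]) (by norm_num)]
    have := sq_le_sq' (by linarith [neg_abs_le (inner ℝ w v), norm_nonneg w])
      ((le_abs_self _).trans hwv)
    nlinarith [norm_nonneg w]
  have h3 : (1 ^ 2 + (-(inner ℝ w v / liftHeight w)) ^ 2) ^ 2 ≤ 2 := by
    nlinarith [sq_nonneg (-(inner ℝ w v / liftHeight w))]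
  have h4 : 3 * (θ : ℝ) * (1 ^ 2 + (-(inner ℝ w v / liftHeight w)) ^ 2) ^ 2 ≤ 6 * θ := by
    have := mul_le_mul_of_nonneg_left h3 (mul_nonneg (by norm_num : (0:ℝ) ≤ 3) θ.2.1)
    linarith
  calc _ ≤ (1 / μ) ^ 2 * (6 * θ) := mul_le_mul_of_nonneg_left (h1.trans h4) (by positivity)
    _ = _ := by field_simp

/-- Only the event that the last entry vanishes is kept; elsewhere nonnegativity is enough. On it,
`1 - tanh² y ≥ 1 - y²` leaves a mixed product of two linear forms, which is split into separate
fourth powers. -/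
theorem le_curvatureTerm {μ : ℝ} (hμ : 0 < μ) (w v : EuclideanSpace ℝ (Fin d))
    (x : Fin (d + 1) → ℝ) :
    (1 / μ) * (zeroIndicator (x (Fin.last d)) * headDot v x ^ 2 -
      (1 / 50) * (5 / μ) ^ 4 * (zeroIndicator (x (Fin.last d)) * headDot w x ^ 4) -
      (1 / 50) * (zeroIndicator (x (Fin.last d)) * headDot v x ^ 4)) ≤
    curvatureTerm μ w v x := by
  unfold zeroIndicator
  split_ifs with h
  · have h1 : Real.tanh (headDot w x / μ) ^ 2 ≤ (headDot w x / μ) ^ 2 :=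
      sq_le_sq.2 (Real.abs_tanh_le_abs _)
    -- Weighted AM-GM. The weight 5 matches the radius `‖w‖ ≤ μ / 5` used later, so that both fourth
    -- moments come out at most `3θ`.
    have h2 : (headDot w x / μ) ^ 2 * headDot v x ^ 2 ≤
        (1 / 50) * (5 / μ) ^ 4 * headDot w x ^ 4 + (1 / 50) * headDot v x ^ 4 := by
      have := sq_nonneg ((5 * (headDot w x / μ)) ^ 2 - headDot v x ^ 2)
      have e : (1 / 50) * (5 / μ) ^ 4 * headDot w x ^ 4 =
          (1 / 50) * (5 * (headDot w x / μ)) ^ 4 := by ring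
      rw [e]
      nlinarith
    simp only [curvatureTerm, liftDot, h, mul_zero, add_zero, sub_zero, one_mul]
    have h3 : headDot v x ^ 2 - 1 / 50 * (5 / μ) ^ 4 * headDot w x ^ 4 -
        1 / 50 * headDot v x ^ 4 ≤ (1 - Real.tanh (headDot w x / μ) ^ 2) * headDot v x ^ 2 := by
      nlinarith [mul_le_mul_of_nonneg_right h1 (sq_nonneg (headDot v x))]
    calc _ ≤ 1 / μ * ((1 - Real.tanh (headDot w x / μ) ^ 2) * headDot v x ^ 2) :=
          mul_le_mul_of_nonneg_left h3 (by positivity)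
      _ = _ := by ring
  · simp only [zero_mul, mul_zero, sub_zero]
    exact curvatureTerm_nonneg hμ w v x

theorem le_integral_curvatureTerm {θ : unitInterval} (hθ : (θ : ℝ) ≤ 1 / 2) {μ : ℝ} (hμ : 0 < μ)
    {w v : EuclideanSpace ℝ (Fin d)} (hv : ‖v‖ = 1) (hw : ‖w‖ ≤ μ / 5) :
    2 / 5 * (θ / μ) ≤ ∫ x, curvatureTerm μ w v x ∂(Measure.pi fun _ => bernoulliGaussian θ) := by
  have iV2 := integrable_last_mul_headDot_pow θ measurable_zeroIndicator abs_zeroIndicator_le v 2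
  have iV4 := integrable_last_mul_headDot_pow θ measurable_zeroIndicator abs_zeroIndicator_le v 4
  have iW4 := integrable_last_mul_headDot_pow θ measurable_zeroIndicator abs_zeroIndicator_le w 4
  have hle := integral_mono (((iV2.sub (iW4.const_mul ((1 / 50) * (5 / μ) ^ 4))).sub
    (iV4.const_mul (1 / 50))).const_mul (1 / μ)) (integrable_curvatureTerm θ hμ w v)
    (le_curvatureTerm hμ w v)
  refine le_trans ?_ hle
  rw [integral_const_mul, integral_sub' (iV2.sub (iW4.const_mul _)) (iV4.const_mul _),
    integral_sub' iV2 (iW4.const_mul _), integral_const_mul, integral_const_mul,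
    integral_last_mul_headDot θ zeroIndicator (fun y => y ^ 2), integral_last_mul_headDot θ zeroIndicator (fun y => y ^ 4),
    integral_last_mul_headDot θ zeroIndicator (fun y => y ^ 4), integral_zeroIndicator_bernoulliGaussian,
    integral_linForm_sq]
  have h1 := integral_linForm_pow_four_le θ (fun i => v i)
  have h2 := integral_linForm_pow_four_le θ (fun i => w i)
  rw [← EuclideanSpace.real_norm_sq_eq] at h1 h2 ⊢
  rw [hv] at *
  set A := ∫ y, linForm (fun i => v i) y ^ 4 ∂(Measure.pi fun _ : Fin d => bernoulliGaussian θ)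
  set B := ∫ y, linForm (fun i => w i) y ^ 4 ∂(Measure.pi fun _ : Fin d => bernoulliGaussian θ)
  have hθ0 := θ.2.1
  have h3 : (5 / μ) ^ 4 * B ≤ 3 * θ := by
    have h4 : (5 / μ * ‖w‖) ≤ 1 := by
      rw [div_mul_eq_mul_div, div_le_one hμ]; linarith
    have h5 := pow_le_one₀ (n := 4) (by positivity) h4
    calc (5 / μ) ^ 4 * B ≤ (5 / μ) ^ 4 * (3 * θ * (‖w‖ ^ 2) ^ 2) := by gcongr
      _ = 3 * θ * (5 / μ * ‖w‖) ^ 4 := by ring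
      _ ≤ 3 * θ * 1 := by gcongr
      _ = _ := by ring
  have h6 : 2 / 5 * (θ : ℝ) ≤ (1 - θ) * (θ * 1 ^ 2) - 1 / 50 * (5 / μ) ^ 4 * ((1 - θ) * B) -
      1 / 50 * ((1 - θ) * A) := by
    -- The two quartic errors cost `6θ/50`, leaving `22θ/25`, and `1 - θ` is at least one half.
    have : (1 - (θ : ℝ)) * (θ * 1 ^ 2 - 1 / 50 * ((5 / μ) ^ 4 * B) - 1 / 50 * A) ≥
      (1 / 2) * ((22 / 25) * θ) := by
      apply mul_le_mul <;> linarith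
    linarith
  calc 2 / 5 * (θ / μ) = 1 / μ * (2 / 5 * θ) := by ring
    _ ≤ _ := mul_le_mul_of_nonneg_left h6 (by positivity)

/-! ### Radial gradient at intermediate distance -/

/-- When the last entry vanishes, the Taylor bound with slope `1/6` gives the gain. Otherwise
monotonicity of `tanh` allows dropping `headDot w x` from its argument. The resulting product has
mean zero because the last entry is independent of the centered form `headDot w x`, and the
remaining cost is of second order in `‖w‖`. -/
theorem le_radialGradTerm {μ : ℝ} (hμ : 0 < μ) {w : EuclideanSpace ℝ (Fin d)}
    (hw : μ / 6 ≤ ‖w‖) (hq : 0 < liftHeight w) (x : Fin (d + 1) → ℝ) :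
    (1 / (6 * ‖w‖)) * (zeroIndicator (x (Fin.last d)) * headDot w x ^ 2) -
      (1 / (648 * ‖w‖ ^ 3)) * (zeroIndicator (x (Fin.last d)) * headDot w x ^ 4) +
      Real.tanh (liftHeight w * x (Fin.last d) / μ) * headDot w x ^ 1 -
      ‖w‖ ^ 2 / liftHeight w * |x (Fin.last d)| ≤ radialGradTerm μ w x := by
  have hs : 0 < ‖w‖ := lt_of_lt_of_le (by positivity) hw
  unfold zeroIndicator
  split_ifs with h
  · simp only [radialGradTerm, liftDot, h, mul_zero, add_zero, sub_zero, zero_div, Real.tanh_zero,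
      abs_zero, zero_mul, one_mul]
    have h1 := Real.mul_tanh_mul_ge (K := ‖w‖ / μ) (K₀ := 1 / 6) (by norm_num)
      (by rw [div_le_div_iff₀ (by norm_num) hμ]; linarith) (headDot w x / ‖w‖)
    have e : ‖w‖ / μ * (headDot w x / ‖w‖) = headDot w x / μ := by field_simp
    rw [e] at h1
    have h2 := mul_le_mul_of_nonneg_left h1 hs.le
    have e2 : ‖w‖ * (headDot w x / ‖w‖ * Real.tanh (headDot w x / μ)) =
        Real.tanh (headDot w x / μ) * headDot w x := by field_simp
    rw [e2] at h2
    refine le_trans (le_of_eq ?_) h2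
    field_simp
    ring
  · simp only [zero_mul, mul_zero, sub_zero, zero_add, pow_one, radialGradTerm]
    have h1 : 0 ≤ headDot w x * (Real.tanh (liftDot w x / μ) -
        Real.tanh (liftHeight w * x (Fin.last d) / μ)) := by
      rcases le_total 0 (headDot w x) with hv | hv
      · refine mul_nonneg hv (sub_nonneg.2 (Real.tanh_monotone' ?_))
        gcongr; unfold liftDot; linarith
      · refine mul_nonneg_of_nonpos_of_nonpos hv (sub_nonpos.2 (Real.tanh_monotone' ?_))
        gcongr; unfold liftDot; linarith
    have h2 : ‖w‖ ^ 2 / liftHeight w * (Real.tanh (liftDot w x / μ) * x (Fin.last d)) ≤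
        ‖w‖ ^ 2 / liftHeight w * |x (Fin.last d)| := by
      refine mul_le_mul_of_nonneg_left ((le_abs_self _).trans ?_) (by positivity)
      rw [abs_mul]
      exact mul_le_of_le_one_left (abs_nonneg _) (Real.abs_tanh_lt_one _).le
    linarith

theorem abs_radialGradTerm_le (μ : ℝ) (w : EuclideanSpace ℝ (Fin d)) (x : Fin (d + 1) → ℝ) :
    |radialGradTerm μ w x| ≤
      |linForm (Fin.snoc (α := fun _ => ℝ) (fun i => w i) (-(‖w‖ ^ 2 / liftHeight w))) x| := by
  rw [← headDot_add_mul_last, neg_mul, ← sub_eq_add_neg, radialGradTerm, abs_mul]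
  exact mul_le_of_le_one_left (abs_nonneg _) (Real.abs_tanh_lt_one _).le

theorem integrable_radialGradTerm (θ : unitInterval) (μ : ℝ) (w : EuclideanSpace ℝ (Fin d)) :
    Integrable (radialGradTerm μ w) (Measure.pi fun _ => bernoulliGaussian θ) :=
  ((integrable_linForm_pow θ _ 1).abs).mono' (by fun_prop)
    (Filter.Eventually.of_forall fun x => by
      simpa only [pow_one, Real.norm_eq_abs] using abs_radialGradTerm_le μ w x)

theorem le_integral_radialGradTerm {θ : unitInterval} (hθ : (θ : ℝ) ≤ 1 / 2) {μ : ℝ} (hμ : 0 < μ)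
    {w : EuclideanSpace ℝ (Fin d)} (hw : μ / 6 ≤ ‖w‖) (hw' : ‖w‖ ≤ 1 / 40) :
    θ / 20 * ‖w‖ ≤ ∫ x, radialGradTerm μ w x ∂(Measure.pi fun _ => bernoulliGaussian θ) := by
  have hs : 0 < ‖w‖ := lt_of_lt_of_le (by positivity) hw
  have hq : 99 / 100 ≤ liftHeight w := by
    refine Real.le_sqrt_of_sq_le ?_
    nlinarith
  have i2 := (integrable_last_mul_headDot_pow θ measurable_zeroIndicator abs_zeroIndicator_le w 2).const_mul (1 / (6 * ‖w‖))
  have i4 := (integrable_last_mul_headDot_pow θ measurable_zeroIndicator abs_zeroIndicator_le w 4).const_mul (1 / (648 * ‖w‖ ^ 3))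
  have i1 := integrable_last_mul_headDot_pow θ (f := fun t => Real.tanh (liftHeight w * t / μ))
    (by fun_prop) (fun t => (Real.abs_tanh_lt_one _).le) w 1
  have ia := (integrable_last (d := d) (integrable_abs_bernoulliGaussian θ)).const_mul
    (‖w‖ ^ 2 / liftHeight w)
  have hle := integral_mono (((i2.sub i4).add i1).sub ia) (integrable_radialGradTerm θ μ w)
    (le_radialGradTerm hμ hw (by linarith))
  refine le_trans ?_ hle
  rw [integral_sub' ((i2.sub i4).add i1) ia, integral_add' (i2.sub i4) i1, integral_sub' i2 i4,
    integral_const_mul, integral_const_mul, integral_const_mul,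
    integral_last_mul_headDot θ zeroIndicator (fun y => y ^ 2), integral_last_mul_headDot θ zeroIndicator (fun y => y ^ 4),
    integral_last_mul_headDot θ (fun t => Real.tanh (liftHeight w * t / μ)) (fun y => y ^ 1),
    integral_zeroIndicator_bernoulliGaussian, integral_linForm_sq,
    integral_eval_pi (f := fun t => |t|) (by fun_prop)]
  simp only [pow_one, integral_linForm, mul_zero, add_zero]
  have h4 := integral_linForm_pow_four_le θ (fun i => w i)
  rw [← EuclideanSpace.real_norm_sq_eq] at h4 ⊢
  have ha := integral_abs_bernoulliGaussian_le θ
  have hθ0 := θ.2.1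
  set B := ∫ y, linForm (fun i => w i) y ^ 4 ∂(Measure.pi fun _ : Fin d => bernoulliGaussian θ)
  set A := ∫ t, |t| ∂bernoulliGaussian θ
  set s := ‖w‖
  have e1 : 1 / (6 * s) * ((1 - θ) * (θ * s ^ 2)) = (1 - θ) * (θ * s / 6) := by field_simp
  have e2 : 1 / (648 * s ^ 3) * ((1 - θ) * B) ≤ (1 - θ) * (θ * s / 216) := by
    calc 1 / (648 * s ^ 3) * ((1 - θ) * B) ≤
        1 / (648 * s ^ 3) * ((1 - θ) * (3 * θ * (s ^ 2) ^ 2)) := by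
          gcongr; linarith
      _ = _ := by field_simp; ring
  have e3 : s ^ 2 / liftHeight w * A ≤ θ * s * (100 / (99 * 40)) := by
    have : s ^ 2 / liftHeight w ≤ s * (100 / (99 * 40)) := by
      rw [div_le_iff₀ (by linarith)]
      nlinarith [mul_le_mul_of_nonneg_left hq hs.le]
    calc s ^ 2 / liftHeight w * A ≤ s * (100 / (99 * 40)) * θ := by gcongr
      _ = _ := by ring
  -- Here `35/216 = 1/6 - 1/216` is the net gain; half of it minus the loss `100/3960` still exceeds
  -- `1/20`.
  have e4 : (1 / 2) * (θ * s * (35 / 216)) ≤ (1 - θ) * (θ * s * (35 / 216)) := by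
    gcongr; linarith
  rw [e1]
  nlinarith [mul_nonneg hθ0 hs.le]

end Terms

/-! ### Radial curvature away from the origin -/

section RadialHessian

/-- The scaled second derivative of `logCosh μ`. -/
noncomputable def sechSq (μ u : ℝ) : ℝ := (1 - Real.tanh (u / μ) ^ 2) / μ

@[fun_prop]
theorem measurable_sechSq (μ : ℝ) : Measurable (sechSq μ) := by
  unfold sechSq; fun_prop

theorem sechSq_nonneg {μ : ℝ} (hμ : 0 < μ) (u : ℝ) : 0 ≤ sechSq μ u :=
  div_nonneg (Real.one_sub_tanh_sq_nonneg _) hμ.le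

theorem sechSq_le {μ : ℝ} (hμ : 0 < μ) (u : ℝ) : sechSq μ u ≤ 1 / μ := by
  unfold sechSq
  gcongr
  linarith [sq_nonneg (Real.tanh (u / μ))]

theorem sechSq_mul_sq_le {μ : ℝ} (hμ : 0 < μ) (u : ℝ) : sechSq μ u * u ^ 2 ≤ μ := by
  have h := Real.sq_mul_one_sub_tanh_sq_le (u / μ)
  have e : sechSq μ u * u ^ 2 = μ * ((u / μ) ^ 2 * (1 - Real.tanh (u / μ) ^ 2)) := by
    unfold sechSq; field_simp
  rw [e]
  exact mul_le_of_le_one_right hμ.le h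

/-- Stein's identity for `u ↦ tanh (u / μ)`. -/
theorem integral_mul_tanh_gaussianReal {μ : ℝ} (hμ : 0 < μ) (v : NNReal) :
    ∫ u, u * Real.tanh (u / μ) ∂gaussianReal 0 v = v * ∫ u, sechSq μ u ∂gaussianReal 0 v := by
  rw [← map_sqrt_mul_gaussianReal, integral_map (by fun_prop) (by fun_prop),
    integral_map (by fun_prop) (measurable_sechSq μ).aestronglyMeasurable]
  set σ := Real.sqrt v
  have hσ : σ ^ 2 = v := Real.sq_sqrt v.coe_nonneg
  have hd : ∀ x, HasDerivAt (fun x => Real.tanh (σ * x / μ)) (σ * sechSq μ (σ * x)) x := fun x => by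
    have h1 : HasDerivAt (fun x => σ * x / μ) (σ / μ) x := by
      simpa using ((hasDerivAt_id' x).const_mul σ).div_const μ
    refine ((Real.hasDerivAt_tanh _).comp x h1).congr_deriv ?_
    unfold sechSq; ring
  have hb : ∀ x, |Real.tanh (σ * x / μ)| ≤ 1 := fun x => (Real.abs_tanh_lt_one _).le
  have h0 : Integrable (fun x => Real.tanh (σ * x / μ)) (gaussianReal 0 1) :=
    (integrable_const (1 : ℝ)).mono' (by fun_prop) (Filter.Eventually.of_forall hb)
  have h1 : Integrable (fun x => σ * sechSq μ (σ * x)) (gaussianReal 0 1) := by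
    refine Integrable.const_mul ((integrable_const (1 / μ)).mono'
      ((measurable_sechSq μ).comp (measurable_const_mul σ)).aestronglyMeasurable
      (Filter.Eventually.of_forall fun x => ?_)) σ
    rw [Real.norm_eq_abs, Function.comp_apply, abs_of_nonneg (sechSq_nonneg hμ _)]
    exact sechSq_le hμ _
  have h2 : Integrable (fun x => x * Real.tanh (σ * x / μ)) (gaussianReal 0 1) :=
    Integrable.mul_bdd (c := 1) (by simpa using integrable_pow_gaussianReal 0 1 1) (by fun_prop)
      (Filter.Eventually.of_forall hb)
  have h := integral_mul_gaussianReal_eq_integral_deriv hd h0 h1 h2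
  simp_rw [mul_assoc]
  rw [integral_const_mul, h, integral_const_mul, ← hσ]
  ring

variable {ι : Type*} [Fintype ι]

theorem integral_mul_of_indepFun {Ω : Type*} [MeasurableSpace Ω] {P : Measure Ω} {X Y : Ω → ℝ}
    (h : IndepFun X Y P) (hX : Measurable X) (hY : Measurable Y) {f g : ℝ → ℝ}
    (hf : Measurable f) (hg : Measurable g) :
    ∫ ω, f (X ω) * g (Y ω) ∂P = (∫ ω, f (X ω) ∂P) * ∫ ω, g (Y ω) ∂P :=
  (h.comp hf hg).integral_fun_mul_eq_mul_integral (hf.comp hX).aestronglyMeasurable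
    (hg.comp hY).aestronglyMeasurable

theorem integral_linForm_sq_gaussian (c : ι → ℝ) :
    ∫ g, linForm c g ^ 2 ∂(Measure.pi fun _ : ι => gaussianReal 0 1) = ∑ i, c i ^ 2 := by
  rw [integral_comp_linForm_gaussian c (f := fun x => x ^ 2) (by fun_prop),
    integral_sq_gaussianReal_var, Real.coe_toNNReal _ (Finset.sum_nonneg fun i _ => sq_nonneg _)]

/-- The exact conditional mean of the radial curvature: it is governed by the two moments `J₀` and
`J₂` of `sechSq μ` under the law of the linear functional. -/
theorem integral_radial_gaussian {μ : ℝ} (hμ : 0 < μ) (c : ι → ℝ) (j : ι) (hj : 0 < c j)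
    {S D : ℝ} (hS : S = ∑ i, c i ^ 2) (hD : D = 1 - S) :
    ∫ g, (sechSq μ (linForm c g) * (linForm c g - g j / c j) ^ 2 -
        (1 - c j ^ 2) / c j ^ 3 * (g j * Real.tanh (linForm c g / μ)))
        ∂(Measure.pi fun _ : ι => gaussianReal 0 1) =
      -(D / S) * ((∫ u, sechSq μ u ∂gaussianReal 0 S.toNNReal) -
        D / S * ∫ u, sechSq μ u * u ^ 2 ∂gaussianReal 0 S.toNNReal) := by
  classical
  set q := c j
  set γ := Measure.pi fun _ : ι => gaussianReal 0 1
  have hq2 : q ^ 2 ≤ S := by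
    rw [hS]; exact Finset.single_le_sum (f := fun i => c i ^ 2) (fun i _ => sq_nonneg _)
      (Finset.mem_univ j)
  have hS0 : 0 < S := lt_of_lt_of_le (by positivity) hq2
  -- The component of the `j`-th basis vector orthogonal to `c`; for Gaussian vectors orthogonality
  -- gives independence of the two linear forms.
  set e : ι → ℝ := fun i => (if i = j then 1 else 0) - q / S * c i
  have he : ∀ g : ι → ℝ, g j = q / S * linForm c g + linForm e g := fun g => by
    simp only [linForm, e, sub_mul, Finset.sum_sub_distrib, Finset.mul_sum]
    simp [mul_assoc]
  have horth : ∑ i, c i * e i = 0 := by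
    simp only [e, mul_sub, Finset.sum_sub_distrib]
    have : ∑ i, c i * (q / S * c i) = q / S * S := by
      rw [hS, Finset.mul_sum]; exact Finset.sum_congr rfl fun i _ => by ring
    rw [this]
    simp only [mul_ite, mul_one, mul_zero, Finset.sum_ite_eq', Finset.mem_univ, if_true]
    field_simp
    simp [q]
  have hee : ∑ i, e i ^ 2 = 1 - q ^ 2 / S := by
    have h1 : ∑ i, e i ^ 2 = ∑ i, (if i = j then 1 else 0) * e i - q / S * ∑ i, c i * e i := by
      rw [Finset.mul_sum, ← Finset.sum_sub_distrib]
      exact Finset.sum_congr rfl fun i _ => by simp only [e]; ring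
    rw [h1, horth]
    simp only [ite_mul, one_mul, zero_mul, Finset.sum_ite_eq', Finset.mem_univ, if_true, e]
    ring
  have hind : IndepFun (linForm c) (linForm e) γ := indepFun_linForm_gaussian horth
  have hL := integrable_linForm_pow_gaussian c 2
  have hR := integrable_linForm_pow_gaussian e 2
  have hsb : ∀ u, |sechSq μ u| ≤ 1 / μ := fun u => by
    rw [abs_of_nonneg (sechSq_nonneg hμ u)]; exact sechSq_le hμ u
  have htb : ∀ u, |Real.tanh (u / μ)| ≤ 1 := fun u => (Real.abs_tanh_lt_one _).le
  have hmS : Measurable fun g => sechSq μ (linForm c g) :=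
    (measurable_sechSq μ).comp (measurable_linForm c)
  have iUR : Integrable (fun g => linForm c g * linForm e g) γ :=
    (hL.add hR).mono' (by fun_prop) (Filter.Eventually.of_forall fun g => by
      rw [Real.norm_eq_abs, abs_mul, Pi.add_apply, ← sq_abs (linForm c g), ← sq_abs (linForm e g)]
      nlinarith [sq_nonneg (|linForm c g| - |linForm e g|), sq_nonneg (|linForm c g|),
        sq_nonneg (|linForm e g|)])
  have i1 : Integrable (fun g => sechSq μ (linForm c g) * linForm c g ^ 2) γ :=
    hL.bdd_mul (c := 1 / μ) hmS.aestronglyMeasurable (Filter.Eventually.of_forall fun g => hsb _)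
  have i2 : Integrable (fun g => (sechSq μ (linForm c g) * linForm c g) * linForm e g) γ := by
    simp_rw [mul_assoc]
    exact iUR.bdd_mul (c := 1 / μ) hmS.aestronglyMeasurable
      (Filter.Eventually.of_forall fun g => hsb _)
  have i3 : Integrable (fun g => sechSq μ (linForm c g) * linForm e g ^ 2) γ :=
    hR.bdd_mul (c := 1 / μ) hmS.aestronglyMeasurable (Filter.Eventually.of_forall fun g => hsb _)
  have iL1 : Integrable (linForm c) γ := by simpa using integrable_linForm_pow_gaussian c 1
  have iR1 : Integrable (linForm e) γ := by simpa using integrable_linForm_pow_gaussian e 1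
  have i4 : Integrable (fun g => linForm c g * Real.tanh (linForm c g / μ)) γ :=
    iL1.mul_bdd (c := 1) (by fun_prop) (Filter.Eventually.of_forall fun g => htb _)
  have i5 : Integrable (fun g => Real.tanh (linForm c g / μ) * linForm e g) γ :=
    iR1.bdd_mul (c := 1) (by fun_prop) (Filter.Eventually.of_forall fun g => htb _)
  -- Since `L - g j / q = (1 - 1/S) L - R/q` with `R` the independent remainder, the terms linear in
  -- `R` integrate to zero, and Stein's identity turns the mean of `L tanh (L/μ)` into `S J₀`.
  have hexp : ∀ g, sechSq μ (linForm c g) * (linForm c g - g j / q) ^ 2 -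
        (1 - q ^ 2) / q ^ 3 * (g j * Real.tanh (linForm c g / μ)) =
      (1 - 1 / S) ^ 2 * (sechSq μ (linForm c g) * linForm c g ^ 2) -
      2 * (1 - 1 / S) / q * ((sechSq μ (linForm c g) * linForm c g) * linForm e g) +
      1 / q ^ 2 * (sechSq μ (linForm c g) * linForm e g ^ 2) -
      (1 - q ^ 2) / (q ^ 2 * S) * (linForm c g * Real.tanh (linForm c g / μ)) -
      (1 - q ^ 2) / q ^ 3 * (Real.tanh (linForm c g / μ) * linForm e g) := fun g => by
    rw [he g]
    field_simp
    ring
  have hsplit : ∫ g, (sechSq μ (linForm c g) * (linForm c g - g j / q) ^ 2 -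
        (1 - q ^ 2) / q ^ 3 * (g j * Real.tanh (linForm c g / μ))) ∂γ =
      ∫ g, (((((fun g : ι → ℝ => (1 - 1 / S) ^ 2 * (sechSq μ (linForm c g) * linForm c g ^ 2)) -
      fun g => 2 * (1 - 1 / S) / q * ((sechSq μ (linForm c g) * linForm c g) * linForm e g)) +
      fun g => 1 / q ^ 2 * (sechSq μ (linForm c g) * linForm e g ^ 2)) -
      fun g => (1 - q ^ 2) / (q ^ 2 * S) * (linForm c g * Real.tanh (linForm c g / μ))) -
      fun g => (1 - q ^ 2) / q ^ 3 * (Real.tanh (linForm c g / μ) * linForm e g) : (ι → ℝ) → ℝ) g ∂γ :=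
    integral_congr_ae (Filter.Eventually.of_forall hexp)
  rw [hsplit, integral_sub' ((((i1.const_mul _).sub (i2.const_mul _)).add (i3.const_mul _)).sub
      (i4.const_mul _)) (i5.const_mul _),
    integral_sub' (((i1.const_mul _).sub (i2.const_mul _)).add (i3.const_mul _)) (i4.const_mul _),
    integral_add' ((i1.const_mul _).sub (i2.const_mul _)) (i3.const_mul _),
    integral_sub' (i1.const_mul _) (i2.const_mul _)]
  simp only [integral_const_mul]
  have mS := measurable_sechSq μ
  rw [integral_mul_of_indepFun hind (by fun_prop) (by fun_prop) (f := fun u => sechSq μ u * u)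
      (g := fun u => u) (by fun_prop) (by fun_prop),
    integral_mul_of_indepFun hind (by fun_prop) (by fun_prop) (f := fun u => sechSq μ u)
      (g := fun u => u ^ 2) (by fun_prop) (by fun_prop),
    integral_mul_of_indepFun hind (by fun_prop) (by fun_prop) (f := fun u => Real.tanh (u / μ))
      (g := fun u => u) (by fun_prop) (by fun_prop),
    integral_linForm_gaussian, integral_linForm_sq_gaussian, hee,
    integral_comp_linForm_gaussian c (f := fun u => sechSq μ u * u ^ 2) (by fun_prop),
    integral_comp_linForm_gaussian c (f := fun u => sechSq μ u) (by fun_prop),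
    integral_comp_linForm_gaussian c (f := fun u => u * Real.tanh (u / μ)) (by fun_prop),
    integral_mul_tanh_gaussianReal hμ, ← hS, Real.coe_toNNReal _ hS0.le, hD]
  field_simp
  ring

/-- Stein's identity read backwards: `S J₀` is the mean of `u tanh (u/μ)`, which is at least the
mean of `|u|` minus `μ`, hence at least `√S/2 - μ`. The second moment is harmless because `sechSq μ
u * u²` never exceeds `μ`. -/
theorem radial_moments_bound {μ : ℝ} (hμ : 0 < μ) {S D : ℝ} (hS : 0 < S) (hD0 : 0 ≤ D)
    (hD : D = 1 - S) (hμS : 8 * μ ≤ Real.sqrt S) :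
    1 / 4 ≤ (∫ u, sechSq μ u ∂gaussianReal 0 S.toNNReal) -
        D / S * ∫ u, sechSq μ u * u ^ 2 ∂gaussianReal 0 S.toNNReal := by
  have hSc : ((S.toNNReal : NNReal) : ℝ) = S := Real.coe_toNNReal _ hS.le
  set σ := Real.sqrt S
  have hσ : 0 < σ := Real.sqrt_pos.2 hS
  have hσ2 : σ ^ 2 = S := Real.sq_sqrt hS.le
  have hσ1 : σ ≤ 1 := Real.sqrt_le_one.2 (by linarith)
  have hT := integral_mul_tanh_gaussianReal hμ S.toNNReal
  rw [hSc] at hT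
  have hT2 : σ / 2 - μ ≤ ∫ u, u * Real.tanh (u / μ) ∂gaussianReal 0 S.toNNReal := by
    have hi : Integrable (fun u : ℝ => |u|) (gaussianReal 0 S.toNNReal) := by
      simpa using (integrable_pow_gaussianReal 0 S.toNNReal 1).abs
    have habs : σ / 2 ≤ ∫ u, |u| ∂gaussianReal 0 S.toNNReal := by
      rw [← map_sqrt_mul_gaussianReal, integral_map (by fun_prop) (by fun_prop), hSc]
      simp_rw [abs_mul]
      rw [integral_const_mul, abs_of_pos hσ]
      have := le_integral_abs_gaussianReal
      nlinarith
    have hle : ∫ u, (|u| - μ) ∂gaussianReal 0 S.toNNReal ≤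
        ∫ u, u * Real.tanh (u / μ) ∂gaussianReal 0 S.toNNReal := by
      refine integral_mono (hi.sub (integrable_const μ)) ?_ fun u => ?_
      · exact Integrable.mul_bdd (c := 1)
          (by simpa using integrable_pow_gaussianReal 0 S.toNNReal 1) (by fun_prop)
          (Filter.Eventually.of_forall fun u => (Real.abs_tanh_lt_one _).le)
      · have h := mul_le_mul_of_nonneg_left (Real.abs_sub_one_le_mul_tanh (u / μ)) hμ.le
        have e1 : μ * (|u / μ| - 1) = |u| - μ := by
          rw [abs_div, abs_of_pos hμ]; field_simp
        have e2 : μ * (u / μ * Real.tanh (u / μ)) = u * Real.tanh (u / μ) := by field_simp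
        rwa [e1, e2] at h
    rw [integral_sub hi (integrable_const μ)] at hle
    simp at hle
    linarith
  have hJ2 : ∫ u, sechSq μ u * u ^ 2 ∂gaussianReal 0 S.toNNReal ≤ μ := by
    have hle : ∫ u, sechSq μ u * u ^ 2 ∂gaussianReal 0 S.toNNReal ≤
        ∫ _, μ ∂gaussianReal 0 S.toNNReal :=
      integral_mono_of_nonneg
        (Filter.Eventually.of_forall fun u => mul_nonneg (sechSq_nonneg hμ u) (sq_nonneg u))
        (integrable_const μ) (Filter.Eventually.of_forall fun u => sechSq_mul_sq_le hμ u)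
    simpa using hle
  set J0 := ∫ u, sechSq μ u ∂gaussianReal 0 S.toNNReal
  set J2 := ∫ u, sechSq μ u * u ^ 2 ∂gaussianReal 0 S.toNNReal
  rw [hT] at hT2
  have h1 : D / S * J2 ≤ μ / S := by
    calc D / S * J2 ≤ D / S * μ := by gcongr
      _ ≤ 1 / S * μ := by gcongr; linarith
      _ = _ := by ring
  have h2 : (σ / 2 - μ) / S ≤ J0 := by
    rw [div_le_iff₀ hS]; linarith
  -- With `8μ ≤ σ` the quotient is at least `1/(4σ)`, and `σ ≤ 1`.
  have h3 : 1 / 4 ≤ (σ / 2 - 2 * μ) / S := by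
    rw [le_div_iff₀ hS, ← hσ2]
    nlinarith
  have h4 : (σ / 2 - 2 * μ) / S = (σ / 2 - μ) / S - μ / S := by ring
  linarith

end RadialHessian

/-! ### Mean of the radial curvature, conditionally on the mask and then averaged. -/

section RadialHessianExpectation

variable {d : ℕ}

theorem radialHessTerm_eq (μ : ℝ) (w : EuclideanSpace ℝ (Fin d)) (x : Fin (d + 1) → ℝ) :
    radialHessTerm μ w x = sechSq μ (liftDot w x) *
      (liftDot w x - x (Fin.last d) / liftHeight w) ^ 2 -
      ‖w‖ ^ 2 / liftHeight w ^ 3 * (x (Fin.last d) * Real.tanh (liftDot w x / μ)) := rfl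

theorem norm_sq_eq_one_sub_liftHeight_sq {w : EuclideanSpace ℝ (Fin d)} (hq : 0 < liftHeight w) :
    ‖w‖ ^ 2 = 1 - liftHeight w ^ 2 := by
  have : 0 < 1 - ‖w‖ ^ 2 := Real.sqrt_pos.1 hq
  rw [liftHeight, Real.sq_sqrt this.le]; ring

/-- The linear form enters only through `sechSq μ u * u² ≤ μ` and a bounded `tanh`, so the
dominating function depends on the last entry alone. Its exponential moments are then
one-dimensional. -/
theorem abs_radialHessTerm_le {μ : ℝ} (hμ : 0 < μ) {w : EuclideanSpace ℝ (Fin d)}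
    (hμq : 8 * μ ≤ liftHeight w) (x : Fin (d + 1) → ℝ) :
    |radialHessTerm μ w x| ≤ 3 / (μ * liftHeight w ^ 2) * (1 + x (Fin.last d) ^ 2) := by
  have hq : 0 < liftHeight w := by linarith
  have hw := norm_sq_eq_one_sub_liftHeight_sq hq
  rw [radialHessTerm_eq]
  set q := liftHeight w
  set u := liftDot w x
  set t := x (Fin.last d)
  have hs0 := sechSq_nonneg hμ u
  have hs1 := sechSq_le hμ u
  have hs2 := sechSq_mul_sq_le hμ u
  have hq1 : q ≤ 1 := by nlinarith [sq_nonneg ‖w‖]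
  have hμ1 : μ ≤ 1 / 8 := by linarith
  have h1 : sechSq μ u * (u - t / q) ^ 2 ≤ 2 * μ + 2 * (t ^ 2 / (μ * q ^ 2)) := by
    have : (u - t / q) ^ 2 ≤ 2 * u ^ 2 + 2 * (t / q) ^ 2 := by nlinarith [sq_nonneg (u + t / q)]
    calc sechSq μ u * (u - t / q) ^ 2 ≤ sechSq μ u * (2 * u ^ 2 + 2 * (t / q) ^ 2) := by gcongr
      _ = 2 * (sechSq μ u * u ^ 2) + 2 * (sechSq μ u * (t / q) ^ 2) := by ring
      _ ≤ 2 * μ + 2 * (1 / μ * (t / q) ^ 2) := by gcongr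
      _ = _ := by field_simp
  have h2 : |‖w‖ ^ 2 / q ^ 3 * (t * Real.tanh (u / μ))| ≤ (1 + t ^ 2) / (16 * (μ * q ^ 2)) := by
    rw [abs_mul, abs_mul, abs_of_nonneg (by positivity)]
    have ha : |t| * |Real.tanh (u / μ)| ≤ (1 + t ^ 2) / 2 := by
      have := (Real.abs_tanh_lt_one (u / μ)).le
      nlinarith [abs_nonneg t, sq_abs t, sq_nonneg (|t| - 1), abs_nonneg (Real.tanh (u / μ))]
    have hb : ‖w‖ ^ 2 / q ^ 3 ≤ 1 / (8 * (μ * q ^ 2)) := by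
      rw [div_le_div_iff₀ (by positivity) (by positivity)]
      have : ‖w‖ ^ 2 ≤ 1 := by nlinarith [sq_nonneg q]
      calc ‖w‖ ^ 2 * (8 * (μ * q ^ 2)) ≤ 1 * (q * q ^ 2) := by
            apply mul_le_mul this _ (by positivity) zero_le_one
            nlinarith [sq_nonneg q]
        _ = _ := by ring
    calc _ ≤ 1 / (8 * (μ * q ^ 2)) * ((1 + t ^ 2) / 2) := by gcongr
      _ = _ := by field_simp; norm_num
  have h3 : 2 * μ ≤ 2 / (μ * q ^ 2) := by
    rw [le_div_iff₀ (by positivity)]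
    have : μ * μ ≤ 1 := by nlinarith
    have hq2 : q ^ 2 ≤ 1 := by nlinarith
    calc 2 * μ * (μ * q ^ 2) = 2 * ((μ * μ) * q ^ 2) := by ring
      _ ≤ 2 * (1 * 1) := by gcongr
      _ = 2 := by ring
  have h4 : 0 ≤ sechSq μ u * (u - t / q) ^ 2 := mul_nonneg hs0 (sq_nonneg _)
  have h5 : |sechSq μ u * (u - t / q) ^ 2 - ‖w‖ ^ 2 / q ^ 3 * (t * Real.tanh (u / μ))| ≤
      sechSq μ u * (u - t / q) ^ 2 + |‖w‖ ^ 2 / q ^ 3 * (t * Real.tanh (u / μ))| := by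
    refine (abs_sub _ _).trans ?_
    rw [abs_of_nonneg h4]
  have hA : 0 < 1 / (μ * q ^ 2) := by positivity
  have e1 : 3 / (μ * q ^ 2) * (1 + t ^ 2) = 3 * (1 / (μ * q ^ 2)) * (1 + t ^ 2) := by ring
  have e2 : (1 + t ^ 2) / (16 * (μ * q ^ 2)) = 1 / (μ * q ^ 2) * (1 + t ^ 2) / 16 := by field_simp
  have e3 : 2 * (t ^ 2 / (μ * q ^ 2)) = 2 * (1 / (μ * q ^ 2)) * t ^ 2 := by field_simp
  have e4 : 2 / (μ * q ^ 2) = 2 * (1 / (μ * q ^ 2)) := by ring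
  rw [e1]
  rw [e2] at h2
  rw [e3] at h1
  rw [e4] at h3
  nlinarith [mul_nonneg hA.le (sq_nonneg t)]

theorem integrable_radialHessTerm (θ : unitInterval) {μ : ℝ} (hμ : 0 < μ)
    {w : EuclideanSpace ℝ (Fin d)} (hμq : 8 * μ ≤ liftHeight w) :
    Integrable (radialHessTerm μ w) (Measure.pi fun _ => bernoulliGaussian θ) :=
  ((((integrable_const (1 : ℝ)).add
    (integrable_last (integrable_pow_bernoulliGaussian θ 2)))).const_mul
      (3 / (μ * liftHeight w ^ 2))).mono' (by fun_prop)
    (Filter.Eventually.of_forall fun x => abs_radialHessTerm_le hμ hμq x)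

theorem integral_pi_bernoulliGaussian_le {ι : Type*} [Fintype ι] {θ : unitInterval}
    {F : (ι → ℝ) → ℝ} {U : (ι → ℝ) → ℝ}
    (hF : Integrable F (Measure.pi fun _ : ι => bernoulliGaussian θ))
    (hU : Integrable U (Measure.pi fun _ : ι => bernoulliMeasure (1 : ℝ) 0 θ))
    (hle : ∀ b : ι → ℝ, (∀ i, b i = 0 ∨ b i = 1) →
      ∫ g : ι → ℝ, F (fun i => b i * g i) ∂(Measure.pi fun _ : ι => gaussianReal 0 1) ≤ U b) :
    ∫ x, F x ∂(Measure.pi fun _ : ι => bernoulliGaussian θ) ≤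
      ∫ b, U b ∂(Measure.pi fun _ : ι => bernoulliMeasure (1 : ℝ) 0 θ) := by
  rw [integral_pi_bernoulliGaussian hF]
  refine integral_mono_ae ?_ hU ?_
  · rw [← map_mul_pi_bernoulli_gaussian] at hF
    rw [integrable_map_measure hF.1 (by fun_prop)] at hF
    exact hF.integral_prod_left
  · filter_upwards [ae_bernoulli_eq_zero_or_one θ] with b hb using hle b hb

/-- The sum weighted by `1 - b²` is the mass `D` of `w` on inactive coordinates. With the last entry
active the exact Gaussian formula gives at most `-D/4`; with it inactive only a nonnegative term
bounded by `μ` remains. -/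
theorem integral_radialHessTerm_mask_le {μ : ℝ} (hμ : 0 < μ) {w : EuclideanSpace ℝ (Fin d)}
    (hμq : 8 * μ ≤ liftHeight w) {b : Fin (d + 1) → ℝ} (hb : ∀ i, b i = 0 ∨ b i = 1) :
    ∫ g : Fin (d + 1) → ℝ, radialHessTerm μ w (fun i => b i * g i)
        ∂(Measure.pi fun _ => gaussianReal 0 1) ≤
      μ * ∑ i : Fin d, b i.castSucc ^ 2 -
        1 / 4 * (b (Fin.last d) ^ 2 * ∑ i : Fin d, w i ^ 2 * (1 - b i.castSucc ^ 2)) := by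
  have hq : 0 < liftHeight w := by linarith
  have hw := norm_sq_eq_one_sub_liftHeight_sq hq
  have hsum0 : 0 ≤ ∑ i : Fin d, b i.castSucc ^ 2 := Finset.sum_nonneg fun i _ => sq_nonneg _
  rcases hb (Fin.last d) with hl | hl
  · have hpt : ∀ g : Fin (d + 1) → ℝ, radialHessTerm μ w (fun i => b i * g i) ≤
        μ * ∑ i : Fin d, b i.castSucc ^ 2 := fun g => by
      rw [radialHessTerm_eq]
      simp only [hl, zero_mul, zero_div, sub_zero, mul_zero]
      -- With an empty mask the term is exactly zero. This improves the bound `μ` to `μ` times the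
      -- number of active coordinates, so that its mean carries a factor `θ`.
      by_cases hz : ∀ i : Fin d, b i.castSucc = 0
      · have : liftDot w (fun i => b i * g i) = 0 := by
          simp [liftDot, headDot, hz, hl]
        rw [this]
        simpa using mul_nonneg hμ.le hsum0
      · push Not at hz
        obtain ⟨i, hi⟩ := hz
        have h1 : b i.castSucc = 1 := (hb _).resolve_left hi
        have h2 : (1 : ℝ) ≤ ∑ i : Fin d, b i.castSucc ^ 2 := by
          have := Finset.single_le_sum (f := fun i : Fin d => b i.castSucc ^ 2)
            (fun i _ => sq_nonneg _) (Finset.mem_univ i)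
          simpa [h1] using this
        exact (sechSq_mul_sq_le hμ _).trans (le_mul_of_one_le_right hμ.le h2)
    have hnn : ∀ g : Fin (d + 1) → ℝ, 0 ≤ radialHessTerm μ w (fun i => b i * g i) := fun g => by
      rw [radialHessTerm_eq]
      simp only [hl, zero_mul, zero_div, sub_zero, mul_zero]
      exact mul_nonneg (sechSq_nonneg hμ _) (sq_nonneg _)
    have h := integral_mono_of_nonneg (Filter.Eventually.of_forall hnn)
      (integrable_const (μ := Measure.pi fun _ : Fin (d + 1) => gaussianReal 0 1)
        (μ * ∑ i : Fin d, b i.castSucc ^ 2)) (Filter.Eventually.of_forall hpt)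
    refine h.trans ?_
    simp [hl]
  · set c : Fin (d + 1) → ℝ :=
      Fin.snoc (α := fun _ => ℝ) (fun i => w i * b i.castSucc) (liftHeight w) with hc
    have hcl : c (Fin.last d) = liftHeight w := by simp [hc]
    have hS : ∑ i, c i ^ 2 = ∑ i : Fin d, w i ^ 2 * b i.castSucc ^ 2 + liftHeight w ^ 2 := by
      simp [hc, Fin.sum_univ_castSucc, mul_pow]
    have hlin : ∀ g : Fin (d + 1) → ℝ, liftDot w (fun i => b i * g i) = linForm c g := fun g => by
      simp [liftDot, headDot, linForm, hc, Fin.sum_univ_castSucc, hl, mul_assoc]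
    have hD : ∑ i : Fin d, w i ^ 2 * (1 - b i.castSucc ^ 2) = 1 - ∑ i, c i ^ 2 := by
      rw [hS]
      simp only [mul_sub, mul_one, Finset.sum_sub_distrib]
      rw [← EuclideanSpace.real_norm_sq_eq, hw]; ring
    have hD0 : 0 ≤ ∑ i : Fin d, w i ^ 2 * (1 - b i.castSucc ^ 2) :=
      Finset.sum_nonneg fun i _ => by
        rcases hb i.castSucc with h | h <;> simp [h, sq_nonneg]
    have hint := integral_radial_gaussian hμ c (Fin.last d) (by rw [hcl]; exact hq) rfl hD
    have hSq : liftHeight w ^ 2 ≤ ∑ i, c i ^ 2 := by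
      rw [hS]
      exact le_add_of_nonneg_left (Finset.sum_nonneg fun i _ => by positivity)
    have hSpos : 0 < ∑ i, c i ^ 2 := lt_of_lt_of_le (by positivity) hSq
    have hbd := radial_moments_bound hμ hSpos hD0 hD
      (hμq.trans (Real.le_sqrt_of_sq_le hSq))
    have hpt : ∀ g : Fin (d + 1) → ℝ, radialHessTerm μ w (fun i => b i * g i) =
        sechSq μ (linForm c g) * (linForm c g - g (Fin.last d) / c (Fin.last d)) ^ 2 -
          (1 - c (Fin.last d) ^ 2) / c (Fin.last d) ^ 3 *
            (g (Fin.last d) * Real.tanh (linForm c g / μ)) := fun g => by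
      simp only [radialHessTerm_eq, hlin, hcl, hl, one_mul, hw]
    simp_rw [hpt]
    rw [hint, hl]
    set D := ∑ i : Fin d, w i ^ 2 * (1 - b i.castSucc ^ 2)
    set S := ∑ i, c i ^ 2
    have h1 : D ≤ D / S := by
      rw [le_div_iff₀ hSpos]
      nlinarith
    have h2 : D * (1 / 4) ≤ D / S * ((∫ u, sechSq μ u ∂gaussianReal 0 S.toNNReal) -
        D / S * ∫ u, sechSq μ u * u ^ 2 ∂gaussianReal 0 S.toNNReal) := by
      gcongr
    have h3 := mul_nonneg hμ.le hsum0
    linarith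

theorem integral_radialHessTerm_le {θ : unitInterval} (hθ : (θ : ℝ) ≤ 1 / 2) {μ : ℝ} (hμ : 0 < μ)
    {w : EuclideanSpace ℝ (Fin d)} (hμq : 8 * μ ≤ liftHeight w) :
    ∫ x, radialHessTerm μ w x ∂(Measure.pi fun _ => bernoulliGaussian θ) ≤
      θ * (μ * d - ‖w‖ ^ 2 / 8) := by
  have hsq : ∀ i : Fin (d + 1), Integrable (fun b : Fin (d + 1) → ℝ => b i ^ 2)
      (Measure.pi fun _ => bernoulliMeasure (1 : ℝ) 0 θ) := fun i =>
    integrable_eval_bernoulli θ (fun x => x ^ 2) i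
  have i1 : Integrable (fun b : Fin (d + 1) → ℝ => μ * ∑ i : Fin d, b i.castSucc ^ 2)
      (Measure.pi fun _ => bernoulliMeasure (1 : ℝ) 0 θ) :=
    (integrable_finsetSum _ fun i _ => hsq _).const_mul μ
  have i2 : Integrable (fun b : Fin (d + 1) → ℝ =>
      b (Fin.last d) ^ 2 * ∑ i : Fin d, w i ^ 2 * (1 - b i.castSucc ^ 2))
      (Measure.pi fun _ => bernoulliMeasure (1 : ℝ) 0 θ) := by
    refine Integrable.bdd_mul (c := 1) (integrable_finsetSum _ fun i _ =>
      ((integrable_const 1).sub (hsq _)).const_mul _)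
      ((measurable_pi_apply _).pow_const 2).aestronglyMeasurable ?_
    filter_upwards [ae_bernoulli_eq_zero_or_one θ] with b hb
    rcases hb (Fin.last d) with h | h <;> simp [h]
  have i3 : ∀ i : Fin d, Integrable (fun y : Fin d → ℝ => w i ^ 2 * (1 - y i ^ 2))
      (Measure.pi fun _ => bernoulliMeasure (1 : ℝ) 0 θ) := fun i =>
    (integrable_eval_bernoulli θ (fun x => 1 - x ^ 2) i).const_mul _
  refine (integral_pi_bernoulliGaussian_le (integrable_radialHessTerm θ hμ hμq)
    (i1.sub (i2.const_mul (1 / 4))) fun b hb =>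
      integral_radialHessTerm_mask_le hμ hμq hb).trans ?_
  rw [integral_sub' i1 (i2.const_mul _), integral_const_mul, integral_const_mul,
    integral_finsetSum _ fun i _ => hsq _,
    integral_last_mul_head (fun t => t ^ 2) (fun y : Fin d → ℝ => ∑ i, w i ^ 2 * (1 - y i ^ 2)),
    integral_bernoulliMeasure, integral_finsetSum _ fun i _ => i3 i]
  have e1 : ∀ i : Fin d, ∫ b : Fin (d + 1) → ℝ, b i.castSucc ^ 2
      ∂(Measure.pi fun _ => bernoulliMeasure (1 : ℝ) 0 θ) = θ := fun i => by
    rw [integral_eval_bernoulli θ (fun x => x ^ 2) (by fun_prop)]; ring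
  have e2 : ∀ i : Fin d, ∫ y : Fin d → ℝ, w i ^ 2 * (1 - y i ^ 2)
      ∂(Measure.pi fun _ => bernoulliMeasure (1 : ℝ) 0 θ) = (1 - θ) * w i ^ 2 := fun i => by
    rw [integral_const_mul,
      integral_eval_bernoulli θ (fun x => 1 - x ^ 2) (by fun_prop)]
    ring
  simp_rw [e1, e2, ← Finset.mul_sum]
  rw [← EuclideanSpace.real_norm_sq_eq]
  have hθ0 := θ.2.1
  simp
  nlinarith [mul_nonneg hθ0 (sq_nonneg ‖w‖)]

end RadialHessianExpectation

/-! ### Concentration of sums over i.i.d. columns -/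

section Concentration

theorem Real.exp_le_quadratic (y : ℝ) : Real.exp y ≤ 1 + y + y ^ 2 * Real.exp |y| := by
  have h := Complex.norm_exp_sub_sum_le_norm_mul_exp (y : ℂ) 2
  simp only [Finset.sum_range_succ, Finset.sum_range_zero, pow_zero, Nat.factorial, pow_one] at h
  have e : Complex.exp (y : ℂ) - (0 + 1 / ((1 : ℕ) : ℂ) + (y : ℂ) / ((1 : ℕ) : ℂ)) =
      ((Real.exp y - (1 + y) : ℝ) : ℂ) := by
    push_cast; ring
  simp only [zero_add, Nat.mul_one] at h e
  rw [e, Complex.norm_real, Complex.norm_real, Real.norm_eq_abs, Real.norm_eq_abs, sq_abs] at h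
  linarith [le_abs_self (Real.exp y - (1 + y))]

theorem Real.exp_neg_le_quadratic {y : ℝ} (hy : 0 ≤ y) : Real.exp (-y) ≤ 1 - y + y ^ 2 := by
  have h1 := Real.add_one_le_exp y
  have h2 : Real.exp (-y) * Real.exp y = 1 := by rw [← Real.exp_add]; simp
  have h3 : 0 ≤ 1 - y + y ^ 2 := by nlinarith [sq_nonneg (y - 1)]
  have h4 : 1 ≤ (1 - y + y ^ 2) * Real.exp y := by nlinarith [pow_nonneg hy 3]
  by_contra hc
  push Not at hc
  nlinarith [Real.exp_pos y]

variable {S : Type*} [MeasurableSpace S] {ν : Measure S} [IsProbabilityMeasure ν]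

theorem integral_one_sub_mul_add {W G : S → ℝ} (hW : Integrable W ν) (hG : Integrable G ν) (t : ℝ) :
    ∫ x, (1 - t * W x + G x) ∂ν = 1 - t * ∫ x, W x ∂ν + ∫ x, G x ∂ν := by
  have h1 : Integrable (fun x => 1 - t * W x) ν := (integrable_const 1).sub (hW.const_mul t)
  rw [integral_add h1 hG, integral_sub (integrable_const 1) (hW.const_mul t), integral_const_mul]
  simp

/-- Bernstein's argument: expand by `exp y ≤ 1 + y + y² exp |y|`. One factor `exp (r M)` absorbs
`exp |t W|` and another absorbs `(r M)²`, hence the moment of order `2r`. -/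
theorem integral_exp_neg_le_of_abs_le {W M : S → ℝ} (hW : Measurable W) (hWM : ∀ x, |W x| ≤ M x)
    {r A : ℝ} (hr : 0 < r) (hi : Integrable (fun x => Real.exp (2 * r * M x)) ν)
    (hA : ∫ x, Real.exp (2 * r * M x) ∂ν ≤ A) {t : ℝ} (ht : 0 ≤ t) (htr : t ≤ r) :
    Integrable (fun x => Real.exp (-t * W x)) ν ∧
      ∫ x, Real.exp (-t * W x) ∂ν ≤ Real.exp (-t * (∫ x, W x ∂ν) + t ^ 2 * (2 * A / r ^ 2)) := by
  have hM : ∀ x, 0 ≤ M x := fun x => (abs_nonneg _).trans (hWM x)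
  have hiW : Integrable W ν := by
    refine (hi.const_mul (1 / (2 * r))).mono' hW.aestronglyMeasurable
      (Filter.Eventually.of_forall fun x => ?_)
    rw [Real.norm_eq_abs, one_div, inv_mul_eq_div, le_div_iff₀ (by positivity)]
    have := Real.add_one_le_exp (2 * r * M x)
    nlinarith [mul_le_mul_of_nonneg_right (hWM x) (by positivity : 0 ≤ 2 * r)]
  have hpt : ∀ x, Real.exp (-t * W x) ≤
      1 - t * W x + t ^ 2 * (2 / r ^ 2 * Real.exp (2 * r * M x)) := fun x => by
    have h1 := Real.exp_le_quadratic (-t * W x)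
    have h2 : |-t * W x| ≤ r * M x := by
      rw [abs_mul, abs_neg, abs_of_nonneg ht]
      exact mul_le_mul htr (hWM x) (abs_nonneg _) hr.le
    have h3 : (W x) ^ 2 ≤ M x ^ 2 := sq_le_sq' (by linarith [(abs_le.1 (hWM x)).1])
      (abs_le.1 (hWM x)).2
    have h4 : (r * M x) ^ 2 ≤ 2 * Real.exp (r * M x) := by
      have := Real.quadratic_le_exp_of_nonneg (mul_nonneg hr.le (hM x))
      nlinarith [mul_nonneg hr.le (hM x)]
    have h5 : (-t * W x) ^ 2 * Real.exp |-t * W x| ≤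
        t ^ 2 * (2 / r ^ 2 * Real.exp (2 * r * M x)) := by
      calc (-t * W x) ^ 2 * Real.exp |-t * W x| ≤ (t ^ 2 * M x ^ 2) * Real.exp (r * M x) := by
            gcongr
            rw [mul_pow, neg_sq]; gcongr
        _ = t ^ 2 * (1 / r ^ 2 * ((r * M x) ^ 2 * Real.exp (r * M x))) := by field_simp
        _ ≤ t ^ 2 * (1 / r ^ 2 * ((2 * Real.exp (r * M x)) * Real.exp (r * M x))) := by gcongr
        _ = t ^ 2 * (2 / r ^ 2 * (Real.exp (r * M x) * Real.exp (r * M x))) := by ring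
        _ = _ := by rw [← Real.exp_add]; ring_nf
    linarith
  have hdom : Integrable (fun x => 1 - t * W x + t ^ 2 * (2 / r ^ 2 * Real.exp (2 * r * M x))) ν :=
    ((integrable_const 1).sub (hiW.const_mul t)).add ((hi.const_mul _).const_mul _)
  have hint : Integrable (fun x => Real.exp (-t * W x)) ν :=
    hdom.mono' (by fun_prop) (Filter.Eventually.of_forall fun x => by
      rw [Real.norm_eq_abs, Real.abs_exp]; exact hpt x)
  refine ⟨hint, (integral_mono hint hdom hpt).trans ?_⟩
  rw [integral_one_sub_mul_add hiW ((hi.const_mul _).const_mul _), integral_const_mul,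
    integral_const_mul]
  have h6 : t ^ 2 * (2 / r ^ 2 * ∫ x, Real.exp (2 * r * M x) ∂ν) ≤ t ^ 2 * (2 * A / r ^ 2) := by
    calc _ ≤ t ^ 2 * (2 / r ^ 2 * A) := by gcongr
      _ = _ := by ring
  have h7 := Real.add_one_le_exp (-t * (∫ x, W x ∂ν) + t ^ 2 * (2 * A / r ^ 2))
  linarith

/-- For a nonnegative variable the lower tail needs only a second moment, since `exp (-y) ≤ 1 - y +
y²` for `y ≥ 0`. -/
theorem integral_exp_neg_le_of_nonneg {W : S → ℝ} (hW : Measurable W) (hW0 : ∀ x, 0 ≤ W x)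
    (hi : Integrable W ν) (hi2 : Integrable (fun x => W x ^ 2) ν) {A : ℝ}
    (hA : ∫ x, W x ^ 2 ∂ν ≤ A) {t : ℝ} (ht : 0 ≤ t) :
    Integrable (fun x => Real.exp (-t * W x)) ν ∧
      ∫ x, Real.exp (-t * W x) ∂ν ≤ Real.exp (-t * (∫ x, W x ∂ν) + t ^ 2 * A) := by
  have hpt : ∀ x, Real.exp (-t * W x) ≤ 1 - t * W x + t ^ 2 * W x ^ 2 := fun x => by
    have := Real.exp_neg_le_quadratic (mul_nonneg ht (hW0 x))
    rw [neg_mul]; rwa [mul_pow] at this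
  have hdom : Integrable (fun x => 1 - t * W x + t ^ 2 * W x ^ 2) ν :=
    ((integrable_const 1).sub (hi.const_mul t)).add (hi2.const_mul _)
  have hint : Integrable (fun x => Real.exp (-t * W x)) ν :=
    hdom.mono' (by fun_prop) (Filter.Eventually.of_forall fun x => by
      rw [Real.norm_eq_abs, Real.abs_exp]; exact hpt x)
  refine ⟨hint, (integral_mono hint hdom hpt).trans ?_⟩
  rw [integral_one_sub_mul_add hi (hi2.const_mul _), integral_const_mul]
  have h6 : t ^ 2 * ∫ x, W x ^ 2 ∂ν ≤ t ^ 2 * A := by gcongr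
  have h7 := Real.add_one_le_exp (-t * (∫ x, W x ∂ν) + t ^ 2 * A)
  linarith

variable {p : ℕ}

variable (ν p) in
theorem iIndepFun_comp_eval {W : S → ℝ} (hW : Measurable W) :
    iIndepFun (fun (k : Fin p) (z : Fin p → S) => W (z k)) (Measure.pi fun _ => ν) :=
  iIndepFun_pi (X := fun _ x => W x) fun _ => hW.aemeasurable

variable (ν) in
theorem integral_comp_eval {W : S → ℝ} (hW : Measurable W) (k : Fin p) :
    ∫ z : Fin p → S, W (z k) ∂(Measure.pi fun _ => ν) = ∫ x, W x ∂ν := by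
  have h := measurePreserving_eval (fun _ : Fin p => ν) k
  have h2 := integral_map (μ := Measure.pi fun _ : Fin p => ν) h.measurable.aemeasurable
    (f := W) hW.aestronglyMeasurable
  rw [h.map_eq] at h2
  exact h2.symm

theorem measure_sum_le_of_integral_exp_neg_le {W : S → ℝ} (hW : Measurable W) {t m K s : ℝ}
    (ht : 0 ≤ t) (hm : m ≤ ∫ x, W x ∂ν) (hi : Integrable (fun x => Real.exp (-t * W x)) ν)
    (hb : ∫ x, Real.exp (-t * W x) ∂ν ≤ Real.exp (-t * (∫ x, W x ∂ν) + t ^ 2 * K)) :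
    (Measure.pi fun _ : Fin p => ν).real {z | ∑ k, W (z k) ≤ p * (m - s)} ≤
      Real.exp (-(p * (t * s - t ^ 2 * K))) := by
  have hind := iIndepFun_comp_eval ν p hW
  have hmeas : ∀ k : Fin p, Measurable fun z : Fin p → S => W (z k) := fun k => by fun_prop
  have hmgf1 : ∀ k : Fin p, mgf (fun z : Fin p → S => W (z k)) (Measure.pi fun _ => ν) (-t) ≤
      Real.exp (-t * m + t ^ 2 * K) := fun k => by
    rw [mgf, integral_comp_eval ν (W := fun x => Real.exp (-t * W x)) (by fun_prop) k]
    refine hb.trans (Real.exp_le_exp.2 ?_)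
    nlinarith
  have hmgf : mgf (∑ k : Fin p, fun z : Fin p → S => W (z k)) (Measure.pi fun _ => ν) (-t) ≤
      Real.exp (p * (-t * m + t ^ 2 * K)) := by
    rw [hind.mgf_sum hmeas Finset.univ]
    calc _ ≤ ∏ _k : Fin p, Real.exp (-t * m + t ^ 2 * K) :=
          Finset.prod_le_prod (fun k _ => mgf_nonneg) fun k _ => hmgf1 k
      _ = _ := by rw [Finset.prod_const, Finset.card_univ, Fintype.card_fin, Real.exp_nat_mul]
  have hint : Integrable (fun z : Fin p → S => Real.exp (-t * (∑ k, fun z : Fin p → S => W (z k)) z))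
      (Measure.pi fun _ => ν) := by
    refine hind.integrable_exp_mul_sum hmeas fun k _ => ?_
    exact ((measurePreserving_eval (fun _ : Fin p => ν) k).integrable_comp
      hi.aestronglyMeasurable).2 hi
  have h := measure_le_le_exp_mul_mgf (p * (m - s)) (neg_nonpos.2 ht) hint
  simp only [Finset.sum_apply] at h
  refine h.trans ?_
  calc _ ≤ Real.exp (- -t * (p * (m - s))) * Real.exp (p * (-t * m + t ^ 2 * K)) := by gcongr
    _ = _ := by rw [← Real.exp_add]; ring_nf

/-- Lower tail of a sum with the exponential parameter optimized. -/
theorem measure_sum_le_exp_neg_sq {W : S → ℝ} (hW : Measurable W) {m K s : ℝ} (hK : 0 < K)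
    (hs : 0 ≤ s) (hm : m ≤ ∫ x, W x ∂ν)
    (h : Integrable (fun x => Real.exp (-(s / (2 * K)) * W x)) ν ∧
      ∫ x, Real.exp (-(s / (2 * K)) * W x) ∂ν ≤
        Real.exp (-(s / (2 * K)) * (∫ x, W x ∂ν) + (s / (2 * K)) ^ 2 * K)) :
    (Measure.pi fun _ : Fin p => ν).real {z | ∑ k, W (z k) ≤ p * (m - s)} ≤
      Real.exp (-(p * (s ^ 2 / (4 * K)))) := by
  -- The parameter `t = s / (2K)` maximizes `t s - t² K`, with value `s² / (4K)`.
  refine (measure_sum_le_of_integral_exp_neg_le hW (by positivity) hm h.1 h.2).trans (le_of_eq ?_)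
  congr 3
  field_simp
  ring

end Concentration

/-! ### Tail bounds for each statistic at a fixed parameter. -/

section Tails

variable {d p : ℕ}

/-- The joint law of `p` independent columns with `d + 1` independent `BG(θ)` entries each. -/
noncomputable abbrev columnsLaw (θ : unitInterval) (d p : ℕ) :
    Measure (Fin p → Fin (d + 1) → ℝ) :=
  Measure.pi fun _ => Measure.pi fun _ => bernoulliGaussian θ

/-- Both the mean `θ/μ` and the second moment `θ/μ²` are linear in `θ`, so the exponent is of order
`pθ` and `μ` cancels. -/
theorem curvatureTerm_tail {θ : unitInterval} (hθ0 : 0 < (θ : ℝ)) (hθ : (θ : ℝ) ≤ 1 / 2) {μ : ℝ}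
    (hμ : 0 < μ) {w v : EuclideanSpace ℝ (Fin d)} (hv : ‖v‖ = 1) (hw : ‖w‖ ≤ μ / 5)
    (hw' : ‖w‖ ≤ 1 / 2) :
    (columnsLaw θ d p).real {z | ∑ k, curvatureTerm μ w v (z k) ≤ p * (θ / (5 * μ))} ≤
      Real.exp (-(p * (θ / 600))) := by
  have h := measure_sum_le_exp_neg_sq (p := p) (measurable_curvatureTerm μ w v)
    (K := 6 * θ / μ ^ 2) (s := θ / (5 * μ)) (by positivity) (by positivity)
    (le_integral_curvatureTerm hθ hμ hv hw)
    (integral_exp_neg_le_of_nonneg (measurable_curvatureTerm μ w v) (curvatureTerm_nonneg hμ w v)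
      (integrable_curvatureTerm θ hμ w v) (integrable_curvatureTerm_sq θ hμ w v)
      (integral_curvatureTerm_sq_le θ hμ hv hw') (by positivity))
  have e1 : 2 / 5 * ((θ : ℝ) / μ) - θ / (5 * μ) = θ / (5 * μ) := by field_simp; norm_num
  have e2 : ((θ : ℝ) / (5 * μ)) ^ 2 / (4 * (6 * θ / μ ^ 2)) = θ / 600 := by field_simp; norm_num
  rwa [e1, e2] at h

theorem radialGradTerm_tail {θ : unitInterval} (hθ0 : 0 < (θ : ℝ)) (hθ : (θ : ℝ) ≤ 1 / 2) {μ : ℝ}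
    (hμ : 0 < μ) {w : EuclideanSpace ℝ (Fin d)} (hw : μ / 6 ≤ ‖w‖) (hw' : ‖w‖ ≤ 1 / 40) :
    (columnsLaw θ d p).real {z | ∑ k, radialGradTerm μ w (z k) ≤ p * (θ / 40 * ‖w‖)} ≤
      Real.exp (-(p * (θ ^ 2 / 691200))) := by
  have hs : 0 < ‖w‖ := lt_of_lt_of_le (by positivity) hw
  set c : Fin (d + 1) → ℝ := Fin.snoc (α := fun _ => ℝ) (fun i => w i) (-(‖w‖ ^ 2 / liftHeight w))
  have hq : liftHeight w ^ 2 = 1 - ‖w‖ ^ 2 := Real.sq_sqrt (by nlinarith)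
  have hc : ∑ i, c i ^ 2 ≤ 3 / 2 * ‖w‖ ^ 2 := by
    rw [sum_sq_snoc, neg_sq, div_pow, hq]
    have : (‖w‖ ^ 2) ^ 2 / (1 - ‖w‖ ^ 2) ≤ 1 / 2 * ‖w‖ ^ 2 := by
      have hs2 : ‖w‖ ^ 2 ≤ 1 / 1600 := by nlinarith
      rw [div_le_iff₀ (by linarith)]
      nlinarith [mul_nonneg (sq_nonneg ‖w‖) (sub_nonneg.2 hs2)]
    linarith
  have hexp : ∫ x, Real.exp (2 * 1 * (1 / ‖w‖ * |linForm c x|))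
      ∂(Measure.pi fun _ => bernoulliGaussian θ) ≤ 54 := by
    simp_rw [← mul_assoc]
    refine (integral_exp_abs_linForm_le θ c _).trans ?_
    have h1 : (∑ i, c i ^ 2) * (2 * 1 * (1 / ‖w‖)) ^ 2 / 2 ≤ 3 := by
      calc (∑ i, c i ^ 2) * (2 * 1 * (1 / ‖w‖)) ^ 2 / 2 ≤
          (3 / 2 * ‖w‖ ^ 2) * (2 * 1 * (1 / ‖w‖)) ^ 2 / 2 := by gcongr
        _ = 3 := by field_simp
    have h2 : Real.exp 3 ≤ 27 := by
      have := Real.exp_one_lt_d9.le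
      calc Real.exp 3 = Real.exp 1 ^ 3 := by rw [← Real.exp_nat_mul]; norm_num
        _ ≤ 3 ^ 3 := by gcongr; linarith
        _ = 27 := by norm_num
    linarith [Real.exp_le_exp.2 h1]
  have hint : Integrable (fun x => Real.exp (2 * 1 * (1 / ‖w‖ * |linForm c x|)))
      (Measure.pi fun _ => bernoulliGaussian θ) := by
    simp_rw [← mul_assoc]
    exact integrable_exp_abs_linForm θ c _
  -- Dividing by `‖w‖` makes both the mean and the exponential moments independent of the radius.
  -- The moment bound 54 is `2 * 27`, with `exp 3 ≤ 27`.
  have h := measure_sum_le_exp_neg_sq (p := p) (W := fun x => 1 / ‖w‖ * radialGradTerm μ w x)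
    (ν := Measure.pi fun _ : Fin (d + 1) => bernoulliGaussian θ)
    ((measurable_radialGradTerm μ w).const_mul _)
    (m := θ / 20) (K := 2 * 54 / 1 ^ 2) (s := θ / 40) (by positivity) (by positivity)
    (by
      rw [integral_const_mul, one_div, inv_mul_eq_div, le_div_iff₀ hs]
      exact le_integral_radialGradTerm hθ hμ hw hw')
    (integral_exp_neg_le_of_abs_le ((measurable_radialGradTerm μ w).const_mul _)
      (M := fun x => 1 / ‖w‖ * |linForm c x|) (fun x => by
        rw [abs_mul, abs_of_pos (by positivity : 0 < 1 / ‖w‖)]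
        exact mul_le_mul_of_nonneg_left (abs_radialGradTerm_le μ w x) (by positivity))
      one_pos hint hexp (by positivity) (by linarith))
  have e1 : ∀ z : Fin p → Fin (d + 1) → ℝ,
      (∑ k, 1 / ‖w‖ * radialGradTerm μ w (z k) ≤ p * ((θ : ℝ) / 20 - θ / 40)) ↔
        ∑ k, radialGradTerm μ w (z k) ≤ p * (θ / 40 * ‖w‖) := fun z => by
    rw [← Finset.mul_sum, one_div, inv_mul_eq_div, div_le_iff₀ hs]
    ring_nf
  simp only [e1] at h
  have e2 : ((θ : ℝ) / 40) ^ 2 / (4 * (2 * 54 / 1 ^ 2)) = θ ^ 2 / 691200 := by ring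
  rwa [e2] at h

theorem radialHessTerm_tail {θ : unitInterval} (hθ0 : 0 < (θ : ℝ)) (hθ : (θ : ℝ) ≤ 1 / 2) {μ : ℝ}
    (hμ : 0 < μ) (hμd : μ * d ≤ 1 / 32000) {w : EuclideanSpace ℝ (Fin d)}
    (hμq : 8 * μ ≤ liftHeight w) (hw : 1 / 2000 ≤ ‖w‖ ^ 2) :
    (columnsLaw θ d p).real {z | ∑ k, -radialHessTerm μ w (z k) ≤ p * (θ / 64000)} ≤
      Real.exp (-(p * ((θ / 64000) ^ 2 / (4 * (384 * (3 / (μ * liftHeight w ^ 2)) ^ 2))))) := by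
  have hq : 0 < liftHeight w := by linarith
  have hw2 := norm_sq_eq_one_sub_liftHeight_sq hq
  have hq1 : liftHeight w ≤ 1 := by nlinarith [sq_nonneg ‖w‖]
  set κ := 3 / (μ * liftHeight w ^ 2) with hκd
  have hκ : 1 ≤ κ := by
    rw [hκd, le_div_iff₀ (by positivity)]
    nlinarith [mul_le_mul (by linarith : μ ≤ 1) (by nlinarith : liftHeight w ^ 2 ≤ 1)
      (by positivity) zero_le_one]
  have e0 : ∀ x : ℝ, 2 * (1 / (8 * κ)) * (κ * (1 + x ^ 2)) = 1 / 4 + x ^ 2 / 4 := fun x => by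
    field_simp; norm_num
  have hexp : ∫ x : Fin (d + 1) → ℝ, Real.exp (2 * (1 / (8 * κ)) * (κ * (1 + x (Fin.last d) ^ 2)))
      ∂(Measure.pi fun _ => bernoulliGaussian θ) ≤ 3 := by
    simp_rw [e0, Real.exp_add]
    rw [integral_const_mul, integral_eval_pi (f := fun t => Real.exp (t ^ 2 / 4)) (by fun_prop)]
    have h1 := integral_exp_sq_bernoulliGaussian_le θ
    have h2 : Real.exp (1 / 4) ≤ 4 / 3 := by
      have := Real.one_sub_le_exp_neg (1 / 4)
      rw [Real.exp_neg] at this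
      have h3 := inv_anti₀ (by norm_num) this
      rw [inv_inv] at h3
      linarith
    nlinarith [Real.exp_pos (1 / 4 : ℝ)]
  have hint : Integrable (fun x : Fin (d + 1) → ℝ =>
      Real.exp (2 * (1 / (8 * κ)) * (κ * (1 + x (Fin.last d) ^ 2))))
      (Measure.pi fun _ => bernoulliGaussian θ) := by
    simp_rw [e0, Real.exp_add]
    exact (integrable_last (integrable_exp_sq_bernoulliGaussian θ)).const_mul _
  -- The rate `r = 1 / (8κ)` is chosen so that the doubled exponent is `(1 + x²)/4`, within reach of
  -- the Gaussian square-exponential moment.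
  have hK : 2 * 3 / (1 / (8 * κ)) ^ 2 = 384 * κ ^ 2 := by field_simp; norm_num
  -- The mean is at least `θ (1/16000 - 1/32000)`, from `‖w‖² ≥ 1/2000` and `μ d ≤ 1/32000`; half of
  -- it is given up as deviation.
  have h := measure_sum_le_exp_neg_sq (p := p) (W := fun x => -radialHessTerm μ w x)
    (ν := Measure.pi fun _ : Fin (d + 1) => bernoulliGaussian θ)
    (measurable_radialHessTerm μ w).neg
    (m := θ / 32000) (K := 384 * κ ^ 2) (s := θ / 64000) (by positivity) (by positivity)
    (by
      rw [integral_neg]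
      have := integral_radialHessTerm_le hθ hμ hμq
      nlinarith)
    (hK ▸ integral_exp_neg_le_of_abs_le (measurable_radialHessTerm μ w).neg
      (M := fun x => κ * (1 + x (Fin.last d) ^ 2)) (fun x => by
        rw [Pi.neg_apply, abs_neg]; exact abs_radialHessTerm_le hμ hμq x)
      (r := 1 / (8 * κ)) (by positivity) hint hexp (by positivity) (by
        rw [hK, div_le_div_iff₀ (by positivity) (by positivity)]
        nlinarith))
  have e1 : (θ : ℝ) / 32000 - θ / 64000 = θ / 64000 := by ring
  rwa [e1] at h

theorem sum_abs_last_tail (θ : unitInterval) :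
    (columnsLaw θ d p).real {z | 2 * (p : ℝ) ≤ ∑ k, |z k (Fin.last d)|} ≤
      Real.exp (-(p * (1 / 216))) := by
  set c : Fin (d + 1) → ℝ := Pi.single (Fin.last d) 1
  have hc : ∀ x, linForm c x = x (Fin.last d) := fun x => by
    simp [linForm, c, Pi.single_apply]
  have hcs : ∑ i, c i ^ 2 = 1 := by
    simp [c, Pi.single_apply]
  have hexp := integral_exp_abs_linForm_le θ c (2 * 1)
  have hint := integrable_exp_abs_linForm θ c (2 * 1)
  simp only [hc, hcs] at hexp hint
  have h3 : 2 * Real.exp (1 * (2 * 1) ^ 2 / 2) ≤ 27 := by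
    have := Real.exp_one_lt_d9.le
    have h2 : Real.exp (1 * (2 * 1) ^ 2 / 2) = Real.exp 1 ^ 2 := by
      rw [← Real.exp_nat_mul]; norm_num
    rw [h2]
    nlinarith [Real.exp_pos 1]
  have h := measure_sum_le_exp_neg_sq (p := p) (W := fun x => -|x (Fin.last d)|)
    (ν := Measure.pi fun _ : Fin (d + 1) => bernoulliGaussian θ)
    (by fun_prop) (m := -1) (K := 2 * 27 / 1 ^ 2) (s := 1) (by norm_num) (by norm_num)
    (by
      rw [integral_neg, integral_eval_pi (f := fun t => |t|) (by fun_prop)]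
      linarith [integral_abs_bernoulliGaussian_le θ, θ.2.2])
    (integral_exp_neg_le_of_abs_le (by fun_prop) (M := fun x => |x (Fin.last d)|)
      (fun x => by rw [abs_neg, abs_abs]) one_pos hint (hexp.trans h3) (by norm_num) (by norm_num))
  have e1 : ∀ z : Fin p → Fin (d + 1) → ℝ,
      (∑ k, -|z k (Fin.last d)| ≤ p * (-1 - 1)) ↔ 2 * (p : ℝ) ≤ ∑ k, |z k (Fin.last d)| := fun z => by
    rw [Finset.sum_neg_distrib]
    constructor <;> intro h <;> linarith
  simp only [e1] at h
  refine h.trans (le_of_eq ?_)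
  norm_num

/-- Because `|tanh| < 1`, the exponent is a convex combination of `t x` and `-t x` with weights
depending only on the last entry. Convexity of `exp` and independence then give the moment
generating function bound of a single entry, which also forces mean zero. -/
theorem hasSubgaussianMGF_tanh_mul (θ : unitInterval) (μ : ℝ) (i : Fin d) :
    HasSubgaussianMGF
      (fun x : Fin (d + 1) → ℝ => Real.tanh (x (Fin.last d) / μ) * x i.castSucc) 1
      (Measure.pi fun _ => bernoulliGaussian θ) := by
  have hm : ∀ t : ℝ, Integrable (fun x : Fin (d + 1) → ℝ => Real.exp (t * x i.castSucc))
      (Measure.pi fun _ => bernoulliGaussian θ) := fun t =>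
    integrable_eval_pi (integrable_exp_mul_bernoulliGaussian θ t) _
  have hconv : ∀ (t : ℝ) (x : Fin (d + 1) → ℝ),
      Real.exp (t * (Real.tanh (x (Fin.last d) / μ) * x i.castSucc)) ≤
        (1 + Real.tanh (x (Fin.last d) / μ)) / 2 * Real.exp (t * x i.castSucc) +
        (1 - Real.tanh (x (Fin.last d) / μ)) / 2 * Real.exp (-t * x i.castSucc) := fun t x => by
    have h1 := (Real.abs_tanh_lt_one (x (Fin.last d) / μ)).le
    rw [abs_le] at h1
    have h := convexOn_exp.2 (Set.mem_univ (t * x i.castSucc)) (Set.mem_univ (-t * x i.castSucc))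
      (by linarith : 0 ≤ (1 + Real.tanh (x (Fin.last d) / μ)) / 2)
      (by linarith : 0 ≤ (1 - Real.tanh (x (Fin.last d) / μ)) / 2) (by ring)
    simp only [smul_eq_mul] at h
    refine le_trans (le_of_eq ?_) h
    congr 1; ring
  have hb : ∀ y : ℝ, |(1 + Real.tanh y) / 2| ≤ 1 ∧ |(1 - Real.tanh y) / 2| ≤ 1 := fun y => by
    have := abs_le.1 (Real.abs_tanh_lt_one y).le
    constructor <;> rw [abs_le] <;> constructor <;> linarith
  have i1 : ∀ t : ℝ, Integrable (fun x : Fin (d + 1) → ℝ =>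
      (1 + Real.tanh (x (Fin.last d) / μ)) / 2 * Real.exp (t * x i.castSucc))
      (Measure.pi fun _ => bernoulliGaussian θ) := fun t =>
    (hm t).bdd_mul (c := 1) (Measurable.aestronglyMeasurable (by fun_prop)) (Filter.Eventually.of_forall fun x => (hb _).1)
  have i2 : ∀ t : ℝ, Integrable (fun x : Fin (d + 1) → ℝ =>
      (1 - Real.tanh (x (Fin.last d) / μ)) / 2 * Real.exp (t * x i.castSucc))
      (Measure.pi fun _ => bernoulliGaussian θ) := fun t =>
    (hm t).bdd_mul (c := 1) (Measurable.aestronglyMeasurable (by fun_prop)) (Filter.Eventually.of_forall fun x => (hb _).2)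
  have hI : ∀ t : ℝ, Integrable (fun x : Fin (d + 1) → ℝ =>
      Real.exp (t * (Real.tanh (x (Fin.last d) / μ) * x i.castSucc)))
      (Measure.pi fun _ => bernoulliGaussian θ) := fun t =>
    ((i1 t).add (i2 (-t))).mono' (by fun_prop) (Filter.Eventually.of_forall fun x => by
      rw [Real.norm_eq_abs, Real.abs_exp]; exact hconv t x)
  refine ⟨hI, fun t => ?_⟩
  have hle := integral_mono (hI t) ((i1 t).add (i2 (-t))) (hconv t)
  rw [integral_add' (i1 t) (i2 (-t)),
    integral_last_mul_head (fun s => (1 + Real.tanh (s / μ)) / 2)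
      (fun y : Fin d → ℝ => Real.exp (t * y i)),
    integral_last_mul_head (fun s => (1 - Real.tanh (s / μ)) / 2)
      (fun y : Fin d → ℝ => Real.exp (-t * y i)),
    integral_eval_pi (f := fun y => Real.exp (t * y)) (by fun_prop),
    integral_eval_pi (f := fun y => Real.exp (-t * y)) (by fun_prop)] at hle
  have hs := hasSubgaussianMGF_bernoulliGaussian θ
  have h1 := hs.mgf_le t
  have h2 := hs.mgf_le (-t)
  rw [mgf] at h1 h2 ⊢
  have hti : Integrable (fun s => Real.tanh (s / μ)) (bernoulliGaussian θ) :=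
    (integrable_const (1 : ℝ)).mono' (by fun_prop)
      (Filter.Eventually.of_forall fun s => (Real.abs_tanh_lt_one _).le)
  have ha : ∫ s, (1 + Real.tanh (s / μ)) / 2 ∂bernoulliGaussian θ =
      (1 + ∫ s, Real.tanh (s / μ) ∂bernoulliGaussian θ) / 2 := by
    rw [integral_div, integral_add (integrable_const 1) hti]; simp
  have hb' : ∫ s, (1 - Real.tanh (s / μ)) / 2 ∂bernoulliGaussian θ =
      (1 - ∫ s, Real.tanh (s / μ) ∂bernoulliGaussian θ) / 2 := by
    rw [integral_div, integral_sub (integrable_const 1) hti]; simp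
  have hc : |∫ s, Real.tanh (s / μ) ∂bernoulliGaussian θ| ≤ 1 := by
    have := norm_integral_le_of_norm_le_const (μ := bernoulliGaussian θ)
      (f := fun s => Real.tanh (s / μ)) (C := 1)
      (Filter.Eventually.of_forall fun s => (Real.abs_tanh_lt_one _).le)
    simpa using this
  rw [ha, hb'] at hle
  rw [abs_le] at hc
  rw [neg_sq] at h2
  refine hle.trans ?_
  nlinarith

theorem abs_sum_tanh_mul_tail (θ : unitInterval) (μ : ℝ) (i : Fin d) {ε : ℝ} (hε : 0 ≤ ε) :
    (columnsLaw θ d p).real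
      {z | ε ≤ |∑ k, Real.tanh (z k (Fin.last d) / μ) * z k i.castSucc|} ≤
      2 * Real.exp (-ε ^ 2 / (2 * p)) := by
  have hmeas : Measurable fun x : Fin (d + 1) → ℝ =>
      Real.tanh (x (Fin.last d) / μ) * x i.castSucc := by fun_prop
  have hind := iIndepFun_comp_eval (Measure.pi fun _ : Fin (d + 1) => bernoulliGaussian θ) p hmeas
  have hsub : ∀ k : Fin p, HasSubgaussianMGF (fun z : Fin p → Fin (d + 1) → ℝ =>
      Real.tanh (z k (Fin.last d) / μ) * z k i.castSucc) 1 (columnsLaw θ d p) := fun k => by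
    have he := measurePreserving_eval
      (fun _ : Fin p => Measure.pi fun _ : Fin (d + 1) => bernoulliGaussian θ) k
    have h2 := hasSubgaussianMGF_tanh_mul θ μ i
    rw [← he.map_eq] at h2
    exact HasSubgaussianMGF.of_map he.measurable.aemeasurable h2
  have hsum := HasSubgaussianMGF.sum_of_iIndepFun hind (s := Finset.univ) (c := fun _ => 1)
    fun k _ => hsub k
  simp only [Finset.sum_const, Finset.card_univ, Fintype.card_fin, nsmul_eq_mul, mul_one] at hsum
  have h1 := hsum.measure_ge_le hε
  have h2 := hsum.neg.measure_ge_le hε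
  have hsubset : {z : Fin p → Fin (d + 1) → ℝ |
      ε ≤ |∑ k, Real.tanh (z k (Fin.last d) / μ) * z k i.castSucc|} ⊆
      {z | ε ≤ ∑ k, Real.tanh (z k (Fin.last d) / μ) * z k i.castSucc} ∪
      {z | ε ≤ (-fun z : Fin p → Fin (d + 1) → ℝ =>
        ∑ k, Real.tanh (z k (Fin.last d) / μ) * z k i.castSucc) z} := fun z hz => by
    simpa [le_abs] using hz
  refine (measureReal_mono hsubset).trans ((measureReal_union_le _ _).trans ?_)
  push_cast at h1 h2
  linarith

theorem entry_tail (θ : unitInterval) (k : Fin p) (i : Fin (d + 1)) {T : ℝ} (hT : 0 ≤ T) :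
    (columnsLaw θ d p).real {z | T ≤ |z k i|} ≤ 2 * Real.exp (-T ^ 2 / 2) := by
  have hsub : HasSubgaussianMGF (fun z : Fin p → Fin (d + 1) → ℝ => z k i) 1
      (columnsLaw θ d p) := by
    have he := (measurePreserving_eval (fun _ : Fin (d + 1) => bernoulliGaussian θ) i).comp
      (measurePreserving_eval
        (fun _ : Fin p => Measure.pi fun _ : Fin (d + 1) => bernoulliGaussian θ) k)
    have h2 := hasSubgaussianMGF_bernoulliGaussian θ
    rw [← he.map_eq] at h2
    exact HasSubgaussianMGF.of_map he.measurable.aemeasurable h2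
  have h1 := hsub.measure_ge_le hT
  have h2 := hsub.neg.measure_ge_le hT
  have hsubset : {z : Fin p → Fin (d + 1) → ℝ | T ≤ |z k i|} ⊆
      {z | T ≤ z k i} ∪ {z | T ≤ (-fun z : Fin p → Fin (d + 1) → ℝ => z k i) z} := fun z hz => by
    simpa [le_abs] using hz
  refine (measureReal_mono hsubset).trans ((measureReal_union_le _ _).trans ?_)
  push_cast at h1 h2
  rw [mul_one] at h1 h2
  linarith

end Tails

/-! ### Nets and Lipschitz bounds -/

section Nets

/-- Cells of side `1/N` are labelled by integer parts, and one point of `K` is kept in each cell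
that `K` meets. The net thus lies inside `K`, which is needed since the tail bounds hold only there.
-/
theorem exists_finset_net {d : ℕ} (K : Set (EuclideanSpace ℝ (Fin d))) (hK : ∀ x ∈ K, ‖x‖ ≤ 1)
    {N : ℕ} (hN : 0 < N) :
    ∃ t : Finset (EuclideanSpace ℝ (Fin d)), (∀ y ∈ t, y ∈ K) ∧ t.card ≤ (2 * N + 1) ^ d ∧
      ∀ x ∈ K, ∃ y ∈ t, dist x y ≤ d / N := by
  classical
  have hN' : (0 : ℝ) < N := by exact_mod_cast hN
  let f : EuclideanSpace ℝ (Fin d) → Fin d → ℤ := fun x i => ⌊N * x i⌋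
  let T : Finset (Fin d → ℤ) := Fintype.piFinset fun _ => Finset.Icc (-(N : ℤ)) N
  have hmaps : ∀ x ∈ K, f x ∈ T := fun x hx => by
    refine Fintype.mem_piFinset.2 fun i => Finset.mem_Icc.2 ?_
    have h1 : |x i| ≤ 1 := (by simpa using PiLp.norm_apply_le x i : |x i| ≤ ‖x‖).trans (hK x hx)
    rw [abs_le] at h1
    constructor
    · refine Int.le_floor.2 ?_
      push_cast
      nlinarith
    · refine Int.floor_le_iff.2 ?_
      push_cast
      nlinarith
  have hsub : f '' K ⊆ T := by
    rintro _ ⟨x, hx, rfl⟩; exact hmaps x hx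
  obtain ⟨u, huK, hu⟩ := (Set.surjOn_image f K).exists_bijOn_subset
  have hufin : u.Finite := by
    refine Set.Finite.of_finite_image ?_ hu.injOn
    rw [hu.image_eq]
    exact T.finite_toSet.subset hsub
  refine ⟨hufin.toFinset, fun y hy => huK (hufin.mem_toFinset.1 hy), ?_, fun x hx => ?_⟩
  · have h1 : hufin.toFinset.card ≤ T.card := by
      refine Finset.card_le_card_of_injOn f (fun y hy => ?_) ?_
      · exact hmaps y (huK (hufin.mem_toFinset.1 hy))
      · rw [hufin.coe_toFinset]; exact hu.injOn
    refine h1.trans (le_of_eq ?_)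
    simp only [T, Fintype.card_piFinset, Int.card_Icc, Finset.prod_const, Finset.card_univ,
      Fintype.card_fin]
    congr 1
    omega
  · obtain ⟨y, hy, hxy⟩ := hu.surjOn (Set.mem_image_of_mem f hx)
    refine ⟨y, hufin.mem_toFinset.2 hy, ?_⟩
    rw [EuclideanSpace.dist_eq]
    have hc : ∀ i, dist (x i) (y i) ^ 2 ≤ (1 / N) ^ 2 := fun i => by
      have h1 : ⌊N * y i⌋ = ⌊N * x i⌋ := congrFun hxy i
      have h2 := Int.abs_sub_lt_one_of_floor_eq_floor h1.symm
      rw [← mul_sub, abs_mul, abs_of_pos hN'] at h2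
      rw [Real.dist_eq]
      have : |x i - y i| ≤ 1 / N := by
        rw [le_div_iff₀ hN']; linarith
      gcongr
    refine Real.sqrt_le_iff.2 ⟨by positivity, ?_⟩
    calc ∑ i, dist (x i) (y i) ^ 2 ≤ ∑ _i : Fin d, (1 / (N : ℝ)) ^ 2 :=
          Finset.sum_le_sum fun i _ => hc i
      _ = d * (1 / (N : ℝ)) ^ 2 := by simp
      _ ≤ d ^ 2 * (1 / (N : ℝ)) ^ 2 := by
          gcongr
          exact_mod_cast Nat.le_self_pow two_ne_zero d
      _ = (d / N) ^ 2 := by ring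

/-- `f` is bounded by `B` and `B`-Lipschitz on `S`. -/
def BddLipOn {α : Type*} [PseudoMetricSpace α] (S : Set α) (B : ℝ) (f : α → ℝ) : Prop :=
  (∀ x ∈ S, |f x| ≤ B) ∧ ∀ x ∈ S, ∀ y ∈ S, |f x - f y| ≤ B * dist x y

namespace BddLipOn

variable {α β : Type*} [PseudoMetricSpace α] [PseudoMetricSpace β] {S : Set α} {f g : α → ℝ}
  {T : ℝ} {a b : ℕ}

theorem mono_const {B B' : ℝ} (h : BddLipOn S B f) (hB : B ≤ B') : BddLipOn S B' f :=
  ⟨fun x hx => (h.1 x hx).trans hB, fun x hx y hy =>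
    (h.2 x hx y hy).trans (mul_le_mul_of_nonneg_right hB dist_nonneg)⟩

theorem congr {B : ℝ} (h : BddLipOn S B f) (hg : ∀ x ∈ S, g x = f x) : BddLipOn S B g :=
  ⟨fun x hx => by rw [hg x hx]; exact h.1 x hx, fun x hx y hy => by
    rw [hg x hx, hg y hy]; exact h.2 x hx y hy⟩

theorem const {c B : ℝ} (h : |c| ≤ B) : BddLipOn S B fun _ => c :=
  ⟨fun _ _ => h, fun _ _ _ _ => by
    simpa using mul_nonneg ((abs_nonneg c).trans h) dist_nonneg⟩

theorem comp {S' : Set β} {B : ℝ} {φ : β → α} (h : BddLipOn S B f) (hφ : ∀ x ∈ S', φ x ∈ S)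
    (hl : ∀ x y, dist (φ x) (φ y) ≤ dist x y) (hB : 0 ≤ B) : BddLipOn S' B fun x => f (φ x) :=
  ⟨fun x hx => h.1 _ (hφ x hx), fun x hx y hy =>
    (h.2 _ (hφ x hx) _ (hφ y hy)).trans (mul_le_mul_of_nonneg_left (hl x y) hB)⟩

/-- The bookkeeping rule behind all the exponents below: a sum or product of functions with
constants `T^a` and `T^b` has constant `T^(a+b+1)`, the extra power paying for the factor 2 in the
product rule. -/
theorem two_mul_pow_le (hT : 2 ≤ T) (a b : ℕ) : 2 * (T ^ a * T ^ b) ≤ T ^ (a + b + 1) := by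
  rw [pow_succ, pow_add, mul_comm]
  gcongr

theorem pow_add_pow_le (hT : 2 ≤ T) (a b : ℕ) : T ^ a + T ^ b ≤ T ^ (a + b + 1) := by
  have ha : 1 ≤ T ^ a := one_le_pow₀ (by linarith)
  have hb : 1 ≤ T ^ b := one_le_pow₀ (by linarith)
  nlinarith [two_mul_pow_le hT a b]

theorem add (hT : 2 ≤ T) (hf : BddLipOn S (T ^ a) f) (hg : BddLipOn S (T ^ b) g) :
    BddLipOn S (T ^ (a + b + 1)) fun x => f x + g x := by
  refine mono_const (B := T ^ a + T ^ b) ⟨fun x hx => ?_, fun x hx y hy => ?_⟩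
    (pow_add_pow_le hT a b)
  · exact (abs_add_le _ _).trans (add_le_add (hf.1 x hx) (hg.1 x hx))
  · rw [add_sub_add_comm, add_mul]
    exact (abs_add_le _ _).trans (add_le_add (hf.2 x hx y hy) (hg.2 x hx y hy))

theorem neg {B : ℝ} (hf : BddLipOn S B f) : BddLipOn S B fun x => -f x :=
  ⟨fun x hx => by rw [abs_neg]; exact hf.1 x hx, fun x hx y hy => by
    rw [neg_sub_neg, abs_sub_comm]; exact hf.2 x hx y hy⟩

theorem sub (hT : 2 ≤ T) (hf : BddLipOn S (T ^ a) f) (hg : BddLipOn S (T ^ b) g) :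
    BddLipOn S (T ^ (a + b + 1)) fun x => f x - g x := by
  simpa only [sub_eq_add_neg] using hf.add hT hg.neg

theorem mul (hT : 2 ≤ T) (hf : BddLipOn S (T ^ a) f) (hg : BddLipOn S (T ^ b) g) :
    BddLipOn S (T ^ (a + b + 1)) fun x => f x * g x := by
  have h0 : 0 ≤ T ^ a := by positivity
  have h1 : 0 ≤ T ^ b := by positivity
  refine mono_const (B := 2 * (T ^ a * T ^ b)) ⟨fun x hx => ?_, fun x hx y hy => ?_⟩
    (two_mul_pow_le hT a b)
  · rw [abs_mul]
    have := mul_le_mul (hf.1 x hx) (hg.1 x hx) (abs_nonneg _) h0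
    nlinarith
  · have e : f x * g x - f y * g y = f x * (g x - g y) + (f x - f y) * g y := by ring
    rw [e]
    refine (abs_add_le _ _).trans ?_
    rw [abs_mul, abs_mul]
    have h2 := mul_le_mul (hf.1 x hx) (hg.2 x hx y hy) (abs_nonneg _) h0
    have h3 := mul_le_mul (hf.2 x hx y hy) (hg.1 y hy) (abs_nonneg _)
      (mul_nonneg h0 dist_nonneg)
    linarith

theorem tanh (hT : 2 ≤ T) (hf : BddLipOn S (T ^ a) f) :
    BddLipOn S (T ^ a) fun x => Real.tanh (f x) :=
  ⟨fun x _ => (Real.abs_tanh_lt_one _).le.trans (one_le_pow₀ (by linarith)), fun x hx y hy =>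
    (Real.abs_tanh_sub_tanh_le _ _).trans (hf.2 x hx y hy)⟩

end BddLipOn

variable {d : ℕ} {T : ℝ} {x : Fin (d + 1) → ℝ}

/-- The part of the unit ball where the lift has height at least `1 / T`. -/
def highPart (d : ℕ) (T : ℝ) : Set (EuclideanSpace ℝ (Fin d)) :=
  {w | ‖w‖ ≤ 1 ∧ 1 / T ≤ liftHeight w}

theorem headDot_sub (w v : EuclideanSpace ℝ (Fin d)) (x : Fin (d + 1) → ℝ) :
    headDot w x - headDot v x = headDot (w - v) x := by
  simp [headDot, ← Finset.sum_sub_distrib, sub_mul]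

theorem abs_headDot_le (hd : (d : ℝ) ≤ T) (hx : ∀ i, |x i| ≤ T) (w : EuclideanSpace ℝ (Fin d)) :
    |headDot w x| ≤ T ^ 2 * ‖w‖ := by
  have hT : 0 ≤ T := d.cast_nonneg.trans hd
  calc |headDot w x| ≤ ∑ i, |w i * x i.castSucc| := Finset.abs_sum_le_sum_abs _ _
    _ ≤ ∑ _i : Fin d, ‖w‖ * T := Finset.sum_le_sum fun i _ => by
        rw [abs_mul]
        have h1 : |w i| ≤ ‖w‖ := by simpa using PiLp.norm_apply_le w i
        exact mul_le_mul h1 (hx _) (abs_nonneg _) (norm_nonneg _)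
    _ = d * (‖w‖ * T) := by simp
    _ ≤ T * (‖w‖ * T) := by gcongr
    _ = _ := by ring

theorem bddLipOn_headDot (hd : (d : ℝ) ≤ T) (hx : ∀ i, |x i| ≤ T) :
    BddLipOn {w : EuclideanSpace ℝ (Fin d) | ‖w‖ ≤ 1} (T ^ 2) fun w => headDot w x :=
  ⟨fun w hw => (abs_headDot_le hd hx w).trans (mul_le_of_le_one_right (sq_nonneg T) hw),
    fun w _ v _ => by rw [headDot_sub, dist_eq_norm]; exact abs_headDot_le hd hx _⟩

theorem bddLipOn_norm_sq (hT : 2 ≤ T) :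
    BddLipOn {w : EuclideanSpace ℝ (Fin d) | ‖w‖ ≤ 1} (T ^ 1) fun w => ‖w‖ ^ 2 := by
  refine BddLipOn.mono_const (B := 2) ⟨fun w hw => ?_, fun w hw v hv => ?_⟩ (by simpa using hT)
  · rw [abs_of_nonneg (sq_nonneg _)]
    nlinarith [norm_nonneg w, show ‖w‖ ≤ 1 from hw]
  · have e : ‖w‖ ^ 2 - ‖v‖ ^ 2 = (‖w‖ + ‖v‖) * (‖w‖ - ‖v‖) := by ring
    rw [e, abs_mul, abs_of_nonneg (by positivity), dist_eq_norm]
    exact mul_le_mul (by linarith [show ‖w‖ ≤ 1 from hw, show ‖v‖ ≤ 1 from hv])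
      (abs_norm_sub_norm_le _ _) (abs_nonneg _) (by norm_num)

theorem liftHeight_le_one (w : EuclideanSpace ℝ (Fin d)) : liftHeight w ≤ 1 :=
  Real.sqrt_le_one.2 (by linarith [sq_nonneg ‖w‖])

/-- The square root is Lipschitz away from zero: the difference of heights times their sum is a
difference of squared norms, and the sum is at least `2/T`. -/
theorem bddLipOn_liftHeight (hT : 2 ≤ T) :
    BddLipOn (highPart d T) (T ^ 1) fun w => liftHeight w := by
  have hT0 : 0 < T := by linarith
  refine ⟨fun w _ => ?_, fun w hw v hv => ?_⟩
  · rw [abs_of_nonneg (show 0 ≤ liftHeight w from Real.sqrt_nonneg _), pow_one]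
    linarith [liftHeight_le_one w]
  · have hw0 : 0 < liftHeight w := lt_of_lt_of_le (by positivity) hw.2
    have hv0 : 0 < liftHeight v := lt_of_lt_of_le (by positivity) hv.2
    have h1 := norm_sq_eq_one_sub_liftHeight_sq hw0
    have h2 := norm_sq_eq_one_sub_liftHeight_sq hv0
    have h3 : |liftHeight w - liftHeight v| * (liftHeight w + liftHeight v) ≤ 2 * dist w v := by
      rw [← abs_of_pos (add_pos hw0 hv0), ← abs_mul]
      have e : (liftHeight w - liftHeight v) * (liftHeight w + liftHeight v) =
          -((‖w‖ + ‖v‖) * (‖w‖ - ‖v‖)) := by nlinarith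
      rw [e, abs_neg, abs_mul, abs_of_nonneg (by positivity), dist_eq_norm]
      exact mul_le_mul (by linarith [hw.1, hv.1]) (abs_norm_sub_norm_le _ _) (abs_nonneg _)
        (by norm_num)
    have h4 : 2 / T ≤ liftHeight w + liftHeight v := by
      have := hw.2; have := hv.2
      have e : 2 / T = 1 / T + 1 / T := by ring
      linarith
    have h5 : |liftHeight w - liftHeight v| * (2 / T) ≤ 2 * dist w v :=
      (mul_le_mul_of_nonneg_left h4 (abs_nonneg _)).trans h3
    rw [pow_one]
    have h6 := mul_le_mul_of_nonneg_left h5 hT0.le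
    have e : T * (|liftHeight w - liftHeight v| * (2 / T)) =
        2 * |liftHeight w - liftHeight v| := by field_simp
    linarith

theorem bddLipOn_inv_liftHeight (hT : 2 ≤ T) :
    BddLipOn (highPart d T) (T ^ 3) fun w => (liftHeight w)⁻¹ := by
  have hT0 : 0 < T := by linarith
  have hinv : ∀ w ∈ highPart d T, 0 < (liftHeight w)⁻¹ ∧ (liftHeight w)⁻¹ ≤ T := fun w hw => by
    have hw0 : 0 < liftHeight w := lt_of_lt_of_le (by positivity) hw.2
    refine ⟨inv_pos.2 hw0, inv_le_of_inv_le₀ hT0 ?_⟩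
    rw [← one_div]; exact hw.2
  refine ⟨fun w hw => ?_, fun w hw v hv => ?_⟩
  · rw [abs_of_pos (hinv w hw).1]
    refine (hinv w hw).2.trans ?_
    nlinarith [mul_pos hT0 hT0]
  · have hw0 : 0 < liftHeight w := lt_of_lt_of_le (by positivity) hw.2
    have hv0 : 0 < liftHeight v := lt_of_lt_of_le (by positivity) hv.2
    have e : (liftHeight w)⁻¹ - (liftHeight v)⁻¹ =
        (liftHeight w)⁻¹ * (liftHeight v)⁻¹ * (liftHeight v - liftHeight w) := by
      field_simp
    have h := (bddLipOn_liftHeight hT).2 v hv w hw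
    rw [e, abs_mul, abs_mul, abs_of_pos (hinv w hw).1, abs_of_pos (hinv v hv).1]
    calc _ ≤ T * T * (T ^ 1 * dist v w) :=
          mul_le_mul (mul_le_mul (hinv w hw).2 (hinv v hv).2 (hinv v hv).1.le hT0.le) h
            (abs_nonneg _) (by positivity)
      _ = _ := by rw [dist_comm]; ring

theorem bddLipOn_headDot_highPart (hd : (d : ℝ) ≤ T) (hx : ∀ i, |x i| ≤ T) :
    BddLipOn (highPart d T) (T ^ 2) fun w => headDot w x :=
  (bddLipOn_headDot hd hx).comp (φ := fun w => w) (fun _ hw => hw.1) (fun _ _ => le_rfl)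
    (sq_nonneg T)

theorem bddLipOn_last {α : Type*} [PseudoMetricSpace α] {S : Set α} (hx : ∀ i, |x i| ≤ T) :
    BddLipOn S (T ^ 1) fun _ => x (Fin.last d) :=
  BddLipOn.const (by simpa using hx (Fin.last d))

theorem bddLipOn_liftDot (hT : 2 ≤ T) (hd : (d : ℝ) ≤ T) (hx : ∀ i, |x i| ≤ T) :
    BddLipOn (highPart d T) (T ^ 6) fun w => liftDot w x :=
  (bddLipOn_headDot_highPart hd hx).add hT ((bddLipOn_liftHeight hT).mul hT (bddLipOn_last hx))

theorem bddLipOn_tanh_liftDot (hT : 2 ≤ T) (hd : (d : ℝ) ≤ T) (hx : ∀ i, |x i| ≤ T) {μ : ℝ}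
    (hμ : |μ⁻¹| ≤ T) :
    BddLipOn (highPart d T) (T ^ 8) fun w => Real.tanh (liftDot w x / μ) := by
  simp only [div_eq_mul_inv]
  have hc : BddLipOn (highPart d T) (T ^ 1) fun _ => μ⁻¹ := .const (by rwa [pow_one])
  exact ((bddLipOn_liftDot hT hd hx).mul hT hc).tanh hT

theorem bddLipOn_sech_sq (hT : 2 ≤ T) (hd : (d : ℝ) ≤ T) (hx : ∀ i, |x i| ≤ T) {μ : ℝ}
    (hμ : |μ⁻¹| ≤ T) :
    BddLipOn (highPart d T) (T ^ 20) fun w => (1 - Real.tanh (liftDot w x / μ) ^ 2) / μ := by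
  have h := bddLipOn_tanh_liftDot hT hd hx hμ
  simp only [div_eq_mul_inv _ μ, sq] at h ⊢
  have hc : BddLipOn (highPart d T) (T ^ 1) fun _ => μ⁻¹ := .const (by rwa [pow_one])
  have h1 : BddLipOn (highPart d T) (T ^ 0) fun _ => (1 : ℝ) := .const (by simp)
  exact (h1.sub hT (h.mul hT h)).mul hT hc

theorem bddLipOn_radialGradTerm (hT : 2 ≤ T) (hd : (d : ℝ) ≤ T) (hx : ∀ i, |x i| ≤ T) {μ : ℝ}
    (hμ : |μ⁻¹| ≤ T) :
    BddLipOn (highPart d T) (T ^ 19) fun w => radialGradTerm μ w x := by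
  have hn : BddLipOn (highPart d T) (T ^ 1) fun w => ‖w‖ ^ 2 :=
    (bddLipOn_norm_sq hT).comp (φ := fun w => w) (fun _ hw => hw.1) (fun _ _ => le_rfl)
      (by positivity)
  simp only [radialGradTerm, div_eq_mul_inv (‖_‖ ^ 2)]
  exact (bddLipOn_tanh_liftDot hT hd hx hμ).mul hT ((bddLipOn_headDot_highPart hd hx).sub hT
    ((hn.mul hT (bddLipOn_inv_liftHeight hT)).mul hT (bddLipOn_last hx)))

theorem bddLipOn_radialHessTerm (hT : 2 ≤ T) (hd : (d : ℝ) ≤ T) (hx : ∀ i, |x i| ≤ T) {μ : ℝ}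
    (hμ : |μ⁻¹| ≤ T) :
    BddLipOn (highPart d T) (T ^ 71) fun w => radialHessTerm μ w x := by
  have hn : BddLipOn (highPart d T) (T ^ 1) fun w => ‖w‖ ^ 2 :=
    (bddLipOn_norm_sq hT).comp (φ := fun w => w) (fun _ hw => hw.1) (fun _ _ => le_rfl)
      (by positivity)
  have hi := bddLipOn_inv_liftHeight (d := d) hT
  have hA := (bddLipOn_liftDot hT hd hx).sub hT ((bddLipOn_last hx).mul hT hi)
  have h := ((bddLipOn_sech_sq hT hd hx hμ).mul hT (hA.mul hT hA)).sub hT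
    ((hn.mul hT ((hi.mul hT hi).mul hT hi)).mul hT
      ((bddLipOn_last hx).mul hT (bddLipOn_tanh_liftDot hT hd hx hμ)))
  refine h.congr fun w _ => ?_
  rw [radialHessTerm]
  ring

theorem bddLipOn_curvatureTerm (hT : 2 ≤ T) (hd : (d : ℝ) ≤ T) (hx : ∀ i, |x i| ≤ T) {μ : ℝ}
    (hμ : |μ⁻¹| ≤ T) :
    BddLipOn (highPart d T ×ˢ {v | ‖v‖ ≤ 1}) (T ^ 42)
      fun z : EuclideanSpace ℝ (Fin d) × EuclideanSpace ℝ (Fin d) => curvatureTerm μ z.1 z.2 x := by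
  have hT0 : 0 ≤ T := by linarith
  have hfst : ∀ z z' : EuclideanSpace ℝ (Fin d) × EuclideanSpace ℝ (Fin d),
      dist z.1 z'.1 ≤ dist z z' := fun z z' => le_max_left _ _
  have hsnd : ∀ z z' : EuclideanSpace ℝ (Fin d) × EuclideanSpace ℝ (Fin d),
      dist z.2 z'.2 ≤ dist z z' := fun z z' => le_max_right _ _
  have h1 := (bddLipOn_sech_sq hT hd hx hμ).comp (φ := Prod.fst)
    (S' := highPart d T ×ˢ {v : EuclideanSpace ℝ (Fin d) | ‖v‖ ≤ 1})
    (fun z hz => hz.1) hfst (by positivity)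
  have h2 := (bddLipOn_headDot hd hx).comp (φ := Prod.snd)
    (S' := highPart d T ×ˢ {v : EuclideanSpace ℝ (Fin d) | ‖v‖ ≤ 1})
    (fun z hz => hz.2) hsnd (by positivity)
  have h3 := (bddLipOn_inv_liftHeight hT).comp (φ := Prod.fst)
    (S' := highPart d T ×ˢ {v : EuclideanSpace ℝ (Fin d) | ‖v‖ ≤ 1})
    (fun z hz => hz.1) hfst (by positivity)
  have h4 : BddLipOn (highPart d T ×ˢ {v : EuclideanSpace ℝ (Fin d) | ‖v‖ ≤ 1}) (T ^ 1)
      fun z => inner ℝ z.1 z.2 := by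
    refine BddLipOn.mono_const (B := 2) ⟨fun z hz => ?_, fun z hz z' hz' => ?_⟩ (by simpa using hT)
    · refine (abs_real_inner_le_norm _ _).trans ?_
      have := mul_le_one₀ hz.1.1 (norm_nonneg _) hz.2
      linarith
    · have e : inner ℝ z.1 z.2 - inner ℝ z'.1 z'.2 =
          inner ℝ (z.1 - z'.1) z.2 + inner ℝ z'.1 (z.2 - z'.2) := by
        rw [inner_sub_left, inner_sub_right]; ring
      rw [e]
      have a1 := abs_real_inner_le_norm (z.1 - z'.1) z.2
      have a2 := abs_real_inner_le_norm z'.1 (z.2 - z'.2)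
      rw [← dist_eq_norm] at a1 a2
      have a3 : dist z.1 z'.1 * ‖z.2‖ ≤ dist z z' * 1 :=
        mul_le_mul (hfst z z') hz.2 (norm_nonneg _) dist_nonneg
      have a4 : ‖z'.1‖ * dist z.2 z'.2 ≤ 1 * dist z z' :=
        mul_le_mul hz'.1.1 (hsnd z z') dist_nonneg zero_le_one
      have := abs_add_le (inner ℝ (z.1 - z'.1) z.2) (inner ℝ z'.1 (z.2 - z'.2))
      linarith
  have hA := h2.sub hT ((h4.mul hT h3).mul hT (bddLipOn_last hx))
  have h := h1.mul hT (hA.mul hT hA)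
  refine h.congr fun z _ => ?_
  rw [curvatureTerm]
  ring

end Nets

/-! ### Uniform bounds -/

section Uniform

variable {d p : ℕ}

/-- A union bound over a net, combined with a Lipschitz bound. -/
theorem exists_exceptional_set {α : Type*} [PseudoMetricSpace α]
    (Q : Measure (Fin p → Fin (d + 1) → ℝ)) [IsFiniteMeasure Q] {S : Set α} {t : Finset α}
    {ε L δ : ℝ} (hL : 0 ≤ L) (ht : ∀ y ∈ t, y ∈ S) (hnet : ∀ x ∈ S, ∃ y ∈ t, dist x y ≤ ε)
    {F : α → (Fin (d + 1) → ℝ) → ℝ} {m : α → ℝ}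
    (htail : ∀ y ∈ S, Q.real {z | ∑ k, F y (z k) ≤ p * m y} ≤ δ) :
    ∃ B : Set (Fin p → Fin (d + 1) → ℝ), Q.real B ≤ t.card * δ ∧
      ∀ z ∉ B, (∀ k, BddLipOn S L fun x => F x (z k)) →
        ∀ x ∈ S, ∃ y ∈ S, dist x y ≤ ε ∧ p * (m y - L * ε) ≤ ∑ k, F x (z k) := by
  refine ⟨⋃ y ∈ t, {z | ∑ k, F y (z k) ≤ p * m y}, ?_, fun z hz hF x hx => ?_⟩
  · refine (measureReal_biUnion_finset_le t _).trans ?_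
    rw [← nsmul_eq_mul]
    exact Finset.sum_le_card_nsmul _ _ _ fun y hy => htail y (ht y hy)
  · obtain ⟨y, hy, hxy⟩ := hnet x hx
    refine ⟨y, ht y hy, hxy, ?_⟩
    have h1 : p * m y < ∑ k, F y (z k) := by
      by_contra! h
      exact hz (Set.mem_biUnion hy h)
    have h2 : ∑ k, F y (z k) - ∑ k, F x (z k) ≤ p * (L * ε) := by
      rw [← Finset.sum_sub_distrib]
      calc ∑ k, (F y (z k) - F x (z k)) ≤ ∑ _k : Fin p, L * ε := Finset.sum_le_sum fun k _ =>
            (le_abs_self _).trans (((hF k).2 y (ht y hy) x hx).trans (by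
              rw [dist_comm]; exact mul_le_mul_of_nonneg_left hxy hL))
        _ = p * (L * ε) := by simp
    linarith

theorem BddLipOn.mono_set {α : Type*} [PseudoMetricSpace α] {S S' : Set α} {B : ℝ} {f : α → ℝ}
    (h : BddLipOn S B f) (hS : S' ⊆ S) : BddLipOn S' B f :=
  ⟨fun x hx => h.1 x (hS hx), fun x hx y hy => h.2 x (hS hx) y (hS hy)⟩

theorem two_mul_pow_add_one_pow_le (hp : 2 ≤ p) :
    (((2 * p ^ 73 + 1) ^ d : ℕ) : ℝ) ≤ (p : ℝ) ^ (75 * d) := by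
  rw [pow_mul]
  have h : 2 * p ^ 73 + 1 ≤ p ^ 75 := by
    have h1 : 1 ≤ p ^ 73 := Nat.one_le_pow _ _ (by omega)
    have h2 : 4 ≤ p ^ 2 := by nlinarith
    calc 2 * p ^ 73 + 1 ≤ p ^ 73 * 4 := by omega
      _ ≤ p ^ 73 * p ^ 2 := Nat.mul_le_mul_left _ h2
      _ = p ^ 75 := by ring
  exact_mod_cast Nat.pow_le_pow_left h d

/-- The mesh beats the largest Lipschitz constant in use, `p^71` for the radial Hessian, leaving an
error of at most `1/p`. -/
theorem exists_fine_net (hp : 2 ≤ p) (hdp : d ≤ p) (K : Set (EuclideanSpace ℝ (Fin d)))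
    (hK : ∀ x ∈ K, ‖x‖ ≤ 1) :
    ∃ t : Finset (EuclideanSpace ℝ (Fin d)), (∀ y ∈ t, y ∈ K) ∧
      (t.card : ℝ) ≤ (p : ℝ) ^ (75 * d) ∧ ∀ x ∈ K, ∃ y ∈ t, dist x y ≤ 1 / (p : ℝ) ^ 72 := by
  obtain ⟨t, h1, h2, h3⟩ := exists_finset_net K hK (N := p ^ 73) (by positivity)
  refine ⟨t, h1, (Nat.cast_le.2 h2).trans (two_mul_pow_add_one_pow_le hp), fun x hx => ?_⟩
  obtain ⟨y, hy, hxy⟩ := h3 x hx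
  refine ⟨y, hy, hxy.trans ?_⟩
  have hp0 : (0 : ℝ) < p := by positivity
  have hd : (d : ℝ) ≤ p := by exact_mod_cast hdp
  rw [Nat.cast_pow, div_le_div_iff₀ (by positivity) (by positivity), pow_succ (p : ℝ) 72, one_mul,
    mul_comm]
  gcongr

theorem pow_mul_inv_pow_le (hp : 2 ≤ p) {m : ℕ} (hm : m ≤ 71) :
    (p : ℝ) ^ m * (1 / (p : ℝ) ^ 72) ≤ 1 / p := by
  have hp0 : (0 : ℝ) < p := by positivity
  have hp1 : (1 : ℝ) ≤ p := by exact_mod_cast (by omega : 1 ≤ p)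
  rw [mul_one_div, div_le_div_iff₀ (by positivity) hp0, one_mul, ← pow_succ]
  exact pow_le_pow_right₀ hp1 (by omega)

/-- The deterministic properties of the data that control the landscape of the objective. -/
structure GoodColumns (θ μ : ℝ) (z : Fin p → Fin (d + 1) → ℝ) : Prop where
  curvature : ∀ w v : EuclideanSpace ℝ (Fin d), ‖w‖ ≤ μ / 5 → ‖v‖ = 1 →
    p * (θ / (10 * μ)) ≤ ∑ k, curvatureTerm μ w v (z k)
  radialGrad : ∀ w : EuclideanSpace ℝ (Fin d), μ / 6 ≤ ‖w‖ → ‖w‖ ≤ 1 / 40 →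
    p * (θ / 80 * ‖w‖) ≤ ∑ k, radialGradTerm μ w (z k)
  radialHess : ∀ w : EuclideanSpace ℝ (Fin d), 1 / 2000 ≤ ‖w‖ ^ 2 →
    1 / (4 * (d + 1)) ≤ liftHeight w ^ 2 → p * (θ / 128000) ≤ ∑ k, -radialHessTerm μ w (z k)
  sum_abs_last : ∑ k, |z k (Fin.last d)| ≤ 2 * p
  gradAtZero : ∀ i : Fin d, |∑ k, Real.tanh (z k (Fin.last d) / μ) * z k i.castSucc| ≤
    Real.sqrt (20 * p * Real.log p)

-- The exceptional set collects the net failures of the three uniform bounds, the tails of the last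
-- row and of the gradient at the origin, and the event that some entry reaches `p`; off the latter
-- the Lipschitz bounds hold with `T = p`. Curvature needs a net for the pair `(w, v)`, hence the
-- exponent `150 * d`.
set_option maxHeartbeats 1000000 in
theorem exists_exceptional_set_goodColumns {θ : unitInterval} (hθ0 : 0 < (θ : ℝ))
    (hθ : (θ : ℝ) ≤ 1 / 2) {μ : ℝ} (hμ : 0 < μ) (hμd : μ * (d + 1) ≤ 1 / 32000)
    (hp : 256000 * (d + 1) / ((θ : ℝ) * μ) ≤ p) :
    ∃ B : Set (Fin p → Fin (d + 1) → ℝ),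
      (columnsLaw θ d p).real B ≤
        (p : ℝ) ^ (150 * d) * Real.exp (-(p * ((θ : ℝ) / 600))) +
        (p : ℝ) ^ (75 * d) * Real.exp (-(p * ((θ : ℝ) ^ 2 / 691200))) +
        (p : ℝ) ^ (75 * d) * Real.exp (-(p * (((θ : ℝ) / 64000) ^ 2 /
          (4 * (384 * (12 * (d + 1) / μ) ^ 2))))) +
        Real.exp (-(p * (1 / 216))) + 2 * d / (p : ℝ) ^ 10 +
        p * (d + 1) * (2 * Real.exp (-(p : ℝ) ^ 2 / 2)) ∧
      ∀ z ∉ B, GoodColumns θ μ z := by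
  have hd0 : (0 : ℝ) ≤ d := d.cast_nonneg
  have hμ1 : μ ≤ 1 / 32000 := by nlinarith
  have hθμ : 0 < (θ : ℝ) * μ := by positivity
  have hθμ1 : (θ : ℝ) * μ ≤ 1 / 64000 := by nlinarith
  rw [div_le_iff₀ hθμ] at hp
  have hp1 : 256000 * ((d : ℝ) + 1) * 64000 ≤ p := by
    have hp0 : (0 : ℝ) ≤ p := p.cast_nonneg
    nlinarith [mul_le_mul_of_nonneg_left hθμ1 hp0]
  have hp2 : 2 ≤ p := by
    have : (2 : ℝ) ≤ p := by nlinarith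
    exact_mod_cast this
  have hp0 : (0 : ℝ) < p := by positivity
  have hT : (2 : ℝ) ≤ p := by exact_mod_cast hp2
  have hdp' : (d : ℝ) ≤ p := by nlinarith
  have hdp : d ≤ p := by exact_mod_cast hdp'
  -- This makes the net error at most half of each margin in the pointwise tail bounds, which
  -- explains the halved constants in `GoodColumns`.
  have hip : 1 / (p : ℝ) ≤ θ * μ / 256000 := by
    rw [div_le_div_iff₀ hp0 (by norm_num)]; nlinarith
  have hμp : |μ⁻¹| ≤ p := by
    rw [abs_of_pos (inv_pos.2 hμ), inv_eq_one_div, div_le_iff₀ hμ]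
    nlinarith [mul_pos hp0 hμ]
  have hε1 : 1 / (p : ℝ) ^ 72 ≤ 1 / p := by
    simpa using pow_mul_inv_pow_le hp2 (m := 0) (by norm_num)
  set K₁ : Set (EuclideanSpace ℝ (Fin d)) := {w | ‖w‖ ≤ μ / 5}
  set K₂ : Set (EuclideanSpace ℝ (Fin d)) := {v | ‖v‖ = 1}
  set K₃ : Set (EuclideanSpace ℝ (Fin d)) := {w | μ / 6 ≤ ‖w‖ ∧ ‖w‖ ≤ 1 / 40}
  set K₄ : Set (EuclideanSpace ℝ (Fin d)) :=
    {w | 1 / 2000 ≤ ‖w‖ ^ 2 ∧ 1 / (4 * (d + 1)) ≤ liftHeight w ^ 2}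
  have hhigh : ∀ w : EuclideanSpace ℝ (Fin d), ‖w‖ ≤ 1 / 2 → w ∈ highPart d p := fun w hw => by
    refine ⟨by linarith, ?_⟩
    have h1 : 1 / 2 ≤ liftHeight w := by
      refine Real.le_sqrt_of_sq_le ?_
      nlinarith [norm_nonneg w]
    refine le_trans ?_ h1
    gcongr
  have hK₁ : ∀ w ∈ K₁, ‖w‖ ≤ 1 / 2 := fun w hw => by
    have : ‖w‖ ≤ μ / 5 := hw
    linarith
  have hK₄ : ∀ w ∈ K₄, 0 < liftHeight w := fun w hw => by
    have h1 : 0 < liftHeight w ^ 2 := lt_of_lt_of_le (by positivity) hw.2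
    exact lt_of_le_of_ne (Real.sqrt_nonneg _) fun h => by
      rw [← h] at h1; simp at h1
  have hK₄' : K₄ ⊆ highPart d p := fun w hw => by
    have h0 := hK₄ w hw
    have h1 := norm_sq_eq_one_sub_liftHeight_sq h0
    refine ⟨by nlinarith [norm_nonneg w], ?_⟩
    refine le_of_sq_le_sq ?_ h0.le
    refine le_trans ?_ hw.2
    rw [div_pow, one_pow]
    refine one_div_le_one_div_of_le (by positivity) ?_
    nlinarith
  obtain ⟨t₁, ht₁, hc₁, hn₁⟩ := exists_fine_net hp2 hdp K₁ fun w hw => by linarith [hK₁ w hw]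
  obtain ⟨t₂, ht₂, hc₂, hn₂⟩ := exists_fine_net hp2 hdp K₂ fun w hw => le_of_eq hw
  obtain ⟨t₃, ht₃, hc₃, hn₃⟩ := exists_fine_net hp2 hdp K₃ fun w hw => by linarith [hw.2]
  obtain ⟨t₄, ht₄, hc₄, hn₄⟩ := exists_fine_net hp2 hdp K₄ fun w hw => (hK₄' hw).1
  obtain ⟨B₁, hB₁, hB₁'⟩ := exists_exceptional_set (columnsLaw θ d p) (S := K₁ ×ˢ K₂)
    (t := t₁ ×ˢ t₂) (ε := 1 / (p : ℝ) ^ 72) (L := (p : ℝ) ^ 42) (by positivity)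
    (fun y hy => ⟨ht₁ _ (Finset.mem_product.1 hy).1, ht₂ _ (Finset.mem_product.1 hy).2⟩)
    (fun x hx => by
      obtain ⟨y₁, h1, h2⟩ := hn₁ x.1 hx.1
      obtain ⟨y₂, h3, h4⟩ := hn₂ x.2 hx.2
      exact ⟨(y₁, y₂), Finset.mk_mem_product h1 h3, max_le h2 h4⟩)
    (F := fun x => curvatureTerm μ x.1 x.2) (m := fun _ => θ / (5 * μ))
    (fun y hy => curvatureTerm_tail hθ0 hθ hμ hy.2 hy.1 (hK₁ _ hy.1))
  obtain ⟨B₃, hB₃, hB₃'⟩ := exists_exceptional_set (columnsLaw θ d p) (L := (p : ℝ) ^ 19)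
    (by positivity) ht₃ hn₃
    (F := fun x => radialGradTerm μ x) (m := fun w => θ / 40 * ‖w‖)
    (fun y hy => radialGradTerm_tail hθ0 hθ hμ hy.1 hy.2)
  obtain ⟨B₄, hB₄, hB₄'⟩ := exists_exceptional_set (columnsLaw θ d p) (L := (p : ℝ) ^ 71)
    (δ := Real.exp (-(p * (((θ : ℝ) / 64000) ^ 2 / (4 * (384 * (12 * (d + 1) / μ) ^ 2))))))
    (by positivity) ht₄ hn₄
    (F := fun w x => -radialHessTerm μ w x) (m := fun _ => (θ : ℝ) / 64000)
    (fun y hy => by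
      have h0 := hK₄ y hy
      have h8 : 8 * μ ≤ liftHeight y := by
        refine le_of_sq_le_sq (le_trans ?_ hy.2) h0.le
        rw [le_div_iff₀ (by positivity)]
        nlinarith [mul_le_mul hμd hμ1 hμ.le (by norm_num)]
      refine (radialHessTerm_tail hθ0 hθ hμ (by nlinarith) h8 hy.1).trans ?_
      -- The squared height is at least `1 / (4 (d + 1))` on this shell; this is where the factor
      -- `n²` in the weakest exponent arises.
      have h2 : 3 / (μ * liftHeight y ^ 2) ≤ 12 * (d + 1) / μ := by
        rw [div_le_div_iff₀ (by positivity) hμ]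
        have := hy.2
        rw [div_le_iff₀ (by positivity)] at this
        nlinarith
      gcongr)
  set B₅ : Set (Fin p → Fin (d + 1) → ℝ) := {z | 2 * (p : ℝ) ≤ ∑ k, |z k (Fin.last d)|}
  set B₆ : Set (Fin p → Fin (d + 1) → ℝ) := ⋃ i ∈ (Finset.univ : Finset (Fin d)),
    {z | Real.sqrt (20 * p * Real.log p) ≤
      |∑ k, Real.tanh (z k (Fin.last d) / μ) * z k i.castSucc|}
  set B₇ : Set (Fin p → Fin (d + 1) → ℝ) :=
    ⋃ ki ∈ (Finset.univ : Finset (Fin p × Fin (d + 1))), {z | (p : ℝ) ≤ |z ki.1 ki.2|}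
  have hB₅ : (columnsLaw θ d p).real B₅ ≤ Real.exp (-(p * (1 / 216))) := sum_abs_last_tail θ
  have hB₆ : (columnsLaw θ d p).real B₆ ≤ 2 * d / (p : ℝ) ^ 10 := by
    refine (measureReal_biUnion_finset_le _ _).trans ?_
    have hlog : 0 ≤ Real.log p := Real.log_nonneg (by linarith)
    -- The threshold is tuned so that the sub-Gaussian tail is exactly `2 p⁻¹⁰`.
    have e : 2 * Real.exp (-(Real.sqrt (20 * p * Real.log p)) ^ 2 / (2 * p)) =
        2 / (p : ℝ) ^ 10 := by
      rw [Real.sq_sqrt (by positivity)]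
      have : -(20 * p * Real.log p) / (2 * p) = -((10 : ℕ) * Real.log p) := by
        push_cast; field_simp; ring
      rw [this, Real.exp_neg, Real.exp_nat_mul, Real.exp_log hp0, div_eq_mul_inv]
    calc _ ≤ ∑ _i : Fin d, 2 / (p : ℝ) ^ 10 := Finset.sum_le_sum fun i _ => by
          rw [← e]; exact abs_sum_tanh_mul_tail θ μ i (Real.sqrt_nonneg _)
      _ = _ := by simp; ring
  have hB₇ : (columnsLaw θ d p).real B₇ ≤ p * (d + 1) * (2 * Real.exp (-(p : ℝ) ^ 2 / 2)) := by
    refine (measureReal_biUnion_finset_le _ _).trans ?_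
    calc _ ≤ ∑ _ki : Fin p × Fin (d + 1), 2 * Real.exp (-(p : ℝ) ^ 2 / 2) :=
          Finset.sum_le_sum fun ki _ => entry_tail θ ki.1 ki.2 hp0.le
      _ = _ := by simp
  refine ⟨B₁ ∪ B₃ ∪ B₄ ∪ B₅ ∪ B₆ ∪ B₇, ?_, fun z hz => ?_⟩
  · have h1 : (columnsLaw θ d p).real B₁ ≤ (p : ℝ) ^ (150 * d) * Real.exp (-(p * (θ / 600))) := by
      refine hB₁.trans (mul_le_mul_of_nonneg_right ?_ (Real.exp_nonneg _))
      rw [Finset.card_product, Nat.cast_mul, show 150 * d = 75 * d + 75 * d by ring, pow_add]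
      exact mul_le_mul hc₁ hc₂ (Nat.cast_nonneg _) (by positivity)
    have h3 := hB₃.trans (mul_le_mul_of_nonneg_right hc₃ (Real.exp_nonneg _))
    have h4 := hB₄.trans (mul_le_mul_of_nonneg_right hc₄ (Real.exp_nonneg _))
    have u1 := measureReal_union_le (μ := columnsLaw θ d p) (B₁ ∪ B₃ ∪ B₄ ∪ B₅ ∪ B₆) B₇
    have u2 := measureReal_union_le (μ := columnsLaw θ d p) (B₁ ∪ B₃ ∪ B₄ ∪ B₅) B₆
    have u3 := measureReal_union_le (μ := columnsLaw θ d p) (B₁ ∪ B₃ ∪ B₄) B₅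
    have u4 := measureReal_union_le (μ := columnsLaw θ d p) (B₁ ∪ B₃) B₄
    have u5 := measureReal_union_le (μ := columnsLaw θ d p) B₁ B₃
    linarith
  · simp only [Set.mem_union, not_or] at hz
    obtain ⟨⟨⟨⟨⟨z1, z3⟩, z4⟩, z5⟩, z6⟩, z7⟩ := hz
    have hx : ∀ k i, |z k i| ≤ p := fun k i => by
      by_contra! h
      exact z7 (Set.mem_biUnion (Finset.mem_coe.2 (Finset.mem_univ (k, i))) h.le)
    refine ⟨fun w v hw hv => ?_, fun w hw hw' => ?_, fun w hw hw' => ?_, ?_, fun i => ?_⟩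
    · obtain ⟨y, -, -, h⟩ := hB₁' z z1 (fun k =>
        (bddLipOn_curvatureTerm hT hdp' (hx k) hμp).mono_set (Set.prod_mono
          (fun w hw => hhigh w (hK₁ w hw)) fun v hv => le_of_eq hv)) (w, v) ⟨hw, hv⟩
      refine le_trans (mul_le_mul_of_nonneg_left ?_ hp0.le) h
      have h1 := pow_mul_inv_pow_le hp2 (m := 42) (by norm_num)
      have h2 : θ / (5 * μ) = θ / (10 * μ) + θ / (10 * μ) := by field_simp; norm_num
      have h3 : θ * μ / 256000 ≤ θ / (10 * μ) := by
        rw [div_le_div_iff₀ (by norm_num) (by positivity)]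
        nlinarith [mul_le_mul hμ1 hμ1 hμ.le (by norm_num)]
      linarith
    · obtain ⟨y, -, hy, h⟩ := hB₃' z z3 (fun k =>
        (bddLipOn_radialGradTerm hT hdp' (hx k) hμp).mono_set
          (fun w hw => hhigh w (by linarith [hw.2]))) w ⟨hw, hw'⟩
      refine le_trans (mul_le_mul_of_nonneg_left ?_ hp0.le) h
      have h1 := pow_mul_inv_pow_le hp2 (m := 19) (by norm_num)
      -- The margin here depends on the net point `y`, so its norm must also be compared with that
      -- of `w`.
      have h2 : ‖w‖ - ‖y‖ ≤ θ * μ / 256000 :=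
        (norm_sub_norm_le w y).trans (by rw [← dist_eq_norm]; linarith)
      have h3 : θ * μ / 256000 ≤ μ / 256000 := by
        have := mul_le_mul_of_nonneg_right (show (θ : ℝ) ≤ 1 by linarith) hμ.le
        linarith
      have h4 := mul_le_mul_of_nonneg_left hw hθ0.le
      have h5 := mul_le_mul_of_nonneg_left (h2.trans h3) hθ0.le
      nlinarith
    · obtain ⟨y, -, -, h⟩ := hB₄' z z4 (fun k =>
        (bddLipOn_radialHessTerm hT hdp' (hx k) hμp).neg.mono_set hK₄') w ⟨hw, hw'⟩
      refine le_trans (mul_le_mul_of_nonneg_left ?_ hp0.le) h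
      have h1 := pow_mul_inv_pow_le hp2 (m := 71) (by norm_num)
      have h3 : θ * μ ≤ θ := by nlinarith
      linarith
    · exact le_of_not_ge z5
    · by_contra! h
      exact z6 (Set.mem_biUnion (Finset.mem_coe.2 (Finset.mem_univ i)) h.le)

end Uniform

/-! ### Gradient and Hessian of the objective -/

section Calculus

open scoped Topology InnerProductSpace

variable {d p : ℕ}

/-- The vector of the first `d` coordinates of `x`. -/
noncomputable def headVec (x : Fin (d + 1) → ℝ) : EuclideanSpace ℝ (Fin d) :=
  WithLp.toLp 2 fun i => x i.castSucc

theorem headDot_eq_inner (w : EuclideanSpace ℝ (Fin d)) (x : Fin (d + 1) → ℝ) :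
    headDot w x = ⟪headVec x, w⟫_ℝ := by
  simp [headDot, headVec, PiLp.inner_apply]

/-- The gradient of `w ↦ liftDot w x`. -/
noncomputable def liftDir (x : Fin (d + 1) → ℝ) (w : EuclideanSpace ℝ (Fin d)) :
    EuclideanSpace ℝ (Fin d) :=
  headVec x - (x (Fin.last d) * (liftHeight w)⁻¹) • w

theorem liftHeight_pos {w : EuclideanSpace ℝ (Fin d)} (hw : ‖w‖ < 1) : 0 < liftHeight w :=
  Real.sqrt_pos.2 (by nlinarith [norm_nonneg w])

theorem hasFDerivAt_liftHeight {w : EuclideanSpace ℝ (Fin d)} (hw : ‖w‖ < 1) :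
    HasFDerivAt liftHeight (-(liftHeight w)⁻¹ • innerSL ℝ w) w := by
  have h0 := liftHeight_pos hw
  have h1 : HasFDerivAt (fun w : EuclideanSpace ℝ (Fin d) => 1 - ‖w‖ ^ 2) (-(2 • innerSL ℝ w)) w :=
    (hasStrictFDerivAt_norm_sq w).hasFDerivAt.const_sub 1
  have h2 := h1.sqrt (Real.sqrt_pos.1 h0).ne'
  refine h2.congr_fderiv ?_
  ext v
  simp only [liftHeight, _root_.smul_apply, _root_.neg_apply,
    smul_eq_mul, nsmul_eq_mul, Nat.cast_ofNat]
  field_simp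

theorem hasFDerivAt_inv_liftHeight {w : EuclideanSpace ℝ (Fin d)} (hw : ‖w‖ < 1) :
    HasFDerivAt (fun w => (liftHeight w)⁻¹) ((liftHeight w ^ 3)⁻¹ • innerSL ℝ w) w := by
  have h0 := liftHeight_pos hw
  refine ((hasDerivAt_inv h0.ne').comp_hasFDerivAt w (hasFDerivAt_liftHeight hw)).congr_fderiv ?_
  ext v
  simp only [_root_.smul_apply, smul_eq_mul]
  field_simp

theorem hasFDerivAt_liftDot {w : EuclideanSpace ℝ (Fin d)} (hw : ‖w‖ < 1)
    (x : Fin (d + 1) → ℝ) :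
    HasFDerivAt (fun w => liftDot w x) (innerSL ℝ (liftDir x w)) w := by
  have h1 : HasFDerivAt (fun w => headDot w x) (innerSL ℝ (headVec x)) w := by
    simp only [headDot_eq_inner]
    exact (innerSL ℝ (headVec x)).hasFDerivAt
  refine (h1.add ((hasFDerivAt_liftHeight hw).mul_const (x (Fin.last d)))).congr_fderiv ?_
  ext v
  simp only [_root_.add_apply, _root_.smul_apply, innerSL_apply_apply,
    liftDir, inner_sub_left, inner_smul_left, smul_eq_mul]
  simp
  ring

theorem hasFDerivAt_tanh_liftDot {w : EuclideanSpace ℝ (Fin d)} (hw : ‖w‖ < 1)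
    (x : Fin (d + 1) → ℝ) (μ : ℝ) :
    HasFDerivAt (fun w => Real.tanh (liftDot w x / μ))
      (((1 - Real.tanh (liftDot w x / μ) ^ 2) / μ) • innerSL ℝ (liftDir x w)) w := by
  refine ((Real.hasDerivAt_tanh (liftDot w x / μ)).comp_hasFDerivAt w
    ((hasFDerivAt_liftDot hw x).mul_const μ⁻¹)).congr_fderiv ?_
  ext v
  simp only [_root_.smul_apply, smul_eq_mul]
  ring

theorem hasDerivAt_logCosh {μ : ℝ} (hμ : μ ≠ 0) (u : ℝ) :
    HasDerivAt (logCosh μ) (Real.tanh (u / μ)) u := by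
  have h := ((Real.hasDerivAt_log_cosh (u / μ)).comp u ((hasDerivAt_id u).div_const μ)).const_mul μ
  refine h.congr_deriv ?_
  field_simp

theorem hasFDerivAt_liftDir {w : EuclideanSpace ℝ (Fin d)} (hw : ‖w‖ < 1)
    (x : Fin (d + 1) → ℝ) :
    HasFDerivAt (liftDir x) (-(x (Fin.last d)) • ((liftHeight w)⁻¹ •
      ContinuousLinearMap.id ℝ (EuclideanSpace ℝ (Fin d)) +
        (liftHeight w ^ 3)⁻¹ • (innerSL ℝ w).smulRight w)) w := by
  refine ((((hasFDerivAt_inv_liftHeight hw).const_mul (x (Fin.last d))).smul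
    (hasFDerivAt_id w)).const_sub (headVec x)).congr_fderiv ?_
  ext1 v
  simp [smul_smul]
  module

theorem chartObjective_eq (μ : ℝ) (Y : Matrix (Fin (d + 1)) (Fin p) ℝ)
    (w : EuclideanSpace ℝ (Fin d)) :
    chartObjective μ Y w = (1 / (p : ℝ)) * ∑ k, logCosh μ (liftDot w fun i => Y i k) := by
  simp [chartObjective, sphereObjective, liftToSphere, liftDot, headDot, liftHeight,
    Fin.sum_univ_castSucc]

/-- The gradient of the objective inside the unit ball. -/
noncomputable def chartGrad (μ : ℝ) (z : Fin p → Fin (d + 1) → ℝ) (w : EuclideanSpace ℝ (Fin d)) :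
    EuclideanSpace ℝ (Fin d) :=
  (1 / (p : ℝ)) • ∑ k, Real.tanh (liftDot w (z k) / μ) • liftDir (z k) w

/-- The Hessian of the objective inside the unit ball. -/
noncomputable def chartHess (μ : ℝ) (z : Fin p → Fin (d + 1) → ℝ) (w : EuclideanSpace ℝ (Fin d)) :
    EuclideanSpace ℝ (Fin d) →L[ℝ] EuclideanSpace ℝ (Fin d) :=
  (1 / (p : ℝ)) • ∑ k, (Real.tanh (liftDot w (z k) / μ) • (-(z k (Fin.last d)) •
      ((liftHeight w)⁻¹ • ContinuousLinearMap.id ℝ (EuclideanSpace ℝ (Fin d)) +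
        (liftHeight w ^ 3)⁻¹ • (innerSL ℝ w).smulRight w)) +
    (((1 - Real.tanh (liftDot w (z k) / μ) ^ 2) / μ) •
      innerSL ℝ (liftDir (z k) w)).smulRight (liftDir (z k) w))

theorem hasGradientAt_chartObjective {μ : ℝ} (hμ : μ ≠ 0) (Y : Matrix (Fin (d + 1)) (Fin p) ℝ)
    {w : EuclideanSpace ℝ (Fin d)} (hw : ‖w‖ < 1) :
    HasGradientAt (chartObjective μ Y) (chartGrad μ (fun k i => Y i k) w) w := by
  rw [hasGradientAt_iff_hasFDerivAt]
  have h : HasFDerivAt (fun w => (1 / (p : ℝ)) * ∑ k, logCosh μ (liftDot w fun i => Y i k))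
      ((1 / (p : ℝ)) • ∑ k, Real.tanh (liftDot w (fun i => Y i k) / μ) •
        innerSL ℝ (liftDir (fun i => Y i k) w)) w :=
    (HasFDerivAt.fun_sum fun k _ => (hasDerivAt_logCosh hμ _).comp_hasFDerivAt w
      (hasFDerivAt_liftDot hw fun i => Y i k)).const_mul _
  rw [funext (chartObjective_eq μ Y)]
  refine h.congr_fderiv ?_
  ext v
  simp [chartGrad]

theorem hasFDerivAt_chartGrad (μ : ℝ) (z : Fin p → Fin (d + 1) → ℝ)
    {w : EuclideanSpace ℝ (Fin d)} (hw : ‖w‖ < 1) :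
    HasFDerivAt (chartGrad μ z) (chartHess μ z w) w := by
  have h := (HasFDerivAt.fun_sum (u := Finset.univ) fun k _ =>
    (hasFDerivAt_tanh_liftDot hw (z k) μ).smul (hasFDerivAt_liftDir hw (z k))).const_smul
      (1 / (p : ℝ))
  exact h

theorem gradient_chartObjective {μ : ℝ} (hμ : μ ≠ 0) (Y : Matrix (Fin (d + 1)) (Fin p) ℝ)
    {w : EuclideanSpace ℝ (Fin d)} (hw : ‖w‖ < 1) :
    gradient (chartObjective μ Y) w = chartGrad μ (fun k i => Y i k) w :=
  (hasGradientAt_chartObjective hμ Y hw).gradient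

theorem hessian_chartObjective {μ : ℝ} (hμ : μ ≠ 0) (Y : Matrix (Fin (d + 1)) (Fin p) ℝ)
    {w : EuclideanSpace ℝ (Fin d)} (hw : ‖w‖ < 1) :
    hessian (chartObjective μ Y) w = chartHess μ (fun k i => Y i k) w := by
  have h : gradient (chartObjective μ Y) =ᶠ[𝓝 w] chartGrad μ (fun k i => Y i k) := by
    filter_upwards [(isOpen_lt continuous_norm continuous_const).mem_nhds hw] with y hy
    exact gradient_chartObjective hμ Y hy
  rw [hessian, h.fderiv_eq]
  exact (hasFDerivAt_chartGrad μ _ hw).fderiv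

theorem inner_chartGrad_self (μ : ℝ) (z : Fin p → Fin (d + 1) → ℝ)
    (w : EuclideanSpace ℝ (Fin d)) :
    ⟪w, chartGrad μ z w⟫_ℝ = 1 / p * ∑ k, radialGradTerm μ w (z k) := by
  simp only [chartGrad, inner_smul_right, inner_sum, liftDir, inner_sub_right,
    real_inner_self_eq_norm_sq, radialGradTerm, headDot_eq_inner, real_inner_comm]
  congr 1
  refine Finset.sum_congr rfl fun k _ => ?_
  rw [real_inner_comm]
  ring

theorem inner_chartHess (μ : ℝ) (z : Fin p → Fin (d + 1) → ℝ)
    (w v v' : EuclideanSpace ℝ (Fin d)) :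
    ⟪v', chartHess μ z w v⟫_ℝ = 1 / p * ∑ k,
      ((1 - Real.tanh (liftDot w (z k) / μ) ^ 2) / μ *
          (⟪liftDir (z k) w, v⟫_ℝ * ⟪liftDir (z k) w, v'⟫_ℝ) -
        z k (Fin.last d) * Real.tanh (liftDot w (z k) / μ) *
          (⟪v, v'⟫_ℝ / liftHeight w + ⟪w, v⟫_ℝ * ⟪w, v'⟫_ℝ / liftHeight w ^ 3)) := by
  simp only [chartHess, _root_.smul_apply, _root_.sum_apply,
    _root_.add_apply, ContinuousLinearMap.smulRight_apply, innerSL_apply_apply,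
    ContinuousLinearMap.id_apply, inner_smul_right, inner_sum, inner_add_right, smul_eq_mul]
  congr 1
  refine Finset.sum_congr rfl fun k _ => ?_
  rw [real_inner_comm v v', real_inner_comm (liftDir (z k) w) v', real_inner_comm w v']
  ring

theorem inner_liftDir (x : Fin (d + 1) → ℝ) (w v : EuclideanSpace ℝ (Fin d)) :
    ⟪liftDir x w, v⟫_ℝ = headDot v x - ⟪w, v⟫_ℝ / liftHeight w * x (Fin.last d) := by
  rw [liftDir, inner_sub_left, real_inner_smul_left, headDot_eq_inner]
  ring

theorem inner_chartHess_self (μ : ℝ) (z : Fin p → Fin (d + 1) → ℝ)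
    (w v : EuclideanSpace ℝ (Fin d)) :
    ⟪v, chartHess μ z w v⟫_ℝ = 1 / p * ∑ k, (curvatureTerm μ w v (z k) -
        z k (Fin.last d) * Real.tanh (liftDot w (z k) / μ) *
          (‖v‖ ^ 2 / liftHeight w + ⟪w, v⟫_ℝ ^ 2 / liftHeight w ^ 3)) := by
  rw [inner_chartHess]
  simp only [curvatureTerm, inner_liftDir, real_inner_self_eq_norm_sq, sq]

/-- In the direction `w` itself, `‖w‖² + liftHeight w ^ 2 = 1` merges the two curvature terms of the
lift into one. -/
theorem inner_chartHess_radial (μ : ℝ) (z : Fin p → Fin (d + 1) → ℝ)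
    {w : EuclideanSpace ℝ (Fin d)} (hw : ‖w‖ < 1) :
    ⟪w, chartHess μ z w w⟫_ℝ = 1 / p * ∑ k, radialHessTerm μ w (z k) := by
  rw [inner_chartHess_self]
  congr 1
  refine Finset.sum_congr rfl fun k _ => ?_
  have h0 := liftHeight_pos hw
  have h1 := norm_sq_eq_one_sub_liftHeight_sq h0
  rw [curvatureTerm, radialHessTerm, real_inner_self_eq_norm_sq]
  have e1 : headDot w (z k) - ‖w‖ ^ 2 / liftHeight w * z k (Fin.last d) =
      liftDot w (z k) - z k (Fin.last d) / liftHeight w := by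
    rw [liftDot, h1]; field_simp; ring
  have e2 : ‖w‖ ^ 2 / liftHeight w + (‖w‖ ^ 2) ^ 2 / liftHeight w ^ 3 =
      ‖w‖ ^ 2 / liftHeight w ^ 3 := by
    rw [h1]; field_simp; ring
  rw [e1, e2]
  ring

/-- Self-adjointness is part of the Loewner order on operators. -/
theorem inner_chartHess_comm (μ : ℝ) (z : Fin p → Fin (d + 1) → ℝ)
    (w v v' : EuclideanSpace ℝ (Fin d)) :
    ⟪v', chartHess μ z w v⟫_ℝ = ⟪v, chartHess μ z w v'⟫_ℝ := by
  rw [inner_chartHess, inner_chartHess]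
  congr 1
  refine Finset.sum_congr rfl fun k _ => ?_
  rw [real_inner_comm v v']
  ring

end Calculus

/-! ### Uniqueness of the local minimizer in a three-region landscape -/

section Landscape

open scoped Topology InnerProductSpace

variable {E : Type*} [NormedAddCommGroup E] [InnerProductSpace ℝ E]
  {g : E → ℝ} {G : E → E} {H : E → E →L[ℝ] E}

theorem HasFDerivAt.hasDerivAt_inner_add_smul {w v : E} {t : ℝ}
    (h : HasFDerivAt G (H (w + t • v)) (w + t • v)) :
    HasDerivAt (fun s : ℝ => ⟪G (w + s • v), v⟫_ℝ) ⟪H (w + t • v) v, v⟫_ℝ t := by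
  have hl : HasDerivAt (fun s : ℝ => w + s • v) v t := by
    simpa using ((hasDerivAt_id t).smul_const v).const_add w
  simpa using (h.comp_hasDerivAt t hl).inner ℝ (hasDerivAt_const t v)

/-- A lower bound on the Hessian makes the gradient strongly monotone. -/
theorem Convex.mul_norm_sq_le_inner_sub {S : Set E} (hS : Convex ℝ S) {m : ℝ}
    (hH : ∀ x ∈ S, HasFDerivAt G (H x) x) (hm : ∀ x ∈ S, ∀ v, m * ‖v‖ ^ 2 ≤ ⟪v, H x v⟫_ℝ)
    {x y : E} (hx : x ∈ S) (hy : y ∈ S) :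
    m * ‖y - x‖ ^ 2 ≤ ⟪G y - G x, y - x⟫_ℝ := by
  have hmem : ∀ t ∈ Set.Icc (0 : ℝ) 1, x + t • (y - x) ∈ S := fun t ht =>
    hS.add_smul_sub_mem hx hy ht
  have hd : ∀ t ∈ Set.Icc (0 : ℝ) 1, HasDerivAt (fun s : ℝ => ⟪G (x + s • (y - x)), y - x⟫_ℝ)
      ⟪H (x + t • (y - x)) (y - x), y - x⟫_ℝ t := fun t ht =>
    (hH _ (hmem t ht)).hasDerivAt_inner_add_smul
  obtain ⟨t, ht, he⟩ := exists_hasDerivAt_eq_slope _ _ zero_lt_one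
    (fun t ht => (hd t ht).continuousAt.continuousWithinAt)
    (fun t ht => hd t (Set.Ioo_subset_Icc_self ht))
  have h1 := hm _ (hmem t (Set.Ioo_subset_Icc_self ht)) (y - x)
  rw [real_inner_comm, he] at h1
  simpa [inner_sub_left] using h1

variable [CompleteSpace E]

theorem HasGradientAt.hasDerivAt_add_smul {w v : E} {t : ℝ}
    (h : HasGradientAt g (G (w + t • v)) (w + t • v)) :
    HasDerivAt (fun s : ℝ => g (w + s • v)) ⟪G (w + t • v), v⟫_ℝ t := by
  have hl : HasDerivAt (fun s : ℝ => w + s • v) v t := by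
    simpa using ((hasDerivAt_id t).smul_const v).const_add w
  exact (h.hasFDerivAt.comp_hasDerivAt t hl).congr_deriv (by simp)

theorem IsLocalMin.gradient_eq_zero {w x : E} (h : IsLocalMin g w) (hg : HasGradientAt g x w) :
    x = 0 := by
  have h1 := h.hasFDerivAt_eq_zero hg.hasFDerivAt
  have h2 : (InnerProductSpace.toDual ℝ E x) x = 0 := by rw [h1]; simp
  simpa using h2

/-- At a local minimum the second derivative is nonnegative in every direction. -/
theorem IsLocalMin.inner_hessian_nonneg {w : E} (h : IsLocalMin g w)
    (hG : ∀ᶠ x in 𝓝 w, HasGradientAt g (G x) x) (hH : HasFDerivAt G (H w) w) (v : E) :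
    0 ≤ ⟪v, H w v⟫_ℝ := by
  by_contra! hneg
  have hcont : Filter.Tendsto (fun s : ℝ => w + s • v) (𝓝 0) (𝓝 w) := by
    have : Continuous fun s : ℝ => w + s • v := by fun_prop
    simpa using this.tendsto 0
  set f : ℝ → ℝ := fun s => g (w + s • v)
  have hf : deriv f =ᶠ[𝓝 0] fun s => ⟪G (w + s • v), v⟫_ℝ := by
    filter_upwards [hcont.eventually hG] with t ht
    exact ht.hasDerivAt_add_smul.deriv
  have hH0 : HasFDerivAt G (H (w + (0 : ℝ) • v)) (w + (0 : ℝ) • v) := by simpa using hH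
  have hff : deriv (deriv f) 0 = ⟪v, H w v⟫_ℝ := by
    rw [hf.deriv_eq, hH0.hasDerivAt_inner_add_smul.deriv, real_inner_comm]
    simp
  have hmin : IsLocalMin f 0 := by
    have h1 : ∀ᶠ y in 𝓝 w, g w ≤ g y := h
    filter_upwards [hcont.eventually h1] with t ht
    simpa [f] using ht
  have hd : HasDerivAt f ⟪G (w + (0 : ℝ) • v), v⟫_ℝ 0 :=
    (hcont.eventually hG).self_of_nhds.hasDerivAt_add_smul
  -- A negative second derivative would make the point a local maximum as well, so `f` would be
  -- locally constant, with zero second derivative.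
  have hmax : IsLocalMax f 0 :=
    isLocalMax_of_deriv_deriv_neg (by rw [hff]; exact hneg) hmin.deriv_eq_zero hd.continuousAt
  have hconst : f =ᶠ[𝓝 0] fun _ => f 0 := by
    filter_upwards [hmin, hmax] with t h1 h2
    exact le_antisymm h2 h1
  have h0 : deriv (deriv f) 0 = 0 := by
    rw [hconst.deriv.deriv_eq]
    simp
  linarith

/-- A function on the ball of radius `R` that is strongly convex on a small ball, has radially
increasing values on an intermediate shell, and has negative radial curvature on the outer shell
has exactly one local minimizer. -/
theorem exists_unique_isLocalMinOn_ball [FiniteDimensional ℝ E] {r ρ R m : ℝ} (hr : 0 < r)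
    (hrR : r < R) (hm : 0 < m)
    (hG : ∀ x, ‖x‖ < R → HasGradientAt g (G x) x) (hH : ∀ x, ‖x‖ < R → HasFDerivAt G (H x) x)
    (h1 : ∀ x, ‖x‖ ≤ r → ∀ v, m * ‖v‖ ^ 2 ≤ ⟪v, H x v⟫_ℝ)
    (h2 : ∀ x, r ≤ ‖x‖ → ‖x‖ ≤ ρ → 0 < ⟪x, G x⟫_ℝ)
    (h3 : ∀ x, ρ ≤ ‖x‖ → ‖x‖ < R → ⟪x, H x x⟫_ℝ < 0) (hrρ : r ≤ ρ) :
    ∃ w ∈ {x : E | ‖x‖ < R}, IsLocalMinOn g {x | ‖x‖ < R} w ∧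
      (∀ x ∈ {x : E | ‖x‖ < R}, IsLocalMinOn g {x | ‖x‖ < R} x → x = w) ∧
      m * ‖w‖ ≤ ‖G 0‖ := by
  have hopen : IsOpen {x : E | ‖x‖ < R} := isOpen_lt continuous_norm continuous_const
  have hcrit : ∀ x ∈ {x : E | ‖x‖ < R}, IsLocalMinOn g {x | ‖x‖ < R} x → G x = 0 ∧ ‖x‖ < r := by
    intro x hx hmin
    have hloc : IsLocalMin g x := hmin.isLocalMin (hopen.mem_nhds hx)
    have h0 := hloc.gradient_eq_zero (hG x hx)
    refine ⟨h0, ?_⟩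
    by_contra! hxr
    rcases le_total ‖x‖ ρ with hxρ | hxρ
    · have := h2 x hxr hxρ
      simp [h0] at this
    · have := hloc.inner_hessian_nonneg (H := H) (Filter.mem_of_superset (hopen.mem_nhds hx) hG)
        (hH x hx) x
      linarith [h3 x hxρ hx]
  have hmono := fun x y (hx : x ∈ Metric.closedBall (0 : E) r)
      (hy : y ∈ Metric.closedBall (0 : E) r) =>
    (convex_closedBall (0 : E) r).mul_norm_sq_le_inner_sub (G := G) (H := H) (m := m)
      (fun x hx => hH x (by rw [mem_closedBall_zero_iff] at hx; linarith))
      (fun x hx => h1 x (by rwa [mem_closedBall_zero_iff] at hx)) hx hy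
  obtain ⟨w, hw, hwmin⟩ := (isCompact_closedBall (0 : E) r).exists_isMinOn
    ⟨0, Metric.mem_closedBall_self hr.le⟩ (f := g) fun x hx => by
      rw [mem_closedBall_zero_iff] at hx
      exact (hG x (by linarith)).continuousAt.continuousWithinAt
  have hwr : ‖w‖ < r := by
    rw [mem_closedBall_zero_iff] at hw
    refine lt_of_le_of_ne hw fun he => ?_
    -- A boundary minimizer is impossible: the direction `-w` points into the ball, while the
    -- positive radial derivative makes `g` decrease along it.
    have hp := h2 w he.ge (he.le.trans hrρ)
    have hseg : segment ℝ w (w + -w) ⊆ Metric.closedBall (0 : E) r :=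
      (convex_closedBall (0 : E) r).segment_subset (by simp [he]) (by simp [hr.le])
    have hn := (hwmin.localize).hasFDerivWithinAt_nonneg
      (hG w (by linarith)).hasFDerivAt.hasFDerivWithinAt
      (mem_posTangentConeAt_of_segment_subset hseg)
    rw [InnerProductSpace.toDual_apply_apply, inner_neg_right, real_inner_comm] at hn
    linarith
  have hwR : w ∈ {x : E | ‖x‖ < R} := hwr.trans hrR
  have hwloc : IsLocalMinOn g {x | ‖x‖ < R} w :=
    (hwmin.isLocalMin (Metric.closedBall_mem_nhds_of_mem (by simpa using hwr))).on _
  have hw0 := (hcrit w hwR hwloc).1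
  refine ⟨w, hwR, hwloc, fun x hx hmin => ?_, ?_⟩
  · obtain ⟨hx0, hxr⟩ := hcrit x hx hmin
    have h := hmono w x hw (by simpa using hxr.le)
    rw [hx0, hw0] at h
    simp only [sub_self, inner_zero_left] at h
    have : ‖x - w‖ ^ 2 = 0 := le_antisymm (nonpos_of_mul_nonpos_right h hm) (sq_nonneg _)
    simpa [sub_eq_zero] using this
  · have h := hmono 0 w (Metric.mem_closedBall_self hr.le) hw
    rw [hw0, zero_sub, sub_zero, inner_neg_left] at h
    have h5 := neg_le_of_abs_le (abs_real_inner_le_norm (G 0) w)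
    rcases (norm_nonneg w).eq_or_lt with h0 | h0
    · rw [← h0, mul_zero]; exact norm_nonneg _
    · refine le_of_mul_le_mul_right ?_ h0
      nlinarith

end Landscape

/-! ### The landscape for good data -/

section GoodLandscape

open scoped InnerProductSpace

variable {d p : ℕ} {θ μ : ℝ} {z : Fin p → Fin (d + 1) → ℝ}

/-- The bending of the sphere contributes at most `2 |x_last|` per column, hence at most 4 on
average. This is absorbed by half of the curvature `θ/(10μ)` once `80μ ≤ θ`. -/
theorem GoodColumns.le_inner_chartHess (hz : GoodColumns θ μ z) (hp : 0 < p) (hθ : 0 < θ)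
    (hθ1 : θ ≤ 1) (hμ : 0 < μ) (hμθ : 80 * μ ≤ θ) {w : EuclideanSpace ℝ (Fin d)} (hw : ‖w‖ ≤ μ / 5)
    (v : EuclideanSpace ℝ (Fin d)) :
    θ / (20 * μ) * ‖v‖ ^ 2 ≤ ⟪v, chartHess μ z w v⟫_ℝ := by
  have hp0 : (0 : ℝ) < p := by exact_mod_cast hp
  have key : ∀ v : EuclideanSpace ℝ (Fin d), ‖v‖ = 1 →
      θ / (20 * μ) ≤ ⟪v, chartHess μ z w v⟫_ℝ := fun v hv => by
    have hw1 : ‖w‖ ≤ 1 / 10 := by linarith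
    have hw2 : ‖w‖ ^ 2 ≤ 1 / 100 := by nlinarith [norm_nonneg w]
    have hq : 9 / 10 ≤ liftHeight w := Real.le_sqrt_of_sq_le (by linarith)
    have hq0 : 0 < liftHeight w := by linarith
    set S := 1 / liftHeight w + ⟪w, v⟫_ℝ ^ 2 / liftHeight w ^ 3
    have hS0 : 0 ≤ S := by positivity
    have hS : S ≤ 2 := by
      have h1 : 1 / liftHeight w ≤ 10 / 9 := by
        rw [div_le_div_iff₀ hq0 (by norm_num)]; linarith
      have h2 : |⟪w, v⟫_ℝ| ≤ 1 / 10 := (abs_real_inner_le_norm w v).trans (by rw [hv]; linarith)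
      have h3 : ⟪w, v⟫_ℝ ^ 2 ≤ 1 / 100 := by rw [← sq_abs]; nlinarith [abs_nonneg ⟪w, v⟫_ℝ]
      have h4 : (9 / 10) ^ 3 ≤ liftHeight w ^ 3 := by gcongr
      have h5 : ⟪w, v⟫_ℝ ^ 2 / liftHeight w ^ 3 ≤ 1 / 2 := by
        rw [div_le_iff₀ (by positivity)]; norm_num at h4; linarith
      linarith
    have h2 : ∑ k, z k (Fin.last d) * Real.tanh (liftDot w (z k) / μ) * S ≤ 4 * p := by
      calc _ ≤ ∑ k, |z k (Fin.last d)| * 2 := Finset.sum_le_sum fun k _ => by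
            refine mul_le_mul ?_ hS hS0 (abs_nonneg _)
            refine (le_abs_self _).trans ?_
            rw [abs_mul]
            exact mul_le_of_le_one_right (abs_nonneg _) (Real.abs_tanh_lt_one _).le
        _ ≤ 4 * p := by
            rw [← Finset.sum_mul]; linarith [hz.sum_abs_last]
    have h1 := hz.curvature w v hw hv
    rw [inner_chartHess_self, Finset.sum_sub_distrib, hv, one_pow, one_div, inv_mul_eq_div,
      le_div_iff₀ hp0]
    have h3 : 4 ≤ θ / (20 * μ) := by
      rw [le_div_iff₀ (by positivity)]; linarith
    have h4 : θ / (10 * μ) = θ / (20 * μ) + θ / (20 * μ) := by field_simp; norm_num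
    rw [h4] at h1
    nlinarith
  rcases eq_or_ne v 0 with rfl | hv
  · simp
  · have hv0 : 0 < ‖v‖ := norm_pos_iff.2 hv
    have h := key (‖v‖⁻¹ • v) (by rw [norm_smul, norm_inv, norm_norm, inv_mul_cancel₀ hv0.ne'])
    rw [map_smul, real_inner_smul_left, real_inner_smul_right, ← mul_assoc, ← sq, inv_pow,
      inv_mul_eq_div, le_div_iff₀ (by positivity)] at h
    exact h

theorem GoodColumns.le_inner_chartGrad (hz : GoodColumns θ μ z) (hp : 0 < p)
    {w : EuclideanSpace ℝ (Fin d)} (hw : μ / 6 ≤ ‖w‖) (hw' : ‖w‖ ≤ 1 / 40) :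
    θ / 80 * ‖w‖ ≤ ⟪w, chartGrad μ z w⟫_ℝ := by
  have hp0 : (0 : ℝ) < p := by exact_mod_cast hp
  rw [inner_chartGrad_self, one_div, inv_mul_eq_div, le_div_iff₀ hp0, mul_comm]
  exact hz.radialGrad w hw hw'

theorem one_div_le_liftHeight_sq {w : EuclideanSpace ℝ (Fin d)}
    (hw : ‖w‖ ≤ Real.sqrt ((4 * ((d + 1 : ℕ) : ℝ) - 1) / (4 * ((d + 1 : ℕ) : ℝ)))) :
    1 / (4 * ((d : ℝ) + 1)) ≤ liftHeight w ^ 2 ∧ ‖w‖ < 1 := by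
  have hd : (0 : ℝ) ≤ d := d.cast_nonneg
  have h1 : ‖w‖ ^ 2 ≤ 1 - 1 / (4 * ((d : ℝ) + 1)) := by
    have h := pow_le_pow_left₀ (norm_nonneg w) hw 2
    push_cast at h
    rw [Real.sq_sqrt (div_nonneg (by linarith) (by linarith))] at h
    refine h.trans (le_of_eq ?_)
    field_simp
  have h2 : 0 < 1 / (4 * ((d : ℝ) + 1)) := by positivity
  have h3 : ‖w‖ < 1 := by nlinarith [norm_nonneg w]
  refine ⟨?_, h3⟩
  rw [liftHeight, Real.sq_sqrt (by linarith)]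
  linarith

theorem GoodColumns.inner_chartHess_le (hz : GoodColumns θ μ z) (hp : 0 < p)
    {w : EuclideanSpace ℝ (Fin d)} (hw : 1 / 2000 ≤ ‖w‖ ^ 2)
    (hw' : ‖w‖ ≤ Real.sqrt ((4 * ((d + 1 : ℕ) : ℝ) - 1) / (4 * ((d + 1 : ℕ) : ℝ)))) :
    ⟪w, chartHess μ z w w⟫_ℝ ≤ -(θ / 128000) := by
  have hp0 : (0 : ℝ) < p := by exact_mod_cast hp
  obtain ⟨h1, h2⟩ := one_div_le_liftHeight_sq hw'
  have h := hz.radialHess w hw h1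
  rw [Finset.sum_neg_distrib] at h
  rw [inner_chartHess_radial μ z h2, one_div, inv_mul_eq_div, div_le_iff₀ hp0]
  linarith

theorem GoodColumns.norm_chartGrad_zero_le (hz : GoodColumns θ μ z) (hp : 0 < p) :
    ‖chartGrad μ z 0‖ ≤ Real.sqrt (20 * d * Real.log p / p) := by
  have hp0 : (0 : ℝ) < p := by exact_mod_cast hp
  have hlog : 0 ≤ Real.log p := Real.log_natCast_nonneg p
  rw [EuclideanSpace.norm_eq]
  refine Real.sqrt_le_sqrt ?_
  have e : ∀ i, chartGrad μ z 0 i =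
      1 / p * ∑ k, Real.tanh (z k (Fin.last d) / μ) * z k i.castSucc := fun i => by
    simp [chartGrad, liftDir, headVec, liftDot, headDot, liftHeight]
  calc ∑ i, ‖chartGrad μ z 0 i‖ ^ 2 ≤ ∑ _i : Fin d, 20 * Real.log p / p :=
        Finset.sum_le_sum fun i _ => by
          rw [e, Real.norm_eq_abs, sq_abs, mul_pow, ← sq_abs (∑ k, _)]
          have h := pow_le_pow_left₀ (abs_nonneg _) (hz.gradAtZero i) 2
          rw [Real.sq_sqrt (by positivity)] at h
          calc _ ≤ (1 / (p : ℝ)) ^ 2 * (20 * p * Real.log p) := by gcongr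
            _ = _ := by field_simp
    _ = 20 * d * Real.log p / p := by simp; ring

theorem smul_id_le_hessian_chartObjective (hμ : μ ≠ 0) (Y : Matrix (Fin (d + 1)) (Fin p) ℝ)
    {w : EuclideanSpace ℝ (Fin d)} (hw : ‖w‖ < 1) {m : ℝ}
    (h : ∀ v, m * ‖v‖ ^ 2 ≤ ⟪v, chartHess μ (fun k i => Y i k) w v⟫_ℝ) :
    m • ContinuousLinearMap.id ℝ (EuclideanSpace ℝ (Fin d)) ≤
      hessian (chartObjective μ Y) w := by
  rw [hessian_chartObjective hμ Y hw, ContinuousLinearMap.le_def]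
  refine ⟨fun v v' => ?_, fun v => ?_⟩
  · simp only [ContinuousLinearMap.coe_coe, _root_.sub_apply, _root_.smul_apply,
      ContinuousLinearMap.id_apply, inner_sub_left, inner_sub_right, real_inner_smul_left,
      real_inner_smul_right]
    rw [real_inner_comm, inner_chartHess_comm]
  · rw [ContinuousLinearMap.reApplyInnerSelf_apply]
    simp only [_root_.sub_apply, _root_.smul_apply, ContinuousLinearMap.id_apply, inner_sub_left,
      real_inner_smul_left, RCLike.re_to_real, real_inner_self_eq_norm_sq]
    rw [real_inner_comm]
    linarith [h v]

theorem one_div_twenty_sqrt_five :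
    0 < 1 / (20 * Real.sqrt 5) ∧ (1 / (20 * Real.sqrt 5)) ^ 2 = 1 / 2000 ∧
      1 / (20 * Real.sqrt 5) ≤ 1 / 40 := by
  refine ⟨by positivity, ?_, ?_⟩
  · rw [div_pow, mul_pow, Real.sq_sqrt (by norm_num)]; norm_num
  · have : 2 ≤ Real.sqrt 5 := Real.le_sqrt_of_sq_le (by norm_num)
    exact one_div_le_one_div_of_le (by norm_num) (by linarith)

/-- The rational radii `μ/6` and `μ/5` bracket the boundary between the first two regions, so the
convexity and radial-gradient bounds overlap there. -/
theorem div_four_sqrt_two_mem (hμ : 0 < μ) :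
    μ / 6 ≤ μ / (4 * Real.sqrt 2) ∧ μ / (4 * Real.sqrt 2) ≤ μ / 5 := by
  have h1 : 5 / 4 ≤ Real.sqrt 2 := Real.le_sqrt_of_sq_le (by norm_num)
  have h2 : Real.sqrt 2 ≤ 3 / 2 := Real.sqrt_le_iff.2 ⟨by norm_num, by norm_num⟩
  constructor <;> exact div_le_div_of_nonneg_left hμ.le (by positivity) (by linarith)

/-- The four landscape properties hold for good data. -/
theorem GoodColumns.landscape {Y : Matrix (Fin (d + 1)) (Fin p) ℝ}
    (hz : GoodColumns θ μ fun k i => Y i k) (hp : 0 < p) (hθ : 0 < θ) (hθ1 : θ ≤ 1) (hμ : 0 < μ)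
    (hμθ : 80 * μ ≤ θ) (hlog : ((d + 1 : ℕ) : ℝ) * Real.log p / p ≤ (θ / 1600) ^ 2) :
    (∀ w : EuclideanSpace ℝ (Fin d), ‖w‖ ≤ μ / (4 * Real.sqrt 2) →
      (1 / 128000 * θ / μ) • ContinuousLinearMap.id ℝ (EuclideanSpace ℝ (Fin d)) ≤
        hessian (chartObjective μ Y) w) ∧
    (∀ w : EuclideanSpace ℝ (Fin d),
      μ / (4 * Real.sqrt 2) ≤ ‖w‖ → ‖w‖ ≤ 1 / (20 * Real.sqrt 5) →
      1 / 128000 * θ ≤ inner ℝ w (gradient (chartObjective μ Y) w) / ‖w‖) ∧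
    (∀ w : EuclideanSpace ℝ (Fin d), 1 / (20 * Real.sqrt 5) ≤ ‖w‖ →
      ‖w‖ ≤ Real.sqrt ((4 * ((d + 1 : ℕ) : ℝ) - 1) / (4 * ((d + 1 : ℕ) : ℝ))) →
      inner ℝ w (hessian (chartObjective μ Y) w w) / ‖w‖ ^ 2 ≤ -(1 / 128000 * θ)) ∧
    (∃ wstar ∈ chartDomain d,
      IsLocalMinOn (chartObjective μ Y) (chartDomain d) wstar ∧
      (∀ w ∈ chartDomain d, IsLocalMinOn (chartObjective μ Y) (chartDomain d) w → w = wstar) ∧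
      ‖wstar‖ ≤ min (100 * μ / θ * Real.sqrt (((d + 1 : ℕ) : ℝ) * Real.log p / p)) (μ / 16)) := by
  obtain ⟨c1, c2, c3⟩ := one_div_twenty_sqrt_five
  obtain ⟨r1, r2⟩ := div_four_sqrt_two_mem hμ
  have hr0 : 0 < μ / (4 * Real.sqrt 2) := by positivity
  have hd0 : (0 : ℝ) ≤ d := d.cast_nonneg
  have hlt : ∀ w : EuclideanSpace ℝ (Fin d), ‖w‖ < Real.sqrt
      ((4 * ((d + 1 : ℕ) : ℝ) - 1) / (4 * ((d + 1 : ℕ) : ℝ))) → ‖w‖ < 1 :=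
    fun w hw => (one_div_le_liftHeight_sq hw.le).2
  refine ⟨fun w hw => ?_, fun w hw hw' => ?_, fun w hw hw' => ?_, ?_⟩
  · refine smul_id_le_hessian_chartObjective hμ.ne' Y (by linarith) fun v => ?_
    refine le_trans (mul_le_mul_of_nonneg_right ?_ (sq_nonneg _))
      (hz.le_inner_chartHess hp hθ hθ1 hμ hμθ (hw.trans r2) v)
    rw [div_le_div_iff₀ hμ (by positivity)]
    nlinarith [mul_pos hθ hμ]
  · rw [gradient_chartObjective hμ.ne' Y (by linarith), le_div_iff₀ (by linarith)]
    have := hz.le_inner_chartGrad hp (r1.trans hw) (hw'.trans c3)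
    nlinarith [mul_nonneg hθ.le (norm_nonneg w)]
  · have hw1 := (one_div_le_liftHeight_sq hw').2
    have hw2 : 1 / 2000 ≤ ‖w‖ ^ 2 := by rw [← c2]; gcongr
    have h := hz.inner_chartHess_le hp hw2 hw'
    have h3 : θ * ‖w‖ ^ 2 ≤ θ := mul_le_of_le_one_right hθ.le (pow_le_one₀ (norm_nonneg w) hw1.le)
    rw [hessian_chartObjective hμ.ne' Y hw1, div_le_iff₀ (by linarith)]
    linarith
  · obtain ⟨w, hw, hmin, huniq, hnorm⟩ := exists_unique_isLocalMinOn_ball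
      (g := chartObjective μ Y) (G := chartGrad μ fun k i => Y i k)
      (H := chartHess μ fun k i => Y i k) (r := μ / (4 * Real.sqrt 2))
      (ρ := 1 / (20 * Real.sqrt 5)) (m := θ / (20 * μ))
      (R := Real.sqrt ((4 * ((d + 1 : ℕ) : ℝ) - 1) / (4 * ((d + 1 : ℕ) : ℝ)))) hr0
      (by
        refine lt_of_lt_of_le (by linarith : _ < (1 / 2 : ℝ)) (Real.le_sqrt_of_sq_le ?_)
        rw [le_div_iff₀ (by positivity)]
        push_cast
        linarith)
      (by positivity)
      (fun x hx => hasGradientAt_chartObjective hμ.ne' Y (hlt x hx))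
      (fun x hx => hasFDerivAt_chartGrad μ _ (hlt x hx))
      (fun x hx v => hz.le_inner_chartHess hp hθ hθ1 hμ hμθ (hx.trans r2) v)
      (fun x hx hx' => lt_of_lt_of_le (mul_pos (by positivity) (by linarith))
        (hz.le_inner_chartGrad hp (r1.trans hx) (hx'.trans c3)))
      (fun x hx hx' => lt_of_le_of_lt (hz.inner_chartHess_le hp
        (by rw [← c2]; gcongr) hx'.le) (by linarith))
      (le_trans (by linarith : _ ≤ (1 / 400 : ℝ)) (le_of_sq_le_sq (by rw [c2]; norm_num) c1.le))
    refine ⟨w, hw, hmin, huniq, ?_⟩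
    have h1 := hnorm.trans (hz.norm_chartGrad_zero_le hp)
    -- Rounding `√20` up to 5 and dividing by the modulus `θ/(20μ)` gives the constant 100; the
    -- bound `θ/1600` on the root then yields `μ/16`.
    have h2 : Real.sqrt (20 * d * Real.log p / p) ≤
        5 * Real.sqrt (((d + 1 : ℕ) : ℝ) * Real.log p / p) := by
      rw [show (5 : ℝ) = Real.sqrt 25 by
        rw [show (25 : ℝ) = 5 ^ 2 by norm_num, Real.sqrt_sq (by norm_num)],
        ← Real.sqrt_mul (by norm_num)]
      refine Real.sqrt_le_sqrt ?_
      have hlp : 0 ≤ Real.log p / p := div_nonneg (Real.log_natCast_nonneg p) p.cast_nonneg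
      push_cast
      rw [mul_div_assoc, mul_div_assoc, ← mul_assoc]
      gcongr <;> linarith
    have h3 : ‖w‖ ≤ 100 * μ / θ * Real.sqrt (((d + 1 : ℕ) : ℝ) * Real.log p / p) := by
      have h4 := h1.trans h2
      rw [div_mul_eq_mul_div, div_le_iff₀ (by positivity)] at h4
      rw [div_mul_eq_mul_div, le_div_iff₀ hθ]
      linarith
    refine le_min h3 (h3.trans ?_)
    have h5 : Real.sqrt (((d + 1 : ℕ) : ℝ) * Real.log p / p) ≤ θ / 1600 :=
      Real.sqrt_le_iff.2 ⟨by positivity, hlog⟩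
    calc _ ≤ 100 * μ / θ * (θ / 1600) := by gcongr
      _ = μ / 16 := by field_simp; norm_num

end GoodLandscape

/-! ### Transfer of the law of the data and choice of the constants -/

section Transfer

variable {d p : ℕ}

theorem map_uncurry_pi_pi {ι κ : Type*} [Fintype ι] [Fintype κ] (m : Measure ℝ)
    [IsProbabilityMeasure m] :
    (Measure.pi fun _ : ι => Measure.pi fun _ : κ => m).map
      (MeasurableEquiv.curry ι κ ℝ).symm = Measure.pi fun _ : ι × κ => m := by
  refine (Measure.pi_eq fun s hs => ?_).symm
  rw [MeasurableEquiv.map_apply]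
  have e : (MeasurableEquiv.curry ι κ ℝ).symm ⁻¹' Set.univ.pi s =
      Set.univ.pi fun k => Set.univ.pi fun i => s (k, i) := by
    ext f
    simp [MeasurableEquiv.coe_curry_symm, Set.mem_pi]
  rw [e, Measure.pi_pi]
  simp_rw [Measure.pi_pi]
  exact (Fintype.prod_prod_type' fun k i => m (s (k, i))).symm

theorem hasLaw_columns {θ : unitInterval} {Ω : Type*} [MeasurableSpace Ω] {P : Measure Ω}
    [IsProbabilityMeasure P] {X₀ : Ω → Matrix (Fin (d + 1)) (Fin p) ℝ}
    (hlaw : ∀ i k, HasLaw (fun ω => X₀ ω i k) (bernoulliGaussian θ) P)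
    (hind : iIndepFun (fun (ik : Fin (d + 1) × Fin p) ω => X₀ ω ik.1 ik.2) P) :
    HasLaw (fun ω k i => X₀ ω i k) (columnsLaw θ d p) P := by
  have h := (hind.precomp (g := Prod.swap) Prod.swap_injective).hasLaw_pi
    (μ := fun _ : Fin p × Fin (d + 1) => bernoulliGaussian θ) (fun ki => hlaw ki.2 ki.1)
  have hm : HasLaw (MeasurableEquiv.curry (Fin p) (Fin (d + 1)) ℝ) (columnsLaw θ d p)
      (Measure.pi fun _ : Fin p × Fin (d + 1) => bernoulliGaussian θ) := by
    refine ⟨(MeasurableEquiv.measurable _).aemeasurable, ?_⟩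
    rw [← map_uncurry_pi_pi, Measure.map_map (MeasurableEquiv.measurable _)
      (MeasurableEquiv.measurable _)]
    simp
  exact hm.comp h

/-- The estimate uses outer measure only, so neither the failure event nor the exceptional set has
to be measurable. -/
theorem measure_le_of_hasLaw {Ω α : Type*} [MeasurableSpace Ω] [MeasurableSpace α] {P : Measure Ω}
    {Q : Measure α} [IsFiniteMeasure Q] {Z : Ω → α} (hZ : HasLaw Z Q P) {B : Set α} {s : Set Ω}
    {b : ℝ} (hB : Q.real B ≤ b) (hs : ∀ ω ∈ s, Z ω ∈ B) : P s ≤ ENNReal.ofReal b := by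
  calc P s ≤ P (Z ⁻¹' B) := measure_mono hs
    _ ≤ P.map Z B := Measure.le_map_apply hZ.aemeasurable B
    _ = ENNReal.ofReal (Q.real B) := by rw [hZ.map_eq, ofReal_measureReal]
    _ ≤ _ := ENNReal.ofReal_le_ofReal hB

end Transfer

/-! ### Sample size against the logarithmic cost of the nets. -/

section Parameters

/-- Turns a sample-size condition with `log A` into one with `log p`. With `y = p / (n A²)`, `log p`
splits as `log y + log n + 2 log A`; the first term is at most `2y/K` and the other three logarithms
at most `y/K` each. -/
theorem Real.mul_log_le_of_le {n A K p : ℝ} (hK : 1 ≤ K) (hn : 1 ≤ n) (hnA : n ≤ A) (hA : 3 ≤ A)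
    (hp : K ^ 2 * n * A ^ 2 * Real.log A ≤ p) : n * Real.log p ≤ 5 / K * (p / A ^ 2) := by
  have hK0 : 0 < K := by linarith
  have hn0 : 0 < n := by linarith
  have hA0 : 0 < A := by linarith
  have hL : 1 ≤ Real.log A := by
    rw [Real.le_log_iff_exp_le hA0]
    linarith [Real.exp_one_lt_d9]
  set y := p / (n * A ^ 2) with hy
  have hpy : p = y * (n * A ^ 2) := by rw [hy]; field_simp
  have hyL : K ^ 2 * Real.log A ≤ y := by
    rw [hy, le_div_iff₀ (by positivity)]; linarith
  have hyK : K ^ 2 ≤ y := by nlinarith [sq_nonneg K]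
  have hy0 : 0 < y := lt_of_lt_of_le (by positivity) hyK
  have h1 : Real.log y ≤ 2 * (y / K) := by
    have a1 := Real.log_le_sub_one_of_pos (show 0 < y / K by positivity)
    have a2 := Real.log_le_sub_one_of_pos hK0
    have a3 : K ≤ y / K := by rw [le_div_iff₀ hK0]; linarith
    rw [Real.log_div hy0.ne' hK0.ne'] at a1
    linarith
  have h2 : Real.log A ≤ y / K := by
    rw [le_div_iff₀ hK0]; nlinarith
  have h3 : Real.log n ≤ Real.log A := Real.log_le_log hn0 hnA
  have h4 : Real.log p = Real.log y + (Real.log n + 2 * Real.log A) := by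
    rw [hpy, Real.log_mul hy0.ne' (by positivity), Real.log_mul hn0.ne' (by positivity),
      Real.log_pow]
    norm_num
  have h5 : Real.log p ≤ 5 * (y / K) := by linarith
  calc n * Real.log p ≤ n * (5 * (y / K)) := by gcongr
    _ = 5 / K * (p / A ^ 2) := by rw [hpy]; field_simp

theorem pow_mul_exp_neg_le {p r s κ : ℝ} {m : ℕ} (hp : 0 < p) (hm : m * Real.log p ≤ κ * s)
    (hr : 2 * κ * s ≤ r) : p ^ m * Real.exp (-r) ≤ Real.exp (-(κ * s)) := by
  rw [← Real.exp_log (pow_pos hp m), Real.log_pow, ← Real.exp_add]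
  exact Real.exp_le_exp.2 (by linarith)

/-- The total failure probability. -/
theorem failure_probability_le {d p : ℕ} {θ μ M : ℝ} (hθ0 : 0 < θ) (hθ1 : θ ≤ 1) (hμ0 : 0 < μ)
    (hμ1 : μ ≤ 1) (hM : M = 905969664000000) (hp : (d : ℝ) + 1 ≤ p)
    (hlog : ((d : ℝ) + 1) * Real.log p ≤ 1 / (300 * M) * (p * μ ^ 2 * θ ^ 2 / (d + 1) ^ 2)) :
    (p : ℝ) ^ (150 * d) * Real.exp (-(p * (θ / 600))) +
        (p : ℝ) ^ (75 * d) * Real.exp (-(p * (θ ^ 2 / 691200))) +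
        (p : ℝ) ^ (75 * d) * Real.exp (-(p * ((θ / 64000) ^ 2 /
          (4 * (384 * (12 * (d + 1) / μ) ^ 2))))) +
        Real.exp (-(p * (1 / 216))) + 2 * d / (p : ℝ) ^ 10 +
        p * (d + 1) * (2 * Real.exp (-(p : ℝ) ^ 2 / 2)) ≤
      4 * (d + 1) / (p : ℝ) ^ 10 +
        6 * Real.exp (-(1 / (2 * M) * p * μ ^ 2 * θ ^ 2 / (d + 1) ^ 2)) := by
  have hd0 : (0 : ℝ) ≤ d := d.cast_nonneg
  have hp1 : (1 : ℝ) ≤ p := by linarith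
  have hp0 : (0 : ℝ) < p := by linarith
  have hM0 : 0 < M := by rw [hM]; norm_num
  have hl0 : 0 ≤ Real.log p := Real.log_nonneg hp1
  set s := p * μ ^ 2 * θ ^ 2 / ((d : ℝ) + 1) ^ 2 with hs
  have hs0 : 0 ≤ s := by positivity
  have hsθ2 : s ≤ p * θ ^ 2 := by
    rw [hs, div_le_iff₀ (by positivity), mul_assoc, mul_assoc]
    refine mul_le_mul_of_nonneg_left ?_ hp0.le
    have a1 : μ ^ 2 ≤ 1 := pow_le_one₀ hμ0.le hμ1
    have a2 : 1 ≤ ((d : ℝ) + 1) ^ 2 := one_le_pow₀ (by linarith)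
    nlinarith [sq_nonneg θ]
  have hsθ : s ≤ p * θ := hsθ2.trans (mul_le_mul_of_nonneg_left (by nlinarith) hp0.le)
  have hsp : s ≤ p := hsθ.trans (mul_le_of_le_one_right hp0.le hθ1)
  -- Every exponent is at least `s/M`. Half of it pays for the cardinality of the net, and the other
  -- half survives as the final rate.
  have hMs : ∀ c : ℝ, c ≤ 691200 → 0 < c → 2 * (1 / (2 * M)) * s ≤ s / c := fun c hc hc0 => by
    have e : 2 * (1 / (2 * M)) * s = s / M := by field_simp
    rw [e]
    refine div_le_div_of_nonneg_left hs0 hc0 ?_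
    rw [hM]; linarith
  have hlog' : ∀ m : ℕ, (m : ℝ) ≤ 150 * (d + 1) → m * Real.log p ≤ 1 / (2 * M) * s := fun m hm => by
    have e : 1 / (2 * M) * s = 150 * (1 / (300 * M) * s) := by field_simp; ring
    rw [e]
    nlinarith [mul_le_mul_of_nonneg_right hm hl0]
  have t1 := pow_mul_exp_neg_le (m := 150 * d) hp0 (hlog' _ (by push_cast; linarith))
    ((hMs 600 (by norm_num) (by norm_num)).trans
      (show s / 600 ≤ p * (θ / 600) by linarith))
  have t2 := pow_mul_exp_neg_le (m := 75 * d) hp0 (hlog' _ (by push_cast; linarith))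
    ((hMs 691200 (by norm_num) (by norm_num)).trans
      (show s / 691200 ≤ p * (θ ^ 2 / 691200) by linarith))
  -- The critical case: `M = 64000² * 4 * 384 * 12²` makes this exponent equal to `s/M`.
  have t3 := pow_mul_exp_neg_le (m := 75 * d) hp0 (hlog' _ (by push_cast; linarith))
    (show 2 * (1 / (2 * M)) * s ≤
        p * ((θ / 64000) ^ 2 / (4 * (384 * (12 * ((d : ℝ) + 1) / μ) ^ 2))) from le_of_eq (by
      rw [hs, hM]; field_simp; norm_num))
  have t4 := pow_mul_exp_neg_le (m := 0) hp0 (hlog' _ (by push_cast; linarith))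
    ((hMs 216 (by norm_num) (by norm_num)).trans
      (show s / 216 ≤ p * (1 / 216) by linarith))
  have t6 := pow_mul_exp_neg_le (m := 2) hp0 (hlog' _ (by push_cast; linarith))
    ((hMs 2 (by norm_num) (by norm_num)).trans
      (show s / 2 ≤ (p : ℝ) ^ 2 / 2 by nlinarith))
  have e : Real.exp (-(1 / (2 * M) * p * μ ^ 2 * θ ^ 2 / ((d : ℝ) + 1) ^ 2)) =
      Real.exp (-(1 / (2 * M) * s)) := by
    rw [hs]; congr 2; ring
  rw [e]
  -- This term counts twice, which together with the four other exponentials gives the factor 6.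
  have h6 : p * ((d : ℝ) + 1) * (2 * Real.exp (-(p : ℝ) ^ 2 / 2)) ≤
      2 * Real.exp (-(1 / (2 * M) * s)) := by
    rw [neg_div]
    have a1 : p * ((d : ℝ) + 1) ≤ (p : ℝ) ^ 2 := by nlinarith
    nlinarith [mul_le_mul_of_nonneg_right a1 (Real.exp_nonneg (-((p : ℝ) ^ 2 / 2)))]
  have h5 : 2 * (d : ℝ) / (p : ℝ) ^ 10 ≤ 4 * (d + 1) / (p : ℝ) ^ 10 := by
    gcongr <;> linarith
  rw [pow_zero, one_mul] at t4
  linarith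

end Parameters

/-! ### The main theorem: choice of constants and assembly. -/

theorem theorem1 :
    ∃ c C ca cb cc cd ce : ℝ,
      0 < c ∧ 0 < C ∧ 0 < ca ∧ 0 < cb ∧ 0 < cc ∧ 0 < cd ∧ 0 < ce ∧
      ∀ (n d p : ℕ) (θ : unitInterval) (μ : ℝ),
        n = d + 1 →
        0 < (θ : ℝ) → (θ : ℝ) < 1 / 2 →
        0 < μ → μ < min (ca * θ / n) (cb * (n : ℝ) ^ (-(5 / 4) : ℝ)) →
        C / (μ ^ 2 * θ ^ 2) * n ^ 3 * Real.log (n / (μ * θ)) ≤ (p : ℝ) →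
        ∀ (Ω : Type*) [MeasurableSpace Ω] (P : Measure Ω) [IsProbabilityMeasure P]
          (X₀ : Ω → Matrix (Fin (d + 1)) (Fin p) ℝ),
          (∀ i k, HasLaw (fun ω => X₀ ω i k) (bernoulliGaussian θ) P) →
          iIndepFun (fun (ik : Fin (d + 1) × Fin p) ω => X₀ ω ik.1 ik.2) P →
          P {ω | ¬
            ((∀ w : EuclideanSpace ℝ (Fin d), ‖w‖ ≤ μ / (4 * Real.sqrt 2) →
                (c * θ / μ) • ContinuousLinearMap.id ℝ (EuclideanSpace ℝ (Fin d)) ≤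
                  hessian (chartObjective μ (X₀ ω)) w) ∧
             (∀ w : EuclideanSpace ℝ (Fin d),
                μ / (4 * Real.sqrt 2) ≤ ‖w‖ → ‖w‖ ≤ 1 / (20 * Real.sqrt 5) →
                c * θ ≤ inner ℝ w (gradient (chartObjective μ (X₀ ω)) w) / ‖w‖) ∧
             (∀ w : EuclideanSpace ℝ (Fin d),
                1 / (20 * Real.sqrt 5) ≤ ‖w‖ →
                ‖w‖ ≤ Real.sqrt ((4 * (n : ℝ) - 1) / (4 * n)) →
                inner ℝ w (hessian (chartObjective μ (X₀ ω)) w w) / ‖w‖ ^ 2 ≤ -(c * θ)) ∧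
             (∃ wstar ∈ chartDomain d,
                IsLocalMinOn (chartObjective μ (X₀ ω)) (chartDomain d) wstar ∧
                (∀ w ∈ chartDomain d,
                  IsLocalMinOn (chartObjective μ (X₀ ω)) (chartDomain d) w → w = wstar) ∧
                ‖wstar‖ ≤ min (cc * μ / θ * Real.sqrt (n * Real.log p / p)) (μ / 16)))}
          ≤ ENNReal.ofReal
              (4 * n / (p : ℝ) ^ 10 + θ / ((n : ℝ) * p) ^ 7 + Real.exp (-(0.3 * θ * n * p))
                + cd * Real.exp (-(ce * p * μ ^ 2 * θ ^ 2 / (n : ℝ) ^ 2))) := by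
  obtain ⟨M, hM⟩ : ∃ M : ℝ, M = 905969664000000 := ⟨_, rfl⟩
  have hM0 : 0 < M := by rw [hM]; norm_num
  -- With `K = 1500 M` the logarithmic lemma yields `n log p ≤ s / (300 M)`, where `s = p μ² θ² /
  -- n²`. Multiplied by 150, the exponent of the pair net per dimension, this is the allowed `s /
  -- (2M)`.
  refine ⟨1 / 128000, (1500 * M) ^ 2, 1 / 64000, 1, 100, 6, 1 / (2 * M), by norm_num, by positivity,
    by norm_num, one_pos, by norm_num, by norm_num, by positivity, ?_⟩
  intro n d p θ μ hn hθ0 hθ hμ0 hμ hp Ω _ P _ X₀ hlaw hind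
  subst hn
  have hμ' := (lt_min_iff.1 hμ).1
  have hd0 : (0 : ℝ) ≤ d := d.cast_nonneg
  have hn1 : (1 : ℝ) ≤ (d : ℝ) + 1 := by linarith
  have hn0 : (0 : ℝ) < (d : ℝ) + 1 := by linarith
  rw [Nat.cast_add_one, lt_div_iff₀ hn0] at hμ'
  have hμθ : 80 * μ ≤ θ := by nlinarith
  have hμ1 : μ ≤ 1 := by linarith
  have hθμ0 : 0 < μ * θ := by positivity
  set A := ((d : ℝ) + 1) / (μ * θ) with hA
  have hθμ1 : μ * θ ≤ 1 / 256000 := by nlinarith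
  have hA1 : 256000 * ((d : ℝ) + 1) ≤ A := by
    rw [hA, le_div_iff₀ hθμ0]; nlinarith
  have hA0 : 0 < A := by linarith
  have hL : 1 ≤ Real.log A := by
    rw [Real.le_log_iff_exp_le hA0]
    linarith [Real.exp_one_lt_d9]
  have hp' : (1500 * M) ^ 2 * ((d : ℝ) + 1) * A ^ 2 * Real.log A ≤ p := by
    refine le_trans (le_of_eq ?_) hp
    rw [hA]
    push_cast
    field_simp
  have hpA : A ^ 2 ≤ p := by
    refine le_trans ?_ hp'
    have a1 : 1 ≤ (1500 * M) ^ 2 := one_le_pow₀ (by rw [hM]; norm_num)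
    have a2 : 1 ≤ (1500 * M) ^ 2 * ((d : ℝ) + 1) := one_le_mul_of_one_le_of_one_le a1 hn1
    rw [mul_right_comm]
    exact le_mul_of_one_le_left (sq_nonneg A) (one_le_mul_of_one_le_of_one_le a2 hL)
  have hpn : 256000 * A ≤ p := by nlinarith
  have hp0 : (0 : ℝ) < p := by linarith
  have hlog := Real.mul_log_le_of_le (by rw [hM]; norm_num) hn1 (by linarith) (by linarith) hp'
  have e1 : (5 : ℝ) / (1500 * M) * (p / A ^ 2) =
      1 / (300 * M) * (p * μ ^ 2 * θ ^ 2 / ((d : ℝ) + 1) ^ 2) := by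
    rw [hA]; field_simp; norm_num
  rw [e1] at hlog
  obtain ⟨B, hB, hgood⟩ := exists_exceptional_set_goodColumns (d := d) (p := p) hθ0 hθ.le hμ0
    (by linarith) (le_trans (le_of_eq (by rw [hA]; ring)) hpn)
  have hBle := hB.trans (failure_probability_le hθ0 (by linarith) hμ0 hμ1 hM (by linarith) hlog)
  refine measure_le_of_hasLaw (hasLaw_columns hlaw hind) (hBle.trans ?_) fun ω hω => ?_
  -- The argument already gives a bound by the first and last terms; the two middle ones are merely
  -- nonnegative.
  · have h1 : 0 ≤ (θ : ℝ) / (((d + 1 : ℕ) : ℝ) * p) ^ 7 := by positivity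
    have h2 := Real.exp_nonneg (-(0.3 * (θ : ℝ) * ((d + 1 : ℕ) : ℝ) * p))
    push_cast at h1 h2 ⊢
    linarith
  · by_contra hωB
    refine hω ((hgood _ hωB).landscape (by exact_mod_cast hp0) hθ0 (by linarith) hμ0 hμθ ?_)
    rw [div_le_iff₀ hp0]
    push_cast
    refine hlog.trans ?_
    have a1 : p * μ ^ 2 * (θ : ℝ) ^ 2 / ((d : ℝ) + 1) ^ 2 ≤ p * θ ^ 2 := by
      rw [div_le_iff₀ (by positivity), mul_assoc, mul_assoc]
      refine mul_le_mul_of_nonneg_left ?_ hp0.le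
      have a2 : μ ^ 2 ≤ 1 := pow_le_one₀ hμ0.le hμ1
      have a3 : 1 ≤ ((d : ℝ) + 1) ^ 2 := one_le_pow₀ hn1
      nlinarith [sq_nonneg (θ : ℝ)]
    have a4 : 1 / (300 * M) ≤ (1 / 1600 : ℝ) ^ 2 := by rw [hM]; norm_num
    have a5 : (0 : ℝ) ≤ p * θ ^ 2 := by positivity
    calc _ ≤ (1 / 1600 : ℝ) ^ 2 * (p * (θ : ℝ) ^ 2) := by gcongr
      _ = _ := by ring
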